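/- Let $\mathcal J$ be a finite index set and let $\{X_i\}_{i\in\mathcal J}$ be square-integrable real random variables on a probability space with $\mathbb E X_i=0$ for all $i$. Let $A_i\subset B_i\subset\mathcal J$ ($i\in\mathcal J$) be sets such that, for every $i\in\mathcal J$, (LD1) $X_i$ is independent of $\{X_j: j\notin A_i\}$; (LD2) $\{X_j: j\in A_i\}$ is independent of $\{X_j: j\notin B_i\}$. Put $S=\sum_{i\in\mathcal J}X_i$, $Y_i=\sum_{j\in A_i}X_j$, $\bar X=|\mathcal J|^{-1}\sum_{i\in\mathcal J}X_i$, $\bar Y=|\mathcal J|^{-1}\sum_{i\in\mathcal J}Y_i$, $$V=\sqrt{\Bigl(\sum_{i\in\mathcal J}(X_iY_i-\bar X\bar Y)\Bigr)_+},\qquad W=S/V,$$ where $(x)_+=\max(x,0)$ and where, on the event $\{V=0\}$, $W$ may be given any measurable real values. Let $\sigma=(\operatorname{Var}S)^{1/2}$ and assume $\sigma>0$. Let $\kappa$ be any real number with $$\kappa\ \ge\ \max_{i\in\mathcal J}\ \max\bigl\{|\{j: B_i\cap A_j\neq\emptyset\}|,\ |\{j: i\in B_j\}|\bigr\},$$ and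 set, with $I(\cdot)$ the indicator function, $$\beta_0=\sum_{i\in\mathcal J}\mathbb P(|X_i|>\sigma/\kappa),\qquad \beta_2=\frac1{\sigma^2}\sum_{i\in\mathcal J}\mathbb E\bigl\{|X_i|^2 I(|X_i|>\sigma/\kappa)\bigr\},$$ $$\beta_3=\frac1{\sigma^3}\sum_{i\in\mathcal J}\mathbb E\bigl\{|X_i|^3 I(|X_i|\le\sigma/\kappa)\bigr\},\qquad \theta=\frac1{\sigma^2}\sum_{i\in\mathcal J}\sum_{j\in A_i}\mathbb E\bigl|X_iX_j I(|X_i|\le\sigma/\kappa,\ |X_j|\le\sigma/\kappa)\bigr|.$$ Then $$\sup_{z\in\mathbb R}\bigl|\mathbb P(W\le z)-\Phi(z)\bigr|\le C\bigl\{(1+\theta)\kappa^2\beta_3+\kappa\beta_2+\beta_0\bigr\}+C\kappa^{1/2}(\theta+1)|\mathcal J|^{-1/2},$$ where $C>0$ is an absolute constant (depending on nothing) and $\Phi$ is the standard normal distribution function. -/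

import Mathlib

open MeasureTheory ProbabilityTheory

namespace LocalDep

noncomputable section

/-- (LD1): for every `i`, the variable `X i` is independent of the family `{X j : j ∉ A i}`. -/
def LD1 {J Ω : Type*} [MeasurableSpace Ω] (μ : Measure Ω) (X : J → Ω → ℝ)
    (A : J → Finset J) : Prop :=
  ∀ i, IndepFun (X i) (fun ω (j : {j : J // j ∉ A i}) => X j ω) μ

/-- (LD2): for every `i`, `A i ⊆ B i` and the family `{X j : j ∈ A i}` is independent of the
family `{X j : j ∉ B i}`. -/
def LD2 {J Ω : Type*} [MeasurableSpace Ω] (μ : Measure Ω) (X : J → Ω → ℝ)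
    (A B : J → Finset J) : Prop :=
  ∀ i, A i ⊆ B i ∧
    IndepFun (fun ω (j : {j : J // j ∈ A i}) => X j ω)
      (fun ω (j : {j : J // j ∉ B i}) => X j ω) μ

/-- `κ` is at least `|{j : B i ∩ A j ≠ ∅}|` and at least `|{j : i ∈ B j}|` for every `i`. -/
def KappaBound {J : Type*} [Fintype J] [DecidableEq J] (A B : J → Finset J) (κ : ℝ) : Prop :=
  ∀ i, ((Finset.univ.filter fun j => (B i ∩ A j).Nonempty).card : ℝ) ≤ κ ∧
    ((Finset.univ.filter fun j => i ∈ B j).card : ℝ) ≤ κ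

/-- `S = ∑ i, X i`. -/
def S {J Ω : Type*} [Fintype J] (X : J → Ω → ℝ) (ω : Ω) : ℝ :=
  ∑ i, X i ω

/-- `Y i = ∑ j ∈ A i, X j`. -/
def Y {J Ω : Type*} (X : J → Ω → ℝ) (A : J → Finset J) (i : J) (ω : Ω) : ℝ :=
  ∑ j ∈ A i, X j ω

/-- The average of a finite family of random variables. -/
def avg {J Ω : Type*} [Fintype J] (Z : J → Ω → ℝ) (ω : Ω) : ℝ :=
  (∑ i, Z i ω) / (Fintype.card J : ℝ)

/-- `V`, the square root of the positive part of `∑ i, (X i * Y i - X̄ * Ȳ)`. -/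
def V {J Ω : Type*} [Fintype J] (X : J → Ω → ℝ) (A : J → Finset J) (ω : Ω) : ℝ :=
  Real.sqrt (max (∑ i, (X i ω * Y X A i ω - avg X ω * avg (Y X A) ω)) 0)

open Classical in
/-- The self-normalized sum `W = S / V`. Where `V = 0` the quotient is undefined, and the value
of `W` is an arbitrary `w₀`; `w₀ = 0` is the convention `x / 0 = 0`. -/
def W {J Ω : Type*} [Fintype J] (X : J → Ω → ℝ) (A : J → Finset J) (w₀ : Ω → ℝ) (ω : Ω) : ℝ :=
  if V X A ω = 0 then w₀ ω else S X ω / V X A ω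

/-- `σ = (Var S)^{1/2}`. -/
def sigma {J Ω : Type*} [Fintype J] [MeasurableSpace Ω] (μ : Measure Ω) (X : J → Ω → ℝ) : ℝ :=
  Real.sqrt (variance (S X) μ)

/-- `β₀ = ∑ i, P(|X i| > σ / κ)`. -/
def beta0 {J Ω : Type*} [Fintype J] [MeasurableSpace Ω] (μ : Measure Ω) (X : J → Ω → ℝ)
    (κ : ℝ) : ℝ :=
  ∑ i, μ.real {ω | sigma μ X / κ < |X i ω|}

/-- `β₂ = σ⁻² ∑ i, E{|X i|² 1(|X i| > σ / κ)}`. -/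
def beta2 {J Ω : Type*} [Fintype J] [MeasurableSpace Ω] (μ : Measure Ω) (X : J → Ω → ℝ)
    (κ : ℝ) : ℝ :=
  1 / sigma μ X ^ 2 *
    ∑ i, ∫ ω, {ω | sigma μ X / κ < |X i ω|}.indicator (fun ω => |X i ω| ^ 2) ω ∂μ

/-- `β₃ = σ⁻³ ∑ i, E{|X i|³ 1(|X i| ≤ σ / κ)}`. -/
def beta3 {J Ω : Type*} [Fintype J] [MeasurableSpace Ω] (μ : Measure Ω) (X : J → Ω → ℝ)
    (κ : ℝ) : ℝ :=
  1 / sigma μ X ^ 3 *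
    ∑ i, ∫ ω, {ω | |X i ω| ≤ sigma μ X / κ}.indicator (fun ω => |X i ω| ^ 3) ω ∂μ

/-- `θ = σ⁻² ∑ i, ∑ j ∈ A i, E|X i X j 1(|X i| ≤ σ / κ, |X j| ≤ σ / κ)|`. -/
def theta {J Ω : Type*} [Fintype J] [MeasurableSpace Ω] (μ : Measure Ω) (X : J → Ω → ℝ)
    (A : J → Finset J) (κ : ℝ) : ℝ :=
  1 / sigma μ X ^ 2 *
    ∑ i, ∑ j ∈ A i, ∫ ω, |{ω | |X i ω| ≤ sigma μ X / κ ∧ |X j ω| ≤ sigma μ X / κ}.indicator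
      (fun ω => X i ω * X j ω) ω| ∂μ

end

end LocalDep

/-! After division by `σ`, each `X i` is truncated at `1 / κ`; write `ξ` for the result. The
truncation acts with probability at most `β₀`, moves the means by at most `b = κ β₂` in total and
the mean of `U = ∑ ξ i * Y i` (`quad`) by at most `2 b`. In return `κ |ξ i| ≤ 1`, so neighbourhood
sums are at most 1, and the cubic errors are bounded by `κ² ∑ |ξ i|³` by AM–GM and counting; `r`
bounds the mean of that sum.

Because `∑ X̄ Ȳ = S Ȳ`, off a small event `W = S / √(U - S Ȳ)`. With `n = |J|`, the second moment of
`Ȳ` is at most `(κ/n)² (θ + b²)`, so `|Ȳ| ≤ ρ = √(κ/n)` outside an event of probability at most `ρ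
(1 + θ)`. Replacing `U - S Ȳ` by `U` then moves `W` by at most `3 ρ W²`, which Gaussian decay turns
into `O(ρ)` (`abs_measureReal_sub_Phi_le`).

It remains to treat `T = S / q(U)`, with `q` a root truncated away from zero and infinity
(`abs_selfStat_sub_Phi_le`). Stein's method is applied to `f(S / q(U)) / q(U)`, where `f` solves the
equation for `(-∞, z]`. Deleting from `S` and `U` all terms touching `A j` leaves a function
independent of `ξ j`, which contributes only through the mean of `ξ j`. The deleted part of `U`
costs a cubic error. The deleted part of `S` gives `(U / q²) f'(T)`, where `U / q² - 1` is quadratic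
in `U - 1`, and the second moment of `U - 1` is `O(r + b)`. The jump of `f'` at `z` leaves `∑ E |ξ i
Y i| 1{|S - z q(U)| ≤ 4 |Y i|}`.

This last sum is the heart (`sum_integral_wt_near_le`). The primitive of a trapezoid with ramps of
width `α` is used as test function. Its leave-one-out increments are integrals of the trapezoid
against the random kernel `M(t) = ∑ ξ j * kern (Y j) t`, whose total mass is `U`, close to 1.
Replacing the shifted trapezoid by the unshifted one costs the squared fluctuation of `M`, which
decouples from the weight `|ξ i Y i|` up to a neighbourhood, and a term with the mean kernel. In
that term a shift by `t` is paid for by the same weighted window sums at other centres, and `∫ |t|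
|E M(t)| dt ≤ r`. So the window bound is controlled by itself times a multiple of `r / α`; for `α =
96 r` this contracts, and iteration gives `O((1 + θ) r)`. The factor `θ` is the total weight `∑ E |ξ
i Y i|`. -/

open MeasureTheory ProbabilityTheory
-- The normal distribution and the solution of Stein's equation.
namespace LocalDep

noncomputable section

/-- The standard normal distribution function. -/
def Phi (x : ℝ) : ℝ := cdf (gaussianReal 0 1) x

/-- The reciprocal of the standard normal density. -/
def invPdf (x : ℝ) : ℝ := Real.sqrt (2 * Real.pi) * Real.exp (x ^ 2 / 2)

lemma invPdf_mul_pdf (x : ℝ) : invPdf x * gaussianPDFReal 0 1 x = 1 := by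
  have h : Real.sqrt (2 * Real.pi) ≠ 0 := by positivity
  simp only [invPdf, gaussianPDFReal, NNReal.coe_one, mul_one, sub_zero]
  rw [show Real.sqrt (2 * Real.pi) * Real.exp (x ^ 2 / 2)
      * ((Real.sqrt (2 * Real.pi))⁻¹ * Real.exp (-x ^ 2 / 2))
    = (Real.sqrt (2 * Real.pi) * (Real.sqrt (2 * Real.pi))⁻¹)
      * (Real.exp (x ^ 2 / 2) * Real.exp (-x ^ 2 / 2)) by ring, ← Real.exp_add,
    mul_inv_cancel₀ h, show x ^ 2 / 2 + -x ^ 2 / 2 = 0 by ring]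
  simp

lemma invPdf_pos (x : ℝ) : 0 < invPdf x := by unfold invPdf; positivity

lemma invPdf_neg (x : ℝ) : invPdf (-x) = invPdf x := by simp [invPdf]

lemma hasDerivAt_invPdf (x : ℝ) : HasDerivAt invPdf (x * invPdf x) x := by
  have h := (((hasDerivAt_pow 2 x).div_const 2).exp).const_mul (Real.sqrt (2 * Real.pi))
  refine h.congr_deriv ?_
  simp [invPdf]; ring

lemma Phi_nonneg (x : ℝ) : 0 ≤ Phi x := cdf_nonneg _ _

lemma Phi_le_one (x : ℝ) : Phi x ≤ 1 := cdf_le_one _ _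

lemma Phi_mono : Monotone Phi := monotone_cdf _

lemma continuous_pdf : Continuous (gaussianPDFReal 0 1) := by
  unfold gaussianPDFReal; fun_prop

lemma Phi_eq_integral (x : ℝ) : Phi x = ∫ t in Set.Iic x, gaussianPDFReal 0 1 t := by
  rw [Phi, cdf_eq_real, measureReal_def, gaussianReal_apply_eq_integral _ one_ne_zero,
    ENNReal.toReal_ofReal]
  exact integral_nonneg fun t => gaussianPDFReal_nonneg _ _ _

lemma hasDerivAt_Phi (x : ℝ) : HasDerivAt Phi (gaussianPDFReal 0 1 x) x := by
  have hint := integrable_gaussianPDFReal 0 1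
  have h : ∀ y, Phi y = Phi 0 + ∫ t in (0 : ℝ)..y, gaussianPDFReal 0 1 t := by
    intro y
    rw [Phi_eq_integral, Phi_eq_integral,
      ← intervalIntegral.integral_Iic_sub_Iic hint.integrableOn hint.integrableOn]
    ring
  have h2 : HasDerivAt (fun y => Phi 0 + ∫ t in (0 : ℝ)..y, gaussianPDFReal 0 1 t)
      (gaussianPDFReal 0 1 x) x :=
    (intervalIntegral.integral_hasDerivAt_right (hint.intervalIntegrable)
      (continuous_pdf.stronglyMeasurableAtFilter _ _) continuous_pdf.continuousAt).const_add _
  exact h2.congr_of_eventuallyEq (Filter.Eventually.of_forall h)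

lemma continuous_Phi : Continuous Phi :=
  continuous_iff_continuousAt.2 fun x => (hasDerivAt_Phi x).continuousAt

lemma pdf_eq (x : ℝ) :
    gaussianPDFReal 0 1 x = (Real.sqrt (2 * Real.pi))⁻¹ * Real.exp (-x ^ 2 / 2) := by
  simp [gaussianPDFReal]

lemma hasDerivAt_pdf (x : ℝ) :
    HasDerivAt (gaussianPDFReal 0 1) (-x * gaussianPDFReal 0 1 x) x := by
  have h := ((((hasDerivAt_pow 2 x).neg).div_const 2).exp).const_mul (Real.sqrt (2 * Real.pi))⁻¹
  have e : gaussianPDFReal 0 1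
      = fun x => (Real.sqrt (2 * Real.pi))⁻¹ * Real.exp (-x ^ 2 / 2) := funext pdf_eq
  rw [e]
  refine h.congr_deriv ?_
  simp; ring

lemma Phi_neg (x : ℝ) : Phi (-x) = 1 - Phi x := by
  have h : (gaussianReal 0 1).map (fun x => -x) = gaussianReal 0 1 := by
    rw [gaussianReal_map_neg]; simp
  have : NullSingletonClass (gaussianReal 0 1) := nullSingletonClass_gaussianReal one_ne_zero
  rw [Phi, Phi, cdf_eq_real, cdf_eq_real, ← probReal_compl_eq_one_sub measurableSet_Iic]
  conv_lhs => rw [← h]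
  rw [measureReal_def, Measure.map_apply measurable_neg measurableSet_Iic, ← measureReal_def]
  have e : (fun x : ℝ => -x) ⁻¹' Set.Iic (-x) = Set.Ici x := by ext; simp
  rw [e, Set.compl_Iic, measureReal_def, measureReal_def, measure_congr Ioi_ae_eq_Ici]

lemma tendsto_pdf_atTop : Filter.Tendsto (gaussianPDFReal 0 1) Filter.atTop (nhds 0) := by
  have e : gaussianPDFReal 0 1
      = fun x => (Real.sqrt (2 * Real.pi))⁻¹ * Real.exp (-x ^ 2 / 2) := funext pdf_eq
  rw [e, ← mul_zero (Real.sqrt (2 * Real.pi))⁻¹]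
  refine Filter.Tendsto.const_mul _ (Real.tendsto_exp_atBot.comp ?_)
  have : Filter.Tendsto (fun x : ℝ => x ^ 2 / 2) Filter.atTop Filter.atTop :=
    (Filter.tendsto_pow_atTop two_ne_zero).atTop_div_const two_pos
  refine (Filter.tendsto_neg_atTop_atBot.comp this).congr fun x => ?_
  simp; ring

/-- Mills' inequality. -/
lemma mul_one_sub_Phi_le (x : ℝ) : x * (1 - Phi x) ≤ gaussianPDFReal 0 1 x := by
  set D : ℝ → ℝ := fun y => gaussianPDFReal 0 1 y - x * (1 - Phi y) with hD
  have hd : ∀ y, HasDerivAt D ((x - y) * gaussianPDFReal 0 1 y) y := fun y => by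
    refine ((hasDerivAt_pdf y).sub (((hasDerivAt_Phi y).const_sub 1).const_mul x)).congr_deriv ?_
    ring
  have hanti : AntitoneOn D (Set.Ici x) := by
    refine antitoneOn_of_deriv_nonpos (convex_Ici x)
      (fun y _ => (hd y).continuousAt.continuousWithinAt)
      (fun y _ => (hd y).differentiableAt.differentiableWithinAt) fun y hy => ?_
    rw [interior_Ici] at hy
    rw [(hd y).deriv]
    exact mul_nonpos_of_nonpos_of_nonneg (by linarith [Set.mem_Ioi.1 hy])
      (gaussianPDFReal_nonneg _ _ _)
  have hlim : Filter.Tendsto D Filter.atTop (nhds 0) := by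
    have h1 : Filter.Tendsto Phi Filter.atTop (nhds 1) := tendsto_cdf_atTop _
    have := tendsto_pdf_atTop.sub ((h1.const_sub 1).const_mul x)
    simpa using this
  have : 0 ≤ D x := by
    refine le_of_tendsto hlim ?_
    filter_upwards [Filter.eventually_ge_atTop x] with y hy
    exact hanti (Set.mem_Ici.2 le_rfl) hy hy
  simp only [hD] at this
  linarith

lemma mul_invPdf_mul_one_sub_Phi_le (x : ℝ) : x * (invPdf x * (1 - Phi x)) ≤ 1 := by
  have h := mul_le_mul_of_nonneg_left (mul_one_sub_Phi_le x) (invPdf_pos x).le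
  rw [invPdf_mul_pdf] at h
  linarith

/-- Mills' inequality gives 1 for `x ≥ 1`; on `[0, 1)` the crude bounds `√(2π) ≤ 3` and `exp (x²/2)
≤ 2` give 6. -/
lemma invPdf_mul_one_sub_Phi_le {x : ℝ} (hx : 0 ≤ x) : invPdf x * (1 - Phi x) ≤ 6 := by
  have h0 : 0 ≤ invPdf x * (1 - Phi x) :=
    mul_nonneg (invPdf_pos x).le (by linarith [Phi_le_one x])
  rcases le_or_gt 1 x with h | h
  · nlinarith [mul_invPdf_mul_one_sub_Phi_le x]
  · have h1 : Real.exp (x ^ 2 / 2) ≤ 2 := by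
      have h2 : Real.exp (x ^ 2 / 2) ≤ Real.exp (1 / 2) := Real.exp_le_exp.2 (by nlinarith)
      have h3 : Real.exp (1 / 2) ^ 2 = Real.exp 1 := by rw [← Real.exp_nat_mul]; norm_num
      nlinarith [Real.exp_one_lt_d9, Real.exp_pos (1 / 2)]
    have h2 : Real.sqrt (2 * Real.pi) ≤ 3 := by
      rw [Real.sqrt_le_left (by norm_num)]
      nlinarith [Real.pi_lt_four]
    have h3 : invPdf x ≤ 6 := by
      unfold invPdf
      nlinarith [Real.exp_pos (x ^ 2 / 2), Real.sqrt_nonneg (2 * Real.pi)]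
    nlinarith [Phi_nonneg x, invPdf_pos x, Phi_le_one x]

/-- The solution of Stein's equation for the half-line `(-∞, z]`. -/
def steinSol (z w : ℝ) : ℝ := invPdf w * (Phi (min w z) * (1 - Phi (max w z)))

lemma steinSol_nonneg (z w : ℝ) : 0 ≤ steinSol z w :=
  mul_nonneg (invPdf_pos w).le
    (mul_nonneg (Phi_nonneg _) (by linarith [Phi_le_one (max w z)]))

lemma steinSol_le_upper (z w : ℝ) : steinSol z w ≤ invPdf w * (1 - Phi w) := by
  refine mul_le_mul_of_nonneg_left ?_ (invPdf_pos w).le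
  have := Phi_mono (le_max_left w z)
  nlinarith [Phi_nonneg (min w z), Phi_le_one (min w z), Phi_le_one (max w z), Phi_le_one w]

lemma steinSol_le_lower (z w : ℝ) : steinSol z w ≤ invPdf (-w) * (1 - Phi (-w)) := by
  rw [invPdf_neg, Phi_neg]
  refine mul_le_mul_of_nonneg_left ?_ (invPdf_pos w).le
  have := Phi_mono (min_le_left w z)
  nlinarith [Phi_nonneg (min w z), Phi_nonneg (max w z), Phi_le_one (max w z), Phi_le_one w]

lemma abs_steinSol_le (z w : ℝ) : |steinSol z w| ≤ 6 := by
  rw [abs_of_nonneg (steinSol_nonneg z w)]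
  rcases le_total 0 w with h | h
  · exact (steinSol_le_upper z w).trans (invPdf_mul_one_sub_Phi_le h)
  · exact (steinSol_le_lower z w).trans (invPdf_mul_one_sub_Phi_le (by linarith))

lemma abs_mul_steinSol_le (z w : ℝ) : |w * steinSol z w| ≤ 1 := by
  rw [abs_mul, abs_of_nonneg (steinSol_nonneg z w)]
  rcases le_total 0 w with h | h
  · rw [abs_of_nonneg h]
    exact (mul_le_mul_of_nonneg_left (steinSol_le_upper z w) h).trans
      (mul_invPdf_mul_one_sub_Phi_le w)
  · rw [abs_of_nonpos h]
    exact (mul_le_mul_of_nonneg_left (steinSol_le_lower z w) (by linarith)).trans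
      (mul_invPdf_mul_one_sub_Phi_le (-w))

lemma continuous_steinSol (z : ℝ) : Continuous (steinSol z) := by
  have h1 : Continuous invPdf := by unfold invPdf; fun_prop
  have h2 := continuous_Phi
  unfold steinSol
  fun_prop

/-- The derivative of `steinSol`, away from the point `z`. -/
def steinDeriv (z w : ℝ) : ℝ := w * steinSol z w + ((if w ≤ z then 1 else 0) - Phi z)

lemma abs_steinDeriv_le (z w : ℝ) : |steinDeriv z w| ≤ 2 := by
  have h := abs_le.1 (abs_mul_steinSol_le z w)
  have h1 := Phi_nonneg z
  have h2 := Phi_le_one z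
  unfold steinDeriv
  rw [abs_le]
  split_ifs <;> constructor <;> linarith

lemma measurable_steinDeriv (z : ℝ) : Measurable (steinDeriv z) := by
  have := (continuous_steinSol z).measurable
  have h : Measurable fun w : ℝ => (if w ≤ z then (1 : ℝ) else 0) :=
    Measurable.ite measurableSet_Iic measurable_const measurable_const
  unfold steinDeriv
  fun_prop

/-- The solution has a corner at `z`, so it is differentiated on each closed half-line separately.
At `z` itself `steinDeriv` takes the left-hand value. -/
lemma hasDerivWithinAt_steinSol_Iic {z w : ℝ} (hw : w ≤ z) :
    HasDerivWithinAt (steinSol z) (steinDeriv z w) (Set.Iic z) w := by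
  have h : HasDerivAt (fun w => invPdf w * (Phi w * (1 - Phi z))) (steinDeriv z w) w := by
    refine ((hasDerivAt_invPdf w).mul ((hasDerivAt_Phi w).mul_const _)).congr_deriv ?_
    rw [steinDeriv, steinSol, min_eq_left hw, max_eq_right hw, if_pos hw]
    linear_combination (1 - Phi z) * invPdf_mul_pdf w
  exact h.hasDerivWithinAt.congr
    (fun y (hy : y ≤ z) => by rw [steinSol, min_eq_left hy, max_eq_right hy])
    (by rw [steinSol, min_eq_left hw, max_eq_right hw])

lemma hasDerivWithinAt_steinSol_Ici {z w : ℝ} (hw : z ≤ w) :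
    HasDerivWithinAt (steinSol z) (w * steinSol z w - Phi z) (Set.Ici z) w := by
  have h : HasDerivAt (fun w => invPdf w * (Phi z * (1 - Phi w)))
      (w * steinSol z w - Phi z) w := by
    refine ((hasDerivAt_invPdf w).mul
      (((hasDerivAt_Phi w).const_sub 1).const_mul _)).congr_deriv ?_
    rw [steinSol, min_eq_right hw, max_eq_left hw]
    linear_combination -(Phi z) * invPdf_mul_pdf w
  exact h.hasDerivWithinAt.congr
    (fun y (hy : z ≤ y) => by rw [steinSol, min_eq_right hy, max_eq_left hy])
    (by rw [steinSol, min_eq_right hw, max_eq_left hw])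

lemma abs_mul_steinSol_sub_Phi_le (z w : ℝ) : |w * steinSol z w - Phi z| ≤ 2 := by
  have h := abs_le.1 (abs_mul_steinSol_le z w)
  rw [abs_le]
  constructor <;> linarith [Phi_nonneg z, Phi_le_one z]

/-- The mean value inequality on each side of `z`, glued at `z`. -/
lemma abs_steinSol_sub_le (z x y : ℝ) : |steinSol z x - steinSol z y| ≤ 2 * |x - y| := by
  have hI : ∀ x ≤ z, ∀ y ≤ z, |steinSol z x - steinSol z y| ≤ 2 * |x - y| :=
    fun x hx y hy => (convex_Iic z).norm_image_sub_le_of_norm_hasDerivWithin_le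
      (fun w hw => hasDerivWithinAt_steinSol_Iic hw) (fun w _ => abs_steinDeriv_le z w) hy hx
  have hJ : ∀ x, z ≤ x → ∀ y, z ≤ y → |steinSol z x - steinSol z y| ≤ 2 * |x - y| :=
    fun x hx y hy => (convex_Ici z).norm_image_sub_le_of_norm_hasDerivWithin_le
      (fun w hw => hasDerivWithinAt_steinSol_Ici hw)
      (fun w _ => abs_mul_steinSol_sub_Phi_le z w) hy hx
  rcases le_total x z with hx | hx <;> rcases le_total y z with hy | hy
  · exact hI x hx y hy
  · have h1 := hI x hx z le_rfl
    have h2 := hJ z le_rfl y hy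
    have h3 := abs_sub_le (steinSol z x) (steinSol z z) (steinSol z y)
    rw [abs_of_nonpos (a := x - z) (by linarith)] at h1
    rw [abs_of_nonpos (a := z - y) (by linarith)] at h2
    rw [abs_of_nonpos (a := x - y) (by linarith)]
    linarith
  · have h1 := hJ x hx z le_rfl
    have h2 := hI z le_rfl y hy
    have h3 := abs_sub_le (steinSol z x) (steinSol z z) (steinSol z y)
    rw [abs_of_nonneg (a := x - z) (by linarith)] at h1
    rw [abs_of_nonneg (a := z - y) (by linarith)] at h2
    rw [abs_of_nonneg (a := x - y) (by linarith)]
    linarith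
  · exact hJ x hx y hy

lemma abs_mul_steinSol_sub_le (z x y : ℝ) :
    |y * steinSol z y - x * steinSol z x| ≤ (6 + 2 * |x|) * |y - x| := by
  have e : y * steinSol z y - x * steinSol z x
    = steinSol z y * (y - x) + x * (steinSol z y - steinSol z x) := by ring
  rw [e]
  refine (abs_add_le _ _).trans ?_
  rw [abs_mul, abs_mul]
  have h1 := abs_steinSol_le z y
  have h2 := abs_steinSol_sub_le z y x
  nlinarith [abs_nonneg x, abs_nonneg (y - x)]

/-- First-order expansion of `steinSol`, with the error caused by the jump of its derivative. -/
lemma abs_steinSol_expansion_le (z x h : ℝ) :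
    |steinSol z x - steinSol z (x - h) - h * steinDeriv z x|
      ≤ (6 + 2 * |x|) * h ^ 2 + 4 * |h| * (if |x - z| ≤ |h| then 1 else 0) := by
  by_cases hz : |x - z| ≤ |h|
  · rw [if_pos hz]
    have h1 := abs_steinSol_sub_le z x (x - h)
    have h2 : |h * steinDeriv z x| ≤ |h| * 2 := by
      rw [abs_mul]; exact mul_le_mul_of_nonneg_left (abs_steinDeriv_le z x) (abs_nonneg h)
    rw [show x - (x - h) = h by ring] at h1
    have h3 := abs_sub (steinSol z x - steinSol z (x - h)) (h * steinDeriv z x)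
    have h4 : 0 ≤ (6 + 2 * |x|) * h ^ 2 := by positivity
    linarith
  · rw [if_neg hz]
    push Not at hz
    set s : Set ℝ := Set.uIcc (x - h) x with hs
    have hle : ∀ y ∈ s, |y - x| ≤ |h| := fun y hy => by
      have := Set.abs_sub_right_of_mem_uIcc hy
      rw [abs_sub_comm] at this
      simpa using this
    have hconv : Convex ℝ s := convex_uIcc _ _
    -- The segment from `x - h` to `x` stays on one side of `z`, so the indicators in the
    -- derivatives at `y` and at `x` cancel and only the Lipschitz part `w * steinSol z w` is left.
    have key : ∀ y ∈ s, HasDerivWithinAt (fun y => steinSol z y - y * steinDeriv z x)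
        (y * steinSol z y - x * steinSol z x) s y := by
      intro y hy
      have hyx := hle y hy
      have hlin := ((hasDerivAt_id y).mul_const (steinDeriv z x)).hasDerivWithinAt (s := s)
      rcases lt_or_ge x z with hxz | hxz
      · have hsz : s ⊆ Set.Iic z := fun u hu => by
          have h1 := hle u hu
          rw [abs_of_neg (a := x - z) (by linarith)] at hz
          have := (abs_le.1 h1).2
          exact Set.mem_Iic.2 (by linarith)
        refine (((hasDerivWithinAt_steinSol_Iic (hsz hy)).mono hsz).sub hlin).congr_deriv ?_
        have hy' : y ≤ z := hsz hy
        simp [steinDeriv, hy', hxz.le]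
      · rw [abs_of_nonneg (a := x - z) (by linarith)] at hz
        have hsz : s ⊆ Set.Ici z := fun u hu => by
          have h1 := hle u hu
          have := (abs_le.1 h1).1
          exact Set.mem_Ici.2 (by linarith)
        refine (((hasDerivWithinAt_steinSol_Ici (hsz hy)).mono hsz).sub hlin).congr_deriv ?_
        -- The case `x = z` is excluded because `|x - z| > |h| ≥ 0`; there `steinDeriv` would be the
        -- derivative from the wrong side.
        have hx' : ¬ x ≤ z := by
          have := abs_nonneg h
          intro h'; linarith
        simp [steinDeriv, hx']
        ring
    have := hconv.norm_image_sub_le_of_norm_hasDerivWithin_le key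
      (C := (6 + 2 * |x|) * |h|) (fun y hy => (abs_mul_steinSol_sub_le z x y).trans
        (mul_le_mul_of_nonneg_left (hle y hy) (by positivity)))
      (Set.left_mem_uIcc) (Set.right_mem_uIcc)
    simp only [Real.norm_eq_abs] at this
    rw [show x - (x - h) = h by ring, mul_assoc, ← sq, sq_abs] at this
    refine (le_of_eq ?_).trans (this.trans (by linarith))
    congr 1; ring

end

end LocalDep
-- Test functions: the truncated root, trapezoids and the increment kernel.
namespace LocalDep

noncomputable section

/-- The square root, truncated above and below. -/
def clampSqrt (v : ℝ) : ℝ := Real.sqrt (max (1 / 2) (min v 2))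

lemma clampSqrt_sq (v : ℝ) : clampSqrt v ^ 2 = max (1 / 2) (min v 2) :=
  Real.sq_sqrt (le_max_of_le_left (by norm_num))

lemma clampSqrt_nonneg (v : ℝ) : 0 ≤ clampSqrt v := Real.sqrt_nonneg _

lemma half_lt_clampSqrt (v : ℝ) : 1 / 2 < clampSqrt v := by
  have h := clampSqrt_sq v
  have h1 : (1 : ℝ) / 2 ≤ max (1 / 2) (min v 2) := le_max_left _ _
  nlinarith [clampSqrt_nonneg v]

lemma clampSqrt_pos (v : ℝ) : 0 < clampSqrt v := by linarith [half_lt_clampSqrt v]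

lemma clampSqrt_eq {v : ℝ} (h1 : 1 / 2 ≤ v) (h2 : v ≤ 2) : clampSqrt v = Real.sqrt v := by
  rw [clampSqrt, min_eq_left h2, max_eq_right h1]

/-- The clipped arguments differ by at most `|v - w|`; in the difference of squares the sum of the
two roots is at least 1. -/
lemma abs_clampSqrt_sub_le (v w : ℝ) : |clampSqrt v - clampSqrt w| ≤ |v - w| := by
  have h1 : |max (1 / 2) (min v 2) - max (1 / 2) (min w 2)| ≤ |v - w| :=
    (abs_max_sub_max_le_max _ _ _ _).trans (by
      simp only [sub_self, abs_zero]
      refine max_le (abs_nonneg _) ((abs_min_sub_min_le_max _ _ _ _).trans ?_)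
      simp)
  rw [← clampSqrt_sq, ← clampSqrt_sq, sq_sub_sq, abs_mul] at h1
  have h2 := half_lt_clampSqrt v
  have h3 := half_lt_clampSqrt w
  have h4 : 1 ≤ |clampSqrt v + clampSqrt w| := by
    rw [abs_of_pos (by linarith)]; linarith
  nlinarith [abs_nonneg (clampSqrt v - clampSqrt w)]

lemma continuous_clampSqrt : Continuous clampSqrt := by unfold clampSqrt; fun_prop

lemma abs_inv_clampSqrt_sub_le (v w : ℝ) :
    |(clampSqrt v)⁻¹ - (clampSqrt w)⁻¹| ≤ 4 * |v - w| := by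
  have h2 := half_lt_clampSqrt v
  have h3 := half_lt_clampSqrt w
  rw [inv_sub_inv (by linarith) (by linarith), abs_div, abs_sub_comm,
    div_le_iff₀ (by positivity)]
  rw [abs_of_pos (by nlinarith : 0 < clampSqrt v * clampSqrt w)]
  nlinarith [abs_clampSqrt_sub_le v w, abs_nonneg (v - w),
    mul_nonneg (abs_nonneg (v - w)) (by nlinarith : 0 ≤ clampSqrt v * clampSqrt w - 1 / 4)]

lemma inv_clampSqrt_le (v : ℝ) : (clampSqrt v)⁻¹ ≤ 2 := by
  have h := half_lt_clampSqrt v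
  rw [inv_le_comm₀ (clampSqrt_pos v) two_pos]
  linarith

lemma inv_clampSqrt_pos (v : ℝ) : 0 < (clampSqrt v)⁻¹ := inv_pos.2 (clampSqrt_pos v)

/-- Self-normalization is exact where the truncation is not active. -/
lemma abs_mul_inv_clampSqrt_sq_sub_one_le (v : ℝ) :
    |v * ((clampSqrt v)⁻¹) ^ 2 - 1| ≤ (v - 1) ^ 2 := by
  rw [inv_pow, clampSqrt_sq]
  rcases le_total v (1 / 2) with h | h
  · rw [min_eq_left (by linarith), max_eq_left h, show ((1 : ℝ) / 2)⁻¹ = 2 by norm_num,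
      abs_of_nonpos] <;> nlinarith [sq_nonneg v]
  · rcases le_total v 2 with h2 | h2
    · rw [min_eq_left h2, max_eq_right h, mul_inv_cancel₀ (by linarith)]
      simp [sq_nonneg]
    · rw [min_eq_right h2, max_eq_right (by norm_num), abs_of_nonneg] <;> nlinarith

/-- The trapezoid function: `1` on `[-w, w]`, with linear ramps of width `α`. -/
def trap (α w y : ℝ) : ℝ := max 0 (min 1 ((w + α - |y|) / α))

lemma trap_nonneg (α w y : ℝ) : 0 ≤ trap α w y := le_max_left _ _

lemma trap_le_one (α w y : ℝ) : trap α w y ≤ 1 := max_le zero_le_one (min_le_left _ _)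

lemma trap_eq_one {α w y : ℝ} (hα : 0 < α) (h : |y| ≤ w) : trap α w y = 1 := by
  have : 1 ≤ (w + α - |y|) / α := by rw [le_div_iff₀ hα]; linarith
  rw [trap, min_eq_left this, max_eq_right zero_le_one]

lemma trap_eq_zero {α w y : ℝ} (hα : 0 < α) (h : w + α ≤ |y|) : trap α w y = 0 := by
  have : (w + α - |y|) / α ≤ 0 := div_nonpos_of_nonpos_of_nonneg (by linarith) hα.le
  rw [trap, max_eq_left ((min_le_right _ _).trans this)]

lemma continuous_trap (α : ℝ) : Continuous fun p : ℝ × ℝ => trap α p.1 p.2 := by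
  unfold trap; fun_prop

lemma abs_trap_sub_le {α : ℝ} (hα : 0 < α) (w x y : ℝ) :
    |trap α w x - trap α w y| ≤ |x - y| / α := by
  have h0 : |(w + α - |x|) / α - (w + α - |y|) / α| ≤ |x - y| / α := by
    rw [← sub_div, abs_div, abs_of_pos hα]
    refine div_le_div_of_nonneg_right ?_ hα.le
    rw [show w + α - |x| - (w + α - |y|) = |y| - |x| by ring, abs_sub_comm x y]
    exact abs_abs_sub_abs_le _ _
  unfold trap
  refine (abs_max_sub_max_le_max _ _ _ _).trans (max_le (by simp; positivity) ?_)
  exact (abs_min_sub_min_le_max _ _ _ _).trans (max_le (by simp; positivity) h0)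

/-- The indicator of the window of radius `2 * α` about the origin. -/
def window (α y : ℝ) : ℝ := if |y| ≤ 2 * α then 1 else 0

lemma window_nonneg (α y : ℝ) : 0 ≤ window α y := by unfold window; split_ifs <;> norm_num

lemma window_le_one (α y : ℝ) : window α y ≤ 1 := by unfold window; split_ifs <;> norm_num

lemma measurable_window (α : ℝ) : Measurable (window α) :=
  Measurable.ite (measurableSet_le (by fun_prop) (by fun_prop)) measurable_const measurable_const

/-- The trapezoid varies only on its ramps, which have centres `±(w + α/2)` and half-width `α/2`. A
shift by at most `α` reaches them only from within `3α/2` of a centre, inside the window radius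
`2α`. -/
lemma abs_trap_shift_le_window {α w : ℝ} (hα : 0 < α) (y : ℝ) {h : ℝ}
    (hh : |h| ≤ α) :
    |trap α w (y + h) - trap α w y|
      ≤ |h| / α * (window α (y - (w + α / 2)) + window α (y + (w + α / 2))) := by
  by_cases h1 : |y - (w + α / 2)| ≤ 2 * α
  · have := abs_trap_sub_le hα w (y + h) y
    rw [add_sub_cancel_left] at this
    refine this.trans (le_mul_of_one_le_right (by positivity) ?_)
    rw [window, if_pos h1]
    linarith [window_nonneg α (y + (w + α / 2))]
  by_cases h2 : |y + (w + α / 2)| ≤ 2 * α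
  · have := abs_trap_sub_le hα w (y + h) y
    rw [add_sub_cancel_left] at this
    refine this.trans (le_mul_of_one_le_right (by positivity) ?_)
    rw [window, window, if_pos h2]
    split_ifs <;> linarith
  rw [window, window, if_neg h1, if_neg h2, add_zero, mul_zero]
  refine le_of_eq (abs_eq_zero.2 (sub_eq_zero.2 ?_))
  obtain ⟨hl, hu⟩ := abs_le.1 hh
  push Not at h1 h2
  by_cases h3 : |y| ≤ w
  · rw [trap_eq_one hα h3, trap_eq_one hα]
    obtain ⟨h4, h5⟩ := abs_le.1 h3
    rw [abs_of_nonpos (by linarith)] at h1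
    rw [abs_of_nonneg (by linarith)] at h2
    rw [abs_le]; constructor <;> linarith
  push Not at h3
  have h4 : w + 2 * α ≤ |y| := by
    rcases le_total 0 y with hy | hy
    · rw [abs_of_nonneg hy] at h3 ⊢
      rcases abs_cases (y - (w + α / 2)) with h | h <;> linarith
    · rw [abs_of_nonpos hy] at h3 ⊢
      rcases abs_cases (y + (w + α / 2)) with h | h <;> linarith
  rw [trap_eq_zero (y := y) hα (by linarith), trap_eq_zero hα]
  have := abs_sub_abs_le_abs_sub y (y + h)
  rw [show y - (y + h) = -h by ring, abs_neg] at this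
  linarith

/-- A long shift is cut into `n` shifts of length at most `α`. Each pays only when its own starting
point is near a ramp, so the total retains the factor `|t|`. -/
lemma abs_trap_shift_le_sum_window {α w : ℝ} (hα : 0 < α) (y t : ℝ) {n : ℕ}
    (hn : 0 < n) (ht : |t| ≤ n * α) :
    |trap α w (y + t) - trap α w y|
      ≤ ∑ k ∈ Finset.range n, |t| / n / α *
        (window α (y + k * (t / n) - (w + α / 2)) + window α (y + k * (t / n) + (w + α / 2))) := by
  have hn' : (0 : ℝ) < n := by exact_mod_cast hn
  have htel : trap α w (y + t) - trap α w y
      = ∑ k ∈ Finset.range n,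
        (trap α w (y + (k + 1 : ℕ) * (t / n)) - trap α w (y + (k : ℕ) * (t / n))) := by
    rw [Finset.sum_range_sub (fun k : ℕ => trap α w (y + k * (t / n)))]
    simp only [Nat.cast_zero, zero_mul, add_zero]
    rw [mul_div_cancel₀ _ hn'.ne']
  rw [htel]
  refine (Finset.abs_sum_le_sum_abs _ _).trans (Finset.sum_le_sum fun k _ => ?_)
  have hd : |t / n| ≤ α := by
    rw [abs_div, abs_of_pos hn', div_le_iff₀ hn', mul_comm]; exact ht
  have := abs_trap_shift_le_window (w := w) hα (y + k * (t / n)) hd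
  rw [abs_div, abs_of_pos hn'] at this
  refine le_trans (le_of_eq ?_) this
  congr 3; push_cast; ring

/-- The odd primitive of `trap`. -/
def trapInt (α w x : ℝ) : ℝ := ∫ t in (0 : ℝ)..x, trap α w t

lemma continuous_trap_right (α w : ℝ) : Continuous (trap α w) := by unfold trap; fun_prop

lemma continuous_trapInt (α : ℝ) : Continuous fun p : ℝ × ℝ => trapInt α p.1 p.2 := by
  unfold trapInt
  refine intervalIntegral.continuous_parametric_intervalIntegral_of_continuous
    (f := fun (p : ℝ × ℝ) t => trap α p.1 t) ?_ (by fun_prop)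
  unfold trap; fun_prop

lemma trapInt_sub (α w x y : ℝ) : trapInt α w x - trapInt α w y = ∫ t in y..x, trap α w t :=
  intervalIntegral.integral_interval_sub_left
    ((continuous_trap_right α w).intervalIntegrable _ _)
    ((continuous_trap_right α w).intervalIntegrable _ _)

lemma abs_trapInt_sub_le (α w x y : ℝ) : |trapInt α w x - trapInt α w y| ≤ |x - y| := by
  rw [trapInt_sub]
  have := intervalIntegral.norm_integral_le_of_norm_le_const (a := y) (b := x)
    (f := trap α w) (C := 1) fun t _ => by
      rw [Real.norm_eq_abs, abs_of_nonneg (trap_nonneg _ _ _)]; exact trap_le_one _ _ _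
  simpa using this

lemma trapInt_eq_of_ge {α w x y : ℝ} (hα : 0 < α) (hw : 0 ≤ w) (hx : w + α ≤ x)
    (hy : w + α ≤ y) : trapInt α w x = trapInt α w y := by
  rw [← sub_eq_zero, trapInt_sub, intervalIntegral.integral_congr (g := fun _ => 0)]
  · simp
  · intro t ht
    have : w + α ≤ t := le_trans (le_min hy hx) ht.1
    exact trap_eq_zero hα (by rw [abs_of_nonneg (by linarith)]; exact this)

lemma trapInt_eq_of_le {α w x y : ℝ} (hα : 0 < α) (hw : 0 ≤ w) (hx : x ≤ -(w + α))
    (hy : y ≤ -(w + α)) : trapInt α w x = trapInt α w y := by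
  rw [← sub_eq_zero, trapInt_sub, intervalIntegral.integral_congr (g := fun _ => 0)]
  · simp
  · intro t ht
    have : t ≤ -(w + α) := le_trans ht.2 (max_le hy hx)
    exact trap_eq_zero hα (by rw [abs_of_nonpos (by linarith)]; linarith)

lemma abs_trapInt_le {α w : ℝ} (hα : 0 < α) (hw : 0 ≤ w) (x : ℝ) :
    |trapInt α w x| ≤ w + α := by
  have h : ∀ y, |trapInt α w y| ≤ |y| := fun y => by
    have := abs_trapInt_sub_le α w y 0
    simpa [trapInt] using this
  rcases le_total (w + α) x with h1 | h1
  · rw [trapInt_eq_of_ge hα hw h1 le_rfl]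
    exact (h _).trans (le_of_eq (abs_of_nonneg (by linarith)))
  rcases le_total x (-(w + α)) with h2 | h2
  · rw [trapInt_eq_of_le hα hw h2 le_rfl]
    refine (h _).trans (le_of_eq ?_)
    rw [abs_neg, abs_of_nonneg (by linarith)]
  · exact (h x).trans (abs_le.2 ⟨h2, h1⟩)

/-- Increment of `trapInt` under a change of the normalizing variable: only levels `z` comparable
with the other variables matter. -/
lemma abs_trapInt_clampSqrt_sub_le {α w : ℝ} (hα : 0 < α) (hw : 0 ≤ w) (s x z v v' : ℝ) :
    |trapInt α w (s - z * clampSqrt v - x) - trapInt α w (s - z * clampSqrt v' - x)|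
      ≤ 4 * (|s| + |x| + w + α) * |v - v'| := by
  -- Since `clampSqrt > 1/2`, a larger `|z|` sends both arguments beyond the same end of the support
  -- of `trap`, where the primitive is constant. This makes the estimate uniform in `z`.
  by_cases hz : |z| ≤ 4 * (|s| + |x| + w + α)
  · refine (abs_trapInt_sub_le _ _ _ _).trans ?_
    rw [show s - z * clampSqrt v - x - (s - z * clampSqrt v' - x)
      = -(z * (clampSqrt v - clampSqrt v')) by ring, abs_neg, abs_mul]
    exact mul_le_mul hz (abs_clampSqrt_sub_le v v') (abs_nonneg _) (by positivity)
  · push Not at hz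
    rw [show trapInt α w (s - z * clampSqrt v - x) = trapInt α w (s - z * clampSqrt v' - x) from ?_]
    · simp only [sub_self, abs_zero]; positivity
    have hs := abs_le.1 (le_refl |s|)
    have hx := abs_le.1 (le_refl |x|)
    have h1 := half_lt_clampSqrt v
    have h2 := half_lt_clampSqrt v'
    rcases le_total 0 z with h | h
    · rw [abs_of_nonneg h] at hz
      exact trapInt_eq_of_le hα hw (by nlinarith [abs_nonneg s, abs_nonneg x])
        (by nlinarith [abs_nonneg s, abs_nonneg x])
    · rw [abs_of_nonpos h] at hz
      exact trapInt_eq_of_ge hα hw (by nlinarith [abs_nonneg s, abs_nonneg x])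
        (by nlinarith [abs_nonneg s, abs_nonneg x])

/-- The kernel which turns increments into integrals: `f 0 - f (-h) = ∫ f' t * kern h t`. -/
def kern (h t : ℝ) : ℝ := (if -h < t ∧ t ≤ 0 then 1 else 0) - (if 0 < t ∧ t ≤ -h then 1 else 0)

/-- Lebesgue measure on `[-1, 1]`. -/
def lebUnit : Measure ℝ := volume.restrict (Set.Icc (-1) 1)

instance : IsFiniteMeasure lebUnit := by unfold lebUnit; infer_instance

lemma measurable_kern : Measurable fun p : ℝ × ℝ => kern p.1 p.2 := by
  have h1 : MeasurableSet ({p : ℝ × ℝ | -p.1 < p.2} ∩ {p | p.2 ≤ 0}) :=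
    (measurableSet_lt (by fun_prop) (by fun_prop)).inter
      (measurableSet_le (by fun_prop) (by fun_prop))
  have h2 : MeasurableSet ({p : ℝ × ℝ | 0 < p.2} ∩ {p | p.2 ≤ -p.1}) :=
    (measurableSet_lt (by fun_prop) (by fun_prop)).inter
      (measurableSet_le (by fun_prop) (by fun_prop))
  exact (Measurable.ite h1 measurable_const measurable_const).sub
    (Measurable.ite h2 measurable_const measurable_const)

lemma abs_kern_le_one (h t : ℝ) : |kern h t| ≤ 1 := by
  unfold kern; split_ifs <;> norm_num

lemma kern_sq (h t : ℝ) : kern h t ^ 2 = |kern h t| := by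
  unfold kern; split_ifs with h1 h2 <;> norm_num

/-- The kernel lives between 0 and `-h`. -/
lemma abs_mul_abs_kern_le (h t : ℝ) : |t| * |kern h t| ≤ |h| * |kern h t| := by
  unfold kern
  split_ifs with h1 h2 h2
  · simp
  · rw [abs_of_nonpos h1.2, abs_of_nonneg (by linarith : 0 ≤ h)]; simp; linarith [h1.1]
  · rw [abs_of_pos h2.1, abs_of_nonpos (by linarith : h ≤ 0)]; simp; linarith [h2.2]
  · simp

lemma integral_mul_kern {h : ℝ} (hh : |h| ≤ 1) {g : ℝ → ℝ} (hg : Continuous g) :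
    ∫ t, g t * kern h t ∂lebUnit = ∫ t in (-h)..0, g t := by
  obtain ⟨h1, h2⟩ := abs_le.1 hh
  have e : ∀ t, g t * kern h t
      = (Set.Ioc (-h) 0).indicator g t - (Set.Ioc 0 (-h)).indicator g t := fun t => by
    simp only [kern, Set.indicator, Set.mem_Ioc, mul_sub, mul_ite, mul_one, mul_zero]
  have hi : ∀ a b : ℝ, Integrable ((Set.Ioc a b).indicator g) lebUnit := fun a b => by
    rw [integrable_indicator_iff measurableSet_Ioc]
    have : IntegrableOn g (Set.Icc a b) volume := hg.continuousOn.integrableOn_Icc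
    exact (this.mono_set Set.Ioc_subset_Icc_self).mono_measure Measure.restrict_le_self
  have hr : ∀ a b : ℝ, -1 ≤ a → b ≤ 1 →
      ∫ t, (Set.Ioc a b).indicator g t ∂lebUnit = ∫ t in Set.Ioc a b, g t := fun a b ha hb => by
    rw [integral_indicator measurableSet_Ioc, lebUnit, Measure.restrict_restrict measurableSet_Ioc,
      Set.inter_eq_left.2 (Set.Ioc_subset_Icc_self.trans (Set.Icc_subset_Icc ha hb))]
  simp_rw [e]
  rw [integral_sub (hi _ _) (hi _ _), hr _ _ (by linarith) (by norm_num),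
    hr _ _ (by norm_num) (by linarith), intervalIntegral]

lemma integral_kern {h : ℝ} (hh : |h| ≤ 1) : ∫ t, kern h t ∂lebUnit = h := by
  have := integral_mul_kern hh (g := fun _ => 1) continuous_const
  simpa using this

lemma integral_abs_kern {h : ℝ} (hh : |h| ≤ 1) : ∫ t, |kern h t| ∂lebUnit = |h| := by
  rcases le_total 0 h with h0 | h0
  · rw [abs_of_nonneg h0]
    conv_rhs => rw [← integral_kern hh]
    congr 1; ext t; refine abs_of_nonneg ?_
    unfold kern; split_ifs with h1 h2 <;> norm_num; linarith
  · rw [abs_of_nonpos h0]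
    conv_rhs => rw [← integral_kern hh, ← integral_neg]
    congr 1; ext t; refine abs_of_nonpos ?_
    unfold kern; split_ifs with h1 h2 <;> norm_num; linarith

lemma trapInt_sub_eq_integral_kern {α w y h : ℝ} (hh : |h| ≤ 1) :
    trapInt α w y - trapInt α w (y - h) = ∫ t, trap α w (y + t) * kern h t ∂lebUnit := by
  have hc : Continuous fun t => trap α w (y + t) :=
    (continuous_trap_right α w).comp (by fun_prop)
  rw [integral_mul_kern hh hc, trapInt_sub, intervalIntegral.integral_comp_add_left]
  simp [sub_eq_add_neg]

lemma integral_trap_shift_le {α w : ℝ} (hα : 0 < α) (hw : 0 ≤ w) (y : ℝ) :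
    ∫ t, trap α w (y + t) ∂lebUnit ≤ 2 * (w + α) := by
  have e : ∫ t, trap α w (y + t) ∂lebUnit = ∫ t in (-1 : ℝ)..1, trap α w (y + t) := by
    rw [intervalIntegral.integral_of_le (by norm_num), lebUnit, integral_Icc_eq_integral_Ioc]
  rw [e, intervalIntegral.integral_comp_add_left, ← trapInt_sub]
  have h1 := abs_le.1 (abs_trapInt_le hα hw (y + 1))
  have h2 := abs_le.1 (abs_trapInt_le hα hw (y + -1))
  linarith

end

end LocalDep
-- Counting in neighbourhoods and cubic bounds for small vectors.
namespace LocalDep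

noncomputable section

section Counting

variable {J : Type*} [Fintype J]

lemma three_mul_le_cubes {a b c : ℝ} (ha : 0 ≤ a) (hb : 0 ≤ b) (hc : 0 ≤ c) :
    a * b * c ≤ (a ^ 3 + b ^ 3 + c ^ 3) / 3 := by
  nlinarith [mul_nonneg ha (sq_nonneg (b - c)), mul_nonneg hb (sq_nonneg (a - c)),
    mul_nonneg hc (sq_nonneg (a - b)), mul_nonneg (add_nonneg ha hb) (sq_nonneg (a - b)),
    mul_nonneg (add_nonneg hb hc) (sq_nonneg (b - c)),
    mul_nonneg (add_nonneg ha hc) (sq_nonneg (a - c))]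

/-- AM–GM replaces `y i * y j * y k` by the mean of three cubes; each cube then only sees a marginal
of the weight. -/
lemma sum_triple_le {w : J → J → J → ℝ} {y : J → ℝ} {c : ℝ} (hw : ∀ i j k, 0 ≤ w i j k)
    (hy : ∀ i, 0 ≤ y i) (h1 : ∀ i, ∑ j, ∑ k, w i j k ≤ c) (h2 : ∀ j, ∑ i, ∑ k, w i j k ≤ c)
    (h3 : ∀ k, ∑ i, ∑ j, w i j k ≤ c) :
    ∑ i, ∑ j, ∑ k, w i j k * (y i * y j * y k) ≤ c * ∑ i, y i ^ 3 := by
  have hc : ∀ i, 0 ≤ y i ^ 3 := fun i => pow_nonneg (hy i) 3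
  have e1 : ∑ i, ∑ j, ∑ k, w i j k * y i ^ 3 ≤ c * ∑ i, y i ^ 3 := by
    rw [Finset.mul_sum]
    refine Finset.sum_le_sum fun i _ => ?_
    simp_rw [← Finset.sum_mul]
    exact mul_le_mul_of_nonneg_right (h1 i) (hc i)
  have e2 : ∑ i, ∑ j, ∑ k, w i j k * y j ^ 3 ≤ c * ∑ i, y i ^ 3 := by
    rw [Finset.mul_sum, Finset.sum_comm]
    refine Finset.sum_le_sum fun j _ => ?_
    simp_rw [← Finset.sum_mul]
    exact mul_le_mul_of_nonneg_right (h2 j) (hc j)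
  have e3 : ∑ i, ∑ j, ∑ k, w i j k * y k ^ 3 ≤ c * ∑ i, y i ^ 3 := by
    have : ∑ i, ∑ j, ∑ k, w i j k * y k ^ 3 = ∑ k, ∑ i, ∑ j, w i j k * y k ^ 3 := by
      rw [Finset.sum_comm (s := (Finset.univ : Finset J)) (t := (Finset.univ : Finset J))
        (f := fun k i => ∑ j, w i j k * y k ^ 3)]
      exact Finset.sum_congr rfl fun i _ => Finset.sum_comm
    rw [this, Finset.mul_sum]
    refine Finset.sum_le_sum fun k _ => ?_
    simp_rw [← Finset.sum_mul]
    exact mul_le_mul_of_nonneg_right (h3 k) (hc k)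
  have : ∑ i, ∑ j, ∑ k, w i j k * (y i * y j * y k)
      ≤ ∑ i, ∑ j, ∑ k, (w i j k * y i ^ 3 + w i j k * y j ^ 3 + w i j k * y k ^ 3) / 3 := by
    refine Finset.sum_le_sum fun i _ => Finset.sum_le_sum fun j _ => Finset.sum_le_sum fun k _ => ?_
    have := mul_le_mul_of_nonneg_left (three_mul_le_cubes (hy i) (hy j) (hy k)) (hw i j k)
    linarith
  simp_rw [← Finset.sum_div, Finset.sum_add_distrib] at this
  linarith

lemma sum_double_le {w : J → J → ℝ} {y : J → ℝ} {c : ℝ} (hw : ∀ i k, 0 ≤ w i k)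
    (hy : ∀ i, 0 ≤ y i) (h1 : ∀ i, ∑ k, w i k ≤ c) (h2 : ∀ k, ∑ i, w i k ≤ c) :
    ∑ i, ∑ k, w i k * (y i ^ 2 * y k) ≤ c * ∑ i, y i ^ 3 := by
  have hc : ∀ i, 0 ≤ y i ^ 3 := fun i => pow_nonneg (hy i) 3
  have e1 : ∑ i, ∑ k, w i k * y i ^ 3 ≤ c * ∑ i, y i ^ 3 := by
    rw [Finset.mul_sum]
    refine Finset.sum_le_sum fun i _ => ?_
    simp_rw [← Finset.sum_mul]
    exact mul_le_mul_of_nonneg_right (h1 i) (hc i)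
  have e2 : ∑ i, ∑ k, w i k * y k ^ 3 ≤ c * ∑ i, y i ^ 3 := by
    rw [Finset.mul_sum, Finset.sum_comm]
    refine Finset.sum_le_sum fun j _ => ?_
    simp_rw [← Finset.sum_mul]
    exact mul_le_mul_of_nonneg_right (h2 j) (hc j)
  have : ∑ i, ∑ k, w i k * (y i ^ 2 * y k)
      ≤ ∑ i, ∑ k, (w i k * y i ^ 3 + w i k * y i ^ 3 + w i k * y k ^ 3) / 3 := by
    refine Finset.sum_le_sum fun i _ => Finset.sum_le_sum fun k _ => ?_
    have := mul_le_mul_of_nonneg_left (three_mul_le_cubes (hy i) (hy i) (hy k)) (hw i k)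
    nlinarith
  simp_rw [← Finset.sum_div, Finset.sum_add_distrib] at this
  linarith

variable [DecidableEq J]

/-- The neighbourhoods `A i ⊆ B i`, with `κ` bounding their overlaps. -/
structure Nbhds (A B : J → Finset J) (κ : ℝ) : Prop where
  kappa : KappaBound A B κ
  sub : ∀ i, A i ⊆ B i

/-- The indices `j` for which `A j` meets `A i`. -/
def nbr (A : J → Finset J) (i : J) : Finset J := Finset.univ.filter fun j => (A i ∩ A j).Nonempty

lemma mem_nbr_comm {A : J → Finset J} {i j : J} : i ∈ nbr A j ↔ j ∈ nbr A i := by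
  simp [nbr, Finset.inter_comm]

/-- The active members of a set of indices. -/
def act (A : J → Finset J) (C : Finset J) : Finset J := C.filter fun j => j ∈ A j

namespace Nbhds

variable {A B : J → Finset J} {κ : ℝ}

/-- An active `j ∈ B i` lies in `B i ∩ A j`. Without activity the size of `B i` is not controlled by
`κ`; inactive entries vanish, so they do not matter in sums. -/
lemma card_act_B_le (h : Nbhds A B κ) (i : J) : ((act A (B i)).card : ℝ) ≤ κ := by
  refine le_trans ?_ (h.kappa i).1
  exact_mod_cast Finset.card_le_card fun j hj => by
    simp only [act, Finset.mem_filter] at hj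
    exact Finset.mem_filter.2 ⟨Finset.mem_univ _, j, Finset.mem_inter.2 hj⟩

lemma card_act_A_le (h : Nbhds A B κ) (i : J) : ((act A (A i)).card : ℝ) ≤ κ := by
  refine le_trans ?_ (h.card_act_B_le i)
  exact_mod_cast Finset.card_le_card (Finset.filter_subset_filter _ (h.sub i))

lemma card_nbr_le (h : Nbhds A B κ) (i : J) : ((nbr A i).card : ℝ) ≤ κ := by
  refine le_trans ?_ (h.kappa i).1
  exact_mod_cast Finset.card_le_card fun j hj => by
    simp only [nbr, Finset.mem_filter] at hj ⊢
    exact ⟨hj.1, hj.2.mono (Finset.inter_subset_inter_right (h.sub i))⟩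

lemma card_mem_B_le (h : Nbhds A B κ) (k : J) :
    ((Finset.univ.filter fun i => k ∈ B i).card : ℝ) ≤ κ :=
  (h.kappa k).2

lemma card_mem_A_le (h : Nbhds A B κ) (k : J) :
    ((Finset.univ.filter fun i => k ∈ A i).card : ℝ) ≤ κ := by
  refine le_trans ?_ (h.card_mem_B_le k)
  exact_mod_cast Finset.card_le_card fun i hi => by
    simp only [Finset.mem_filter] at hi ⊢
    exact ⟨hi.1, h.sub i hi.2⟩

lemma sum_sum_mem_B_le (h : Nbhds A B κ) {c : J → ℝ} (hc : ∀ j, 0 ≤ c j) :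
    ∑ i, ∑ j ∈ B i, c j ≤ κ * ∑ j, c j := by
  have : ∑ i, ∑ j ∈ B i, c j = ∑ j, ∑ i ∈ Finset.univ.filter fun i => j ∈ B i, c j :=
    Finset.sum_comm' (by simp)
  rw [this, Finset.mul_sum]
  refine Finset.sum_le_sum fun j _ => ?_
  rw [Finset.sum_const, nsmul_eq_mul]
  exact mul_le_mul_of_nonneg_right (h.card_mem_B_le j) (hc j)

lemma sum_sum_mem_A_le (h : Nbhds A B κ) {c : J → ℝ} (hc : ∀ j, 0 ≤ c j) :
    ∑ i, ∑ j ∈ A i, c j ≤ κ * ∑ j, c j :=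
  (Finset.sum_le_sum fun i _ =>
    Finset.sum_le_sum_of_subset_of_nonneg (h.sub i) fun j _ _ => hc j).trans (h.sum_sum_mem_B_le hc)

end Nbhds

/-- A vector which vanishes at inactive indices and has small entries. -/
structure SmallVec (A B : J → Finset J) (κ : ℝ) (x : J → ℝ) : Prop extends Nbhds A B κ where
  one_le : 1 ≤ κ
  zero : ∀ i, i ∉ A i → x i = 0
  bdd : ∀ i, κ * |x i| ≤ 1

namespace SmallVec

variable {A B : J → Finset J} {κ : ℝ} {x : J → ℝ}

lemma kappa_pos (h : SmallVec A B κ x) : 0 < κ := one_pos.trans_le h.one_le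

lemma abs_le_one (h : SmallVec A B κ x) (i : J) :
    |x i| ≤ 1 := by nlinarith [h.bdd i, h.one_le, abs_nonneg (x i)]

lemma sum_act (h : SmallVec A B κ x) (C : Finset J) {g : J → ℝ} (hg : ∀ j, x j = 0 → g j = 0) :
    ∑ j ∈ act A C, g j = ∑ j ∈ C, g j :=
  Finset.sum_filter_of_ne fun j _ hj => by
    by_contra h'
    exact hj (hg j (h.zero j h'))

lemma sum_abs_le_one_of_card (h : SmallVec A B κ x) {C : Finset J} (hC : (C.card : ℝ) ≤ κ) :
    ∑ j ∈ C, |x j| ≤ 1 := by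
  have h1 : κ * ∑ j ∈ C, |x j| ≤ C.card := by
    rw [Finset.mul_sum]
    refine (Finset.sum_le_sum fun j _ => h.bdd j).trans ?_
    simp
  have := h.kappa_pos
  nlinarith

lemma sum_abs_B_le (h : SmallVec A B κ x) (i : J) : ∑ j ∈ B i, |x j| ≤ 1 := by
  rw [← h.sum_act (B i) (g := fun j => |x j|) (fun j hj => by simp [hj])]
  exact h.sum_abs_le_one_of_card (h.card_act_B_le i)

lemma sum_abs_A_le (h : SmallVec A B κ x) (i : J) : ∑ j ∈ A i, |x j| ≤ 1 :=
  (Finset.sum_le_sum_of_subset_of_nonneg (h.sub i) fun _ _ _ => abs_nonneg _).trans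
    (h.sum_abs_B_le i)

lemma sum_abs_nbr_le (h : SmallVec A B κ x) (i : J) : ∑ j ∈ nbr A i, |x j| ≤ 1 :=
  h.sum_abs_le_one_of_card (h.card_nbr_le i)

lemma abs_sum_A_le_one (h : SmallVec A B κ x) (i : J) : |∑ j ∈ A i, x j| ≤ 1 :=
  (Finset.abs_sum_le_sum_abs _ _).trans (h.sum_abs_A_le i)

lemma abs_sum_A_le (h : SmallVec A B κ x) (i : J) :
    |∑ j ∈ A i, x j| ≤ ∑ k, (if k ∈ act A (A i) then 1 else 0) * |x k| := by
  refine (Finset.abs_sum_le_sum_abs _ _).trans (le_of_eq ?_)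
  rw [← h.sum_act (A i) (g := fun j => |x j|) (fun j hj => by simp [hj])]
  simp [ite_mul, Finset.sum_ite_mem]

lemma sum_ite_card (C : Finset J) : ∑ k, (if k ∈ C then (1 : ℝ) else 0) = C.card := by simp

lemma sum_ite_mem_act_le (h : SmallVec A B κ x) (k : J) :
    ∑ i, (if k ∈ act A (A i) then (1 : ℝ) else 0) ≤ κ := by
  refine le_trans ?_ (h.card_mem_A_le k)
  rw [← sum_ite_card]
  refine Finset.sum_le_sum fun i _ => ?_
  simp only [act, Finset.mem_filter, Finset.mem_univ, true_and]
  split_ifs <;> simp_all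

/-- Expanding the square gives a triple sum over active `j, k ∈ A i`. Each index is an active member
of at most `κ` of the sets `A i`, and each `A i` has at most `κ` active members, so all marginals
are at most `κ²`. -/
lemma sum_abs_mul_sq_le (h : SmallVec A B κ x) :
    ∑ i, |x i| * (∑ j ∈ A i, x j) ^ 2 ≤ κ ^ 2 * ∑ i, |x i| ^ 3 := by
  set a : J → J → ℝ := fun i k => if k ∈ act A (A i) then 1 else 0 with ha
  have ha0 : ∀ i k, 0 ≤ a i k := fun i k => by simp only [ha]; split_ifs <;> norm_num
  have hrow : ∀ i, ∑ k, a i k ≤ κ := fun i => by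
    simp only [ha, sum_ite_card]; exact h.card_act_A_le i
  have hcol : ∀ k, ∑ i, a i k ≤ κ := h.sum_ite_mem_act_le
  have hk := h.kappa_pos
  refine le_trans ?_ (sum_triple_le (w := fun i j k => a i j * a i k) (y := fun i => |x i|)
    (fun i j k => mul_nonneg (ha0 _ _) (ha0 _ _)) (fun i => abs_nonneg _) (c := κ ^ 2) ?_ ?_ ?_)
  · refine Finset.sum_le_sum fun i _ => ?_
    have h1 := h.abs_sum_A_le i
    have h2 : (∑ j ∈ A i, x j) ^ 2 ≤ (∑ k, a i k * |x k|) ^ 2 := by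
      rw [← sq_abs]; exact pow_le_pow_left₀ (abs_nonneg _) h1 2
    refine (mul_le_mul_of_nonneg_left h2 (abs_nonneg _)).trans (le_of_eq ?_)
    rw [sq, Finset.sum_mul_sum, Finset.mul_sum]
    refine Finset.sum_congr rfl fun j _ => ?_
    rw [Finset.mul_sum]
    exact Finset.sum_congr rfl fun k _ => by ring
  · intro i
    simp_rw [← Finset.mul_sum]
    rw [← Finset.sum_mul, sq]
    exact mul_le_mul (hrow i) (hrow i) (Finset.sum_nonneg fun _ _ => ha0 _ _) hk.le
  · intro j
    simp_rw [← Finset.mul_sum]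
    refine (Finset.sum_le_sum fun i _ => mul_le_mul_of_nonneg_left (hrow i) (ha0 i j)).trans ?_
    rw [← Finset.sum_mul, sq]
    exact mul_le_mul_of_nonneg_right (hcol j) hk.le
  · intro k
    simp_rw [← Finset.sum_mul]
    refine (Finset.sum_le_sum fun i _ => mul_le_mul_of_nonneg_right (hrow i) (ha0 i k)).trans ?_
    rw [← Finset.mul_sum, sq]
    exact mul_le_mul_of_nonneg_left (hcol k) hk.le

/-- Bounds the effect, weighted by `|x i|`, of deleting from the quadratic form the terms that touch
`A i`. The triple sum runs along a chain: `j` is a neighbour of `i`, and `k` is an active member of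
`A j`. -/
lemma sum_abs_mul_nbr_le (h : SmallVec A B κ x) :
    ∑ i, |x i| * ∑ j ∈ nbr A i, |x j| * |∑ k ∈ A j, x k| ≤ κ ^ 2 * ∑ i, |x i| ^ 3 := by
  set a : J → J → ℝ := fun i k => if k ∈ act A (A i) then 1 else 0 with ha
  set b : J → J → ℝ := fun i k => if k ∈ nbr A i then 1 else 0 with hb
  have ha0 : ∀ i k, 0 ≤ a i k := fun i k => by simp only [ha]; split_ifs <;> norm_num
  have hb0 : ∀ i k, 0 ≤ b i k := fun i k => by simp only [hb]; split_ifs <;> norm_num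
  have hrow : ∀ i, ∑ k, a i k ≤ κ := fun i => by
    simp only [ha, sum_ite_card]; exact h.card_act_A_le i
  have hcol : ∀ k, ∑ i, a i k ≤ κ := h.sum_ite_mem_act_le
  have hbrow : ∀ i, ∑ k, b i k ≤ κ := fun i => by
    simp only [hb, sum_ite_card]; exact h.card_nbr_le i
  have hbcol : ∀ k, ∑ i, b i k ≤ κ := fun k => by
    refine le_trans (le_of_eq ?_) (hbrow k)
    exact Finset.sum_congr rfl fun i _ => by simp only [hb, mem_nbr_comm]
  have hk := h.kappa_pos
  refine le_trans ?_ (sum_triple_le (w := fun i j k => b i j * a j k) (y := fun i => |x i|)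
    (fun i j k => mul_nonneg (hb0 _ _) (ha0 _ _)) (fun i => abs_nonneg _) (c := κ ^ 2) ?_ ?_ ?_)
  · refine Finset.sum_le_sum fun i _ => ?_
    rw [Finset.mul_sum]
    have e : ∀ g : J → ℝ, ∑ j ∈ nbr A i, g j = ∑ j, b i j * g j := fun g => by
      simp [hb, ite_mul, Finset.sum_ite_mem]
    rw [e]
    refine Finset.sum_le_sum fun j _ => ?_
    have h1 := h.abs_sum_A_le j
    have h2 : b i j * (|x i| * (|x j| * |∑ k ∈ A j, x k|))
        ≤ b i j * (|x i| * (|x j| * ∑ k, a j k * |x k|)) := by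
      have := hb0 i j
      gcongr
    refine h2.trans (le_of_eq ?_)
    simp_rw [Finset.mul_sum]
    exact Finset.sum_congr rfl fun k _ => by ring
  · intro i
    simp_rw [← Finset.mul_sum]
    refine (Finset.sum_le_sum fun j _ => mul_le_mul_of_nonneg_left (hrow j) (hb0 i j)).trans ?_
    rw [← Finset.sum_mul, sq]
    exact mul_le_mul_of_nonneg_right (hbrow i) hk.le
  · intro j
    simp_rw [← Finset.mul_sum]
    rw [← Finset.sum_mul, sq]
    exact mul_le_mul (hbcol j) (hrow j) (Finset.sum_nonneg fun _ _ => ha0 _ _) hk.le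
  · intro k
    rw [Finset.sum_comm]
    simp_rw [← Finset.sum_mul]
    refine (Finset.sum_le_sum fun j _ => mul_le_mul_of_nonneg_right (hbcol j) (ha0 j k)).trans ?_
    rw [← Finset.mul_sum, sq]
    exact mul_le_mul_of_nonneg_left (hcol k) hk.le

lemma kappa_mul_sum_sq_mul_abs_le (h : SmallVec A B κ x) :
    κ * ∑ i, x i ^ 2 * |∑ j ∈ A i, x j| ≤ κ ^ 2 * ∑ i, |x i| ^ 3 := by
  set a : J → J → ℝ := fun i k => if k ∈ act A (A i) then 1 else 0 with ha
  have ha0 : ∀ i k, 0 ≤ a i k := fun i k => by simp only [ha]; split_ifs <;> norm_num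
  have hrow : ∀ i, ∑ k, a i k ≤ κ := fun i => by
    simp only [ha, sum_ite_card]; exact h.card_act_A_le i
  have hcol : ∀ k, ∑ i, a i k ≤ κ := h.sum_ite_mem_act_le
  rw [sq, mul_assoc]
  refine mul_le_mul_of_nonneg_left ?_ h.kappa_pos.le
  refine le_trans ?_ (sum_double_le ha0 (fun i => abs_nonneg (x i)) hrow hcol)
  refine Finset.sum_le_sum fun i _ => ?_
  refine (mul_le_mul_of_nonneg_left (h.abs_sum_A_le i) (sq_nonneg _)).trans (le_of_eq ?_)
  rw [Finset.mul_sum]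
  exact Finset.sum_congr rfl fun k _ => by rw [sq_abs]; ring

end SmallVec

end Counting

end

end LocalDep
-- Bounded measurable functions and factorization under independence.
namespace LocalDep

noncomputable section

section BddMeas

/-- Bounded measurable real functions. -/
@[fun_prop]
structure BddMeas {α : Type*} [MeasurableSpace α] (f : α → ℝ) : Prop where
  measurable : Measurable f
  bdd : ∃ C : ℝ, ∀ a, |f a| ≤ C

variable {α β : Type*} [MeasurableSpace α] [MeasurableSpace β] {f g : α → ℝ}

namespace BddMeas

lemma integrable (hf : BddMeas f) {μ : Measure α} [IsFiniteMeasure μ] : Integrable f μ := by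
  obtain ⟨C, hC⟩ := hf.bdd
  exact Integrable.of_bound hf.measurable.aestronglyMeasurable C
    (Filter.Eventually.of_forall hC)

@[fun_prop]
lemma const (c : ℝ) : BddMeas (fun _ : α => c) := ⟨measurable_const, |c|, fun _ => le_rfl⟩

@[fun_prop]
lemma add (hf : BddMeas f) (hg : BddMeas g) : BddMeas fun a => f a + g a := by
  obtain ⟨C, hC⟩ := hf.bdd
  obtain ⟨D, hD⟩ := hg.bdd
  exact ⟨hf.measurable.add hg.measurable, C + D, fun a =>
    (abs_add_le _ _).trans (add_le_add (hC a) (hD a))⟩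

@[fun_prop]
lemma neg (hf : BddMeas f) : BddMeas fun a => -f a := by
  obtain ⟨C, hC⟩ := hf.bdd
  exact ⟨hf.measurable.neg, C, fun a => by rw [abs_neg]; exact hC a⟩

@[fun_prop]
lemma sub (hf : BddMeas f) (hg : BddMeas g) : BddMeas fun a => f a - g a := by
  simp_rw [sub_eq_add_neg]; fun_prop

@[fun_prop]
lemma mul (hf : BddMeas f) (hg : BddMeas g) : BddMeas fun a => f a * g a := by
  obtain ⟨C, hC⟩ := hf.bdd
  obtain ⟨D, hD⟩ := hg.bdd
  exact ⟨hf.measurable.mul hg.measurable, C * D, fun a => by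
    rw [abs_mul]
    exact mul_le_mul (hC a) (hD a) (abs_nonneg _) ((abs_nonneg _).trans (hC a))⟩

@[fun_prop]
lemma pow (hf : BddMeas f) (n : ℕ) : BddMeas fun a => f a ^ n := by
  induction n with
  | zero => simpa using const 1
  | succ n ih => simp_rw [pow_succ]; exact ih.mul hf

@[fun_prop]
lemma abs (hf : BddMeas f) : BddMeas fun a => |f a| := by
  obtain ⟨C, hC⟩ := hf.bdd
  exact ⟨hf.measurable.abs, C, fun a => by rw [abs_abs]; exact hC a⟩

@[fun_prop]
lemma div_const (hf : BddMeas f) (c : ℝ) : BddMeas fun a => f a / c := by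
  simp_rw [div_eq_mul_inv]; fun_prop

@[fun_prop]
lemma sum {ι : Type*} (s : Finset ι) {F : ι → α → ℝ} (hF : ∀ i, BddMeas (F i)) :
    BddMeas fun a => ∑ i ∈ s, F i a := by
  classical
  induction s using Finset.induction_on with
  | empty => simpa using const 0
  | insert i s hi ih => simp_rw [Finset.sum_insert hi]; exact (hF i).add ih

lemma of_bound (hf : Measurable f) {C : ℝ} (h : ∀ a, |f a| ≤ C) : BddMeas f := ⟨hf, C, h⟩

lemma comp_measurable (hf : BddMeas f) {φ : β → α} (hφ : Measurable φ) :
    BddMeas fun b => f (φ b) := by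
  obtain ⟨C, hC⟩ := hf.bdd
  exact ⟨hf.measurable.comp hφ, C, fun b => hC _⟩

lemma comp_fst (hf : BddMeas f) : BddMeas fun p : α × β => f p.1 :=
  hf.comp_measurable measurable_fst

lemma comp_snd (hf : BddMeas f) : BddMeas fun p : β × α => f p.2 :=
  hf.comp_measurable measurable_snd

lemma comp_continuous (hf : BddMeas f) {φ : ℝ → ℝ} (hφ : Continuous φ) :
    BddMeas fun a => φ (f a) := by
  obtain ⟨C, hC⟩ := hf.bdd
  obtain ⟨D, hD⟩ := (isCompact_Icc (a := -C) (b := C)).exists_bound_of_continuousOn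
    hφ.continuousOn
  exact ⟨hφ.measurable.comp hf.measurable, D, fun a => hD _ (abs_le.1 (hC a))⟩

variable {μ : Measure α} [IsFiniteMeasure μ] {ν : Measure β} [IsFiniteMeasure ν]

lemma integral_swap {F : α × β → ℝ} (hF : BddMeas F) :
    ∫ a, ∫ b, F (a, b) ∂ν ∂μ = ∫ b, ∫ a, F (a, b) ∂μ ∂ν :=
  integral_integral_swap (f := fun a b => F (a, b)) hF.integrable

lemma slice_left {F : α × β → ℝ} (hF : BddMeas F) (a : α) : BddMeas fun b => F (a, b) :=
  hF.comp_measurable (by fun_prop)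

lemma slice_right {F : α × β → ℝ} (hF : BddMeas F) (b : β) : BddMeas fun a => F (a, b) :=
  hF.comp_measurable (by fun_prop)

lemma integral_right {F : α × β → ℝ} (hF : BddMeas F) : BddMeas fun a => ∫ b, F (a, b) ∂ν := by
  obtain ⟨C, hC⟩ := hF.bdd
  refine ⟨hF.measurable.stronglyMeasurable.integral_prod_right'.measurable, C * ν.real Set.univ,
    fun a => ?_⟩
  exact norm_integral_le_of_norm_le_const (f := fun b => F (a, b))
    (Filter.Eventually.of_forall fun b => hC (a, b))

lemma integral_left {F : α × β → ℝ} (hF : BddMeas F) : BddMeas fun b => ∫ a, F (a, b) ∂μ := by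
  obtain ⟨C, hC⟩ := hF.bdd
  refine ⟨hF.measurable.stronglyMeasurable.integral_prod_left'.measurable, C * μ.real Set.univ,
    fun b => ?_⟩
  exact norm_integral_le_of_norm_le_const (f := fun a => F (a, b))
    (Filter.Eventually.of_forall fun a => hC (a, b))

lemma integral_mono (hf : BddMeas f) (hg : BddMeas g) (h : ∀ a, f a ≤ g a) :
    ∫ a, f a ∂μ ≤ ∫ a, g a ∂μ :=
  MeasureTheory.integral_mono hf.integrable hg.integrable h

lemma integral_add (hf : BddMeas f) (hg : BddMeas g) :
    ∫ a, (f a + g a) ∂μ = ∫ a, f a ∂μ + ∫ a, g a ∂μ :=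
  MeasureTheory.integral_add hf.integrable hg.integrable

lemma integral_sub (hf : BddMeas f) (hg : BddMeas g) :
    ∫ a, (f a - g a) ∂μ = ∫ a, f a ∂μ - ∫ a, g a ∂μ :=
  MeasureTheory.integral_sub hf.integrable hg.integrable

lemma integral_sum {ι : Type*} {s : Finset ι} {F : ι → α → ℝ} (hF : ∀ i, BddMeas (F i)) :
    ∫ a, ∑ i ∈ s, F i a ∂μ = ∑ i ∈ s, ∫ a, F i a ∂μ :=
  integral_finsetSum _ fun i _ => (hF i).integrable

end BddMeas

end BddMeas

section Independence

/-- The σ-algebra generated by the variables whose index satisfies `p`. -/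
abbrev sig {J Ω : Type*} (ξ : J → Ω → ℝ) (p : J → Prop) : MeasurableSpace Ω :=
  MeasurableSpace.comap (fun ω (j : {j // p j}) => ξ j ω) inferInstance

lemma measurable_sig {J Ω : Type*} {ξ : J → Ω → ℝ} {p : J → Prop} {j : J} (hj : p j) :
    Measurable[sig ξ p] (ξ j) :=
  (measurable_pi_apply (X := fun _ : {j // p j} => ℝ) ⟨j, hj⟩).comp
    (comap_measurable (fun ω (j : {j // p j}) => ξ j ω))

variable {Ω : Type*} [mΩ : MeasurableSpace Ω] {μ : Measure Ω}

lemma integral_mul_of_indep {m₁ m₂ : MeasurableSpace Ω} (h : Indep m₁ m₂ μ) (h₁ : m₁ ≤ mΩ)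
    (h₂ : m₂ ≤ mΩ) {f g : Ω → ℝ} (hf : Measurable[m₁] f) (hg : Measurable[m₂] g) :
    ∫ ω, f ω * g ω ∂μ = (∫ ω, f ω ∂μ) * ∫ ω, g ω ∂μ := by
  have hi : IndepFun f g μ := by
    rw [IndepFun_iff_Indep]
    exact indep_of_indep_of_le h hf.comap_le hg.comap_le
  exact hi.integral_fun_mul_eq_mul_integral (hf.mono h₁ le_rfl).aestronglyMeasurable
    (hg.mono h₂ le_rfl).aestronglyMeasurable

variable {J : Type*} {ξ : J → Ω → ℝ} {p : J → Prop}

lemma sig_le (hξ : ∀ j, Measurable (ξ j)) : sig ξ p ≤ mΩ :=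
  Measurable.comap_le (measurable_pi_lambda _ fun j => hξ j)

end Independence
end

end LocalDep
-- Moments of a truncated locally dependent family.
namespace LocalDep

set_option linter.unusedSectionVars false

noncomputable section

variable {J Ω : Type*} [Fintype J]

/-- The quadratic form `∑ i, ξ i * Y i`. -/
def quad (ξ : J → Ω → ℝ) (A : J → Finset J) (ω : Ω) : ℝ := ∑ i, ξ i ω * Y ξ A i ω

/-- The cubic sum `κ² * ∑ i, |ξ i|³`. -/
def cub (ξ : J → Ω → ℝ) (κ : ℝ) (ω : Ω) : ℝ := κ ^ 2 * ∑ i, |ξ i ω| ^ 3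

/-- The absolute value of `ξ i * Y i`. -/
def wt (ξ : J → Ω → ℝ) (A : J → Finset J) (i : J) (ω : Ω) : ℝ := |ξ i ω * Y ξ A i ω|

/-- The sum outside of `C`. -/
def Sout [DecidableEq J] (ξ : J → Ω → ℝ) (C : Finset J) (ω : Ω) : ℝ := ∑ j ∈ Cᶜ, ξ j ω

lemma cub_nonneg (ξ : J → Ω → ℝ) (κ : ℝ) (ω : Ω) : 0 ≤ cub ξ κ ω := by unfold cub; positivity

lemma wt_nonneg (ξ : J → Ω → ℝ) (A : J → Finset J) (i : J) (ω : Ω) : 0 ≤ wt ξ A i ω :=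
  abs_nonneg _

variable [DecidableEq J] [mΩ : MeasurableSpace Ω]

/-- A locally dependent family of bounded variables. -/
structure LocDep (μ : Measure Ω) (ξ : J → Ω → ℝ) (A B : J → Finset J) (κ : ℝ) : Prop where
  meas : ∀ i, Measurable (ξ i)
  small : ∀ ω, SmallVec A B κ fun i => ξ i ω
  indep_A : ∀ i, Indep (sig ξ (· = i)) (sig ξ (· ∉ A i)) μ
  indep_B : ∀ i, Indep (sig ξ (· ∈ A i)) (sig ξ (· ∉ B i)) μ

/-- A locally dependent family, approximately normalized. -/
structure NormDep (μ : Measure Ω) (ξ : J → Ω → ℝ) (A B : J → Finset J) (κ b r θ : ℝ) : Prop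
    extends LocDep μ ξ A B κ where
  sum_mean : ∑ i, |∫ ω, ξ i ω ∂μ| ≤ b
  mean_quad : |∫ ω, quad ξ A ω ∂μ - 1| ≤ 2 * b
  b_le : b ≤ 1 / 16
  cub_le : ∫ ω, cub ξ κ ω ∂μ ≤ r
  theta_le : ∑ i, ∫ ω, wt ξ A i ω ∂μ ≤ θ

variable {μ : Measure Ω} [IsProbabilityMeasure μ] {ξ : J → Ω → ℝ} {A B : J → Finset J}
  {κ b r θ : ℝ}

namespace LocDep

lemma nbhds (h : LocDep μ ξ A B κ) : Nbhds A B κ := by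
  have : Nonempty Ω := nonempty_of_isProbabilityMeasure μ
  exact (h.small (Classical.arbitrary Ω)).toNbhds

lemma one_le (h : LocDep μ ξ A B κ) : 1 ≤ κ := by
  have : Nonempty Ω := nonempty_of_isProbabilityMeasure μ
  exact (h.small (Classical.arbitrary Ω)).one_le

lemma bdd (h : LocDep μ ξ A B κ) (i : J) : BddMeas (ξ i) :=
  BddMeas.of_bound (h.meas i) fun ω => (h.small ω).abs_le_one i

lemma bdd_Y (h : LocDep μ ξ A B κ) (i : J) : BddMeas (Y ξ A i) :=
  BddMeas.sum _ h.bdd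

lemma bdd_S (h : LocDep μ ξ A B κ) : BddMeas (S ξ) := BddMeas.sum _ h.bdd

lemma bdd_Sout (h : LocDep μ ξ A B κ) (C : Finset J) : BddMeas (Sout ξ C) := BddMeas.sum _ h.bdd

lemma bdd_quad (h : LocDep μ ξ A B κ) : BddMeas (quad ξ A) :=
  BddMeas.sum _ fun i => (h.bdd i).mul (h.bdd_Y i)

lemma bdd_cub (h : LocDep μ ξ A B κ) : BddMeas (cub ξ κ) :=
  (BddMeas.const _).mul (BddMeas.sum _ fun i => (h.bdd i).abs.pow 3)

lemma bdd_wt (h : LocDep μ ξ A B κ) (i : J) : BddMeas (wt ξ A i) :=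
  ((h.bdd i).mul (h.bdd_Y i)).abs

lemma abs_Y_le (h : LocDep μ ξ A B κ) (i : J) (ω : Ω) : |Y ξ A i ω| ≤ 1 :=
  (h.small ω).abs_sum_A_le_one i

/-- An active `ξ j` has its own index in `A j`; an inactive one is identically zero. Thus `ξ j`
always depends on the variables in `A j` alone. -/
lemma measurable_xi (h : LocDep μ ξ A B κ) {p : J → Prop} {j : J} (hp : ∀ k ∈ A j, p k) :
    Measurable[sig ξ p] (ξ j) := by
  by_cases hj : j ∈ A j
  · exact measurable_sig (hp j hj)
  · rw [show ξ j = fun _ => 0 from funext fun ω => (h.small ω).zero j hj]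
    exact measurable_const

lemma measurable_Y {p : J → Prop} {j : J} (hp : ∀ k ∈ A j, p k) :
    Measurable[sig ξ p] (Y ξ A j) :=
  Finset.measurable_fun_sum _ fun k hk => measurable_sig (hp k hk)

lemma measurable_wt (h : LocDep μ ξ A B κ) (i : J) :
    Measurable[sig ξ (· ∈ A i)] (wt ξ A i) := by
  have h1 := h.measurable_xi (p := (· ∈ A i)) (j := i) fun _ hk => hk
  have h2 := measurable_Y (ξ := ξ) (p := (· ∈ A i)) (j := i) fun _ hk => hk
  unfold wt
  fun_prop

lemma measurable_Sout {C : Finset J} {p : J → Prop} (hp : ∀ k ∉ C, p k) :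
    Measurable[sig ξ p] (Sout ξ C) :=
  Finset.measurable_fun_sum _ fun k hk => measurable_sig (hp k (Finset.mem_compl.1 hk))

lemma integral_mul_A (h : LocDep μ ξ A B κ) (i : J) {f g : Ω → ℝ}
    (hf : Measurable[sig ξ (· = i)] f) (hg : Measurable[sig ξ (· ∉ A i)] g) :
    ∫ ω, f ω * g ω ∂μ = (∫ ω, f ω ∂μ) * ∫ ω, g ω ∂μ :=
  integral_mul_of_indep (h.indep_A i) (sig_le h.meas) (sig_le h.meas) hf hg

lemma integral_mul_B (h : LocDep μ ξ A B κ) (i : J) {f g : Ω → ℝ}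
    (hf : Measurable[sig ξ (· ∈ A i)] f) (hg : Measurable[sig ξ (· ∉ B i)] g) :
    ∫ ω, f ω * g ω ∂μ = (∫ ω, f ω ∂μ) * ∫ ω, g ω ∂μ :=
  integral_mul_of_indep (h.indep_B i) (sig_le h.meas) (sig_le h.meas) hf hg

lemma S_eq (ξ : J → Ω → ℝ) (C : Finset J) (ω : Ω) : S ξ ω = ∑ j ∈ C, ξ j ω + Sout ξ C ω :=
  (Finset.sum_add_sum_compl C _).symm

lemma S_eq_Y (ξ : J → Ω → ℝ) (A : J → Finset J) (i : J) (ω : Ω) :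
    S ξ ω = Y ξ A i ω + Sout ξ (A i) ω := S_eq ξ (A i) ω

lemma abs_Sout_A_le (h : LocDep μ ξ A B κ) (i : J) (ω : Ω) :
    |Sout ξ (A i) ω| ≤ |S ξ ω| + 1 := by
  have h1 := h.abs_Y_le i ω
  have h2 := S_eq_Y ξ A i ω
  rw [show Sout ξ (A i) ω = S ξ ω - Y ξ A i ω by rw [h2]; ring]
  exact (abs_sub _ _).trans (by linarith)

lemma abs_S_le_Sout_A (h : LocDep μ ξ A B κ) (i : J) (ω : Ω) :
    |S ξ ω| ≤ |Sout ξ (A i) ω| + 1 := by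
  have h1 := h.abs_Y_le i ω
  rw [S_eq_Y ξ A i ω]
  exact (abs_add_le _ _).trans (by linarith)

lemma abs_sum_B_le (h : LocDep μ ξ A B κ) (i : J) (ω : Ω) : |∑ j ∈ B i, ξ j ω| ≤ 1 :=
  (Finset.abs_sum_le_sum_abs _ _).trans ((h.small ω).sum_abs_B_le i)

lemma abs_Sout_B_le (h : LocDep μ ξ A B κ) (i : J) (ω : Ω) :
    |Sout ξ (B i) ω| ≤ |S ξ ω| + 1 := by
  have h1 := h.abs_sum_B_le i ω
  have h2 := S_eq ξ (B i) ω
  rw [show Sout ξ (B i) ω = S ξ ω - ∑ j ∈ B i, ξ j ω by rw [h2]; ring]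
  exact (abs_sub _ _).trans (by linarith)

lemma abs_S_le_Sout_B (h : LocDep μ ξ A B κ) (i : J) (ω : Ω) :
    |S ξ ω| ≤ |Sout ξ (B i) ω| + 1 := by
  have h1 := h.abs_sum_B_le i ω
  rw [S_eq ξ (B i) ω]
  exact (abs_add_le _ _).trans (by linarith)

lemma wt_le (h : LocDep μ ξ A B κ) (i : J) (ω : Ω) : κ * wt ξ A i ω ≤ 1 := by
  have h1 := (h.small ω).bdd i
  have h2 := h.abs_Y_le i ω
  have h3 := h.one_le
  rw [wt, abs_mul, ← mul_assoc]
  exact mul_le_one₀ h1 (abs_nonneg _) h2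

end LocDep

namespace NormDep

lemma b_nonneg (h : NormDep μ ξ A B κ b r θ) : 0 ≤ b :=
  (Finset.sum_nonneg fun _ _ => abs_nonneg _).trans h.sum_mean

lemma r_nonneg (h : NormDep μ ξ A B κ b r θ) : 0 ≤ r :=
  (integral_nonneg fun ω => cub_nonneg ξ κ ω).trans h.cub_le

lemma theta_nonneg (h : NormDep μ ξ A B κ b r θ) : 0 ≤ θ :=
  (Finset.sum_nonneg fun i _ => integral_nonneg fun ω => wt_nonneg ξ A i ω).trans h.theta_le

lemma abs_integral_S_le (h : NormDep μ ξ A B κ b r θ) : |∫ ω, S ξ ω ∂μ| ≤ b := by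
  unfold S
  rw [BddMeas.integral_sum h.bdd]
  exact (Finset.abs_sum_le_sum_abs _ _).trans h.sum_mean

lemma abs_integral_Sout_A_le (h : NormDep μ ξ A B κ b r θ) (i : J) :
    |∫ ω, Sout ξ (A i) ω ∂μ| ≤ b + 1 := by
  have hS := h.bdd_S
  have hY := h.bdd_Y i
  have e : ∫ ω, Sout ξ (A i) ω ∂μ = ∫ ω, S ξ ω ∂μ - ∫ ω, Y ξ A i ω ∂μ := by
    rw [← BddMeas.integral_sub hS hY]
    exact integral_congr_ae (Filter.Eventually.of_forall fun ω => by
      simp only [LocDep.S_eq_Y ξ A i ω]; ring)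
  have h1 : |∫ ω, Y ξ A i ω ∂μ| ≤ 1 := by
    have := norm_integral_le_of_norm_le_const (μ := μ) (f := Y ξ A i) (C := 1)
      (Filter.Eventually.of_forall fun ω => h.abs_Y_le i ω)
    simpa using this
  rw [e]
  exact (abs_sub _ _).trans (by linarith [h.abs_integral_S_le])

/-- Splitting `S = Y i + Sout (A i)` in each `ξ i * S` gives the quadratic form plus products that
factor by (LD1), with total at most `b (b + 1)` because the truncated means are small rather than
zero. -/
lemma integral_S_sq_le (h : NormDep μ ξ A B κ b r θ) : ∫ ω, S ξ ω ^ 2 ∂μ ≤ 2 := by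
  have hb := h.bdd
  have hY := h.bdd_Y
  have hO := h.bdd_Sout
  have e : ∫ ω, S ξ ω ^ 2 ∂μ
      = ∫ ω, quad ξ A ω ∂μ + ∑ i, (∫ ω, ξ i ω ∂μ) * ∫ ω, Sout ξ (A i) ω ∂μ := by
    have e1 : ∀ ω, S ξ ω ^ 2 = quad ξ A ω + ∑ i, ξ i ω * Sout ξ (A i) ω := fun ω => by
      rw [quad, ← Finset.sum_add_distrib, sq]
      nth_rewrite 1 [S]
      rw [Finset.sum_mul]
      exact Finset.sum_congr rfl fun i _ => by rw [LocDep.S_eq_Y ξ A i ω]; ring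
    simp_rw [e1]
    rw [BddMeas.integral_add h.bdd_quad (by fun_prop), BddMeas.integral_sum (by fun_prop)]
    congr 1
    exact Finset.sum_congr rfl fun i _ => h.integral_mul_A i (measurable_sig rfl)
      (LocDep.measurable_Sout fun k hk => hk)
  have h1 : |∑ i, (∫ ω, ξ i ω ∂μ) * ∫ ω, Sout ξ (A i) ω ∂μ| ≤ b * (b + 1) := by
    calc _ ≤ ∑ i, |(∫ ω, ξ i ω ∂μ) * ∫ ω, Sout ξ (A i) ω ∂μ| := Finset.abs_sum_le_sum_abs _ _
      _ ≤ ∑ i, |∫ ω, ξ i ω ∂μ| * (b + 1) := Finset.sum_le_sum fun i _ => by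
          rw [abs_mul]
          exact mul_le_mul_of_nonneg_left (h.abs_integral_Sout_A_le i) (abs_nonneg _)
      _ ≤ b * (b + 1) := by
          rw [← Finset.sum_mul]
          exact mul_le_mul_of_nonneg_right h.sum_mean (by linarith [h.b_nonneg])
  have h2 := (abs_le.1 h.mean_quad).2
  have h3 := (abs_le.1 h1).2
  nlinarith [h.b_le, h.b_nonneg]

lemma integral_abs_S_le (h : NormDep μ ξ A B κ b r θ) : ∫ ω, |S ξ ω| ∂μ ≤ 2 := by
  have hS := h.bdd_S
  have h1 : ∫ ω, |S ξ ω| ∂μ ≤ ∫ ω, (1 + S ξ ω ^ 2) / 2 ∂μ :=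
    BddMeas.integral_mono (by fun_prop) (by fun_prop) fun ω => by
      rw [← sq_abs (S ξ ω)]
      nlinarith [sq_nonneg (|S ξ ω| - 1)]
  have h2 : ∫ ω, (1 + S ξ ω ^ 2) / 2 ∂μ = (1 + ∫ ω, S ξ ω ^ 2 ∂μ) / 2 := by
    rw [integral_div, BddMeas.integral_add (by fun_prop) (by fun_prop)]
    simp
  linarith [h.integral_S_sq_le]

lemma integral_abs_Sout_A_le (h : NormDep μ ξ A B κ b r θ) (i : J) :
    ∫ ω, |Sout ξ (A i) ω| ∂μ ≤ 3 := by
  have hS := h.bdd_S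
  have hO := h.bdd_Sout (A i)
  have h1 : ∫ ω, |Sout ξ (A i) ω| ∂μ ≤ ∫ ω, (|S ξ ω| + 1) ∂μ :=
    BddMeas.integral_mono (by fun_prop) (by fun_prop) fun ω => h.abs_Sout_A_le i ω
  rw [BddMeas.integral_add (by fun_prop) (by fun_prop)] at h1
  simp only [integral_const, probReal_univ, smul_eq_mul, mul_one] at h1
  linarith [h.integral_abs_S_le]

lemma integral_abs_Sout_B_le (h : NormDep μ ξ A B κ b r θ) (i : J) :
    ∫ ω, |Sout ξ (B i) ω| ∂μ ≤ 3 := by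
  have hS := h.bdd_S
  have hO := h.bdd_Sout (B i)
  have h1 : ∫ ω, |Sout ξ (B i) ω| ∂μ ≤ ∫ ω, (|S ξ ω| + 1) ∂μ :=
    BddMeas.integral_mono (by fun_prop) (by fun_prop) fun ω => h.abs_Sout_B_le i ω
  rw [BddMeas.integral_add (by fun_prop) (by fun_prop)] at h1
  simp only [integral_const, probReal_univ, smul_eq_mul, mul_one] at h1
  linarith [h.integral_abs_S_le]

/-- Removing `A i` changes `|S|` by at most 1 and makes it independent of `ξ i`; the constant is 2
plus the bound 3 for the remaining first moment. -/
lemma integral_cube_mul_le (h : NormDep μ ξ A B κ b r θ) (i : J) :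
    ∫ ω, |ξ i ω| ^ 3 * (1 + |S ξ ω|) ∂μ ≤ 5 * ∫ ω, |ξ i ω| ^ 3 ∂μ := by
  have hS := h.bdd_S
  have hO := h.bdd_Sout (A i)
  have hb := h.bdd
  have h0 : 0 ≤ ∫ ω, |ξ i ω| ^ 3 ∂μ := integral_nonneg fun ω => by positivity
  calc _ ≤ ∫ ω, |ξ i ω| ^ 3 * (2 + |Sout ξ (A i) ω|) ∂μ :=
        BddMeas.integral_mono (by fun_prop) (by fun_prop) fun ω =>
          mul_le_mul_of_nonneg_left (by linarith [h.abs_S_le_Sout_A i ω]) (by positivity)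
    _ = (∫ ω, |ξ i ω| ^ 3 ∂μ) * ∫ ω, (2 + |Sout ξ (A i) ω|) ∂μ := by
        have h1 : Measurable[sig ξ (· = i)] (ξ i) := measurable_sig rfl
        have h2 : Measurable[sig ξ (· ∉ A i)] (Sout ξ (A i)) :=
          LocDep.measurable_Sout fun _ hk => hk
        exact h.integral_mul_A i (by fun_prop) (by fun_prop)
    _ ≤ (∫ ω, |ξ i ω| ^ 3 ∂μ) * 5 := by
        refine mul_le_mul_of_nonneg_left ?_ h0
        rw [BddMeas.integral_add (by fun_prop) (by fun_prop)]
        simp only [integral_const, probReal_univ, smul_eq_mul, one_mul]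
        linarith [h.integral_abs_Sout_A_le i]
    _ = _ := mul_comm _ _

lemma kappa_sq_mul_sum_cube_le (h : NormDep μ ξ A B κ b r θ) :
    κ ^ 2 * ∑ i, ∫ ω, |ξ i ω| ^ 3 ∂μ ≤ r := by
  have hb := h.bdd
  refine le_trans (le_of_eq ?_) h.cub_le
  unfold cub
  rw [integral_const_mul, BddMeas.integral_sum (by fun_prop)]

lemma sum_cube_mul_le (h : NormDep μ ξ A B κ b r θ) :
    κ ^ 2 * ∑ i, ∫ ω, |ξ i ω| ^ 3 * (1 + |S ξ ω|) ∂μ ≤ 5 * r := by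
  have h1 : κ ^ 2 * ∑ i, ∫ ω, |ξ i ω| ^ 3 * (1 + |S ξ ω|) ∂μ
      ≤ κ ^ 2 * ∑ i, 5 * ∫ ω, |ξ i ω| ^ 3 ∂μ :=
    mul_le_mul_of_nonneg_left (Finset.sum_le_sum fun i _ => h.integral_cube_mul_le i)
      (sq_nonneg κ)
  rw [← Finset.mul_sum] at h1
  linarith [h.kappa_sq_mul_sum_cube_le]

lemma integral_cub_mul_le (h : NormDep μ ξ A B κ b r θ) :
    ∫ ω, cub ξ κ ω * (1 + |S ξ ω|) ∂μ ≤ 5 * r := by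
  have hb := h.bdd
  have hS := h.bdd_S
  refine le_trans (le_of_eq ?_) h.sum_cube_mul_le
  unfold cub
  simp_rw [mul_assoc, Finset.sum_mul]
  rw [integral_const_mul, BddMeas.integral_sum (by fun_prop)]

/-- A weight depending on the variables in `A i` does not see the size of the total sum. -/
lemma integral_mul_abs_S_le (h : NormDep μ ξ A B κ b r θ) (i : J) {Z : Ω → ℝ} (hZ : BddMeas Z)
    (hZm : Measurable[sig ξ (· ∈ A i)] Z) (hZ0 : ∀ ω, 0 ≤ Z ω) :
    ∫ ω, Z ω * |S ξ ω| ∂μ ≤ 4 * ∫ ω, Z ω ∂μ := by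
  have hS := h.bdd_S
  have hO := h.bdd_Sout (B i)
  have h0 : 0 ≤ ∫ ω, Z ω ∂μ := integral_nonneg hZ0
  calc _ ≤ ∫ ω, Z ω * (1 + |Sout ξ (B i) ω|) ∂μ :=
        BddMeas.integral_mono (by fun_prop) (by fun_prop) fun ω =>
          mul_le_mul_of_nonneg_left (by linarith [h.abs_S_le_Sout_B i ω]) (hZ0 ω)
    _ = (∫ ω, Z ω ∂μ) * ∫ ω, (1 + |Sout ξ (B i) ω|) ∂μ := by
        have h2 : Measurable[sig ξ (· ∉ B i)] (Sout ξ (B i)) :=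
          LocDep.measurable_Sout fun _ hk => hk
        exact h.integral_mul_B i hZm (by fun_prop)
    _ ≤ (∫ ω, Z ω ∂μ) * 4 := by
        refine mul_le_mul_of_nonneg_left ?_ h0
        rw [BddMeas.integral_add (by fun_prop) (by fun_prop)]
        simp only [integral_const, probReal_univ, smul_eq_mul, one_mul]
        linarith [h.integral_abs_Sout_B_le i]
    _ = _ := mul_comm _ _

lemma integral_mul_far_cub_le (h : NormDep μ ξ A B κ b r θ) (i : J) {Z : Ω → ℝ} (hZ : BddMeas Z)
    (hZm : Measurable[sig ξ (· ∈ A i)] Z) (hZ0 : ∀ ω, 0 ≤ Z ω) :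
    ∫ ω, Z ω * ((κ ^ 2 * ∑ j ∈ (B i)ᶜ, |ξ j ω| ^ 3) * (1 + |S ξ ω|)) ∂μ
      ≤ 15 * r * ∫ ω, Z ω ∂μ := by
  have hb := h.bdd
  have hS := h.bdd_S
  have hc := h.bdd_cub
  have hO := h.bdd_Sout (B i)
  have h0 : 0 ≤ ∫ ω, Z ω ∂μ := integral_nonneg hZ0
  calc _ ≤ ∫ ω, Z ω * ((κ ^ 2 * ∑ j ∈ (B i)ᶜ, |ξ j ω| ^ 3) * (2 + |Sout ξ (B i) ω|)) ∂μ :=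
        BddMeas.integral_mono (by fun_prop) (by fun_prop) fun ω =>
          mul_le_mul_of_nonneg_left (mul_le_mul_of_nonneg_left
            (by linarith [h.abs_S_le_Sout_B i ω]) (by positivity)) (hZ0 ω)
    _ = (∫ ω, Z ω ∂μ) *
        ∫ ω, (κ ^ 2 * ∑ j ∈ (B i)ᶜ, |ξ j ω| ^ 3) * (2 + |Sout ξ (B i) ω|) ∂μ := by
        have h2 : Measurable[sig ξ (· ∉ B i)] (Sout ξ (B i)) :=
          LocDep.measurable_Sout fun _ hk => hk
        have h3 : Measurable[sig ξ (· ∉ B i)] fun ω => ∑ j ∈ (B i)ᶜ, |ξ j ω| ^ 3 := by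
          refine Finset.measurable_fun_sum _ fun k hk => ?_
          have : Measurable[sig ξ (· ∉ B i)] (ξ k) := measurable_sig (Finset.mem_compl.1 hk)
          fun_prop
        exact h.integral_mul_B i hZm (by fun_prop)
    _ ≤ (∫ ω, Z ω ∂μ) * ∫ ω, 3 * (cub ξ κ ω * (1 + |S ξ ω|)) ∂μ := by
        refine mul_le_mul_of_nonneg_left ?_ h0
        refine BddMeas.integral_mono (by fun_prop) (by fun_prop) fun ω => ?_
        have h4 : κ ^ 2 * ∑ j ∈ (B i)ᶜ, |ξ j ω| ^ 3 ≤ cub ξ κ ω :=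
          mul_le_mul_of_nonneg_left (Finset.sum_le_sum_of_subset_of_nonneg
            (Finset.subset_univ _) fun _ _ _ => by positivity) (sq_nonneg κ)
        have h5 : 2 + |Sout ξ (B i) ω| ≤ 3 * (1 + |S ξ ω|) := by
          linarith [h.abs_Sout_B_le i ω, abs_nonneg (S ξ ω)]
        exact (mul_le_mul h4 h5 (by positivity) (cub_nonneg _ _ _)).trans (le_of_eq (by ring))
    _ ≤ (∫ ω, Z ω ∂μ) * (15 * r) := by
        refine mul_le_mul_of_nonneg_left ?_ h0
        rw [integral_const_mul]
        linarith [h.integral_cub_mul_le]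
    _ = _ := mul_comm _ _

/-- Decoupling of the weights `|ξ i * Y i|` from the cubic sum. -/
lemma sum_integral_wt_mul_cub_le (h : NormDep μ ξ A B κ b r θ) :
    ∑ i, ∫ ω, wt ξ A i ω * (cub ξ κ ω * (1 + |S ξ ω|)) ∂μ ≤ 15 * (1 + θ) * r := by
  have hb := h.bdd
  have hS := h.bdd_S
  have hw := h.bdd_wt
  have hr := h.r_nonneg
  have hκ := h.one_le
  have hsplit : ∀ i, ∫ ω, wt ξ A i ω * (cub ξ κ ω * (1 + |S ξ ω|)) ∂μ
      ≤ κ * ∑ j ∈ B i, ∫ ω, |ξ j ω| ^ 3 * (1 + |S ξ ω|) ∂μ + 15 * r * ∫ ω, wt ξ A i ω ∂μ := by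
    intro i
    have e : ∀ ω, wt ξ A i ω * (cub ξ κ ω * (1 + |S ξ ω|))
        = ∑ j ∈ B i, wt ξ A i ω * κ ^ 2 * (|ξ j ω| ^ 3 * (1 + |S ξ ω|))
          + wt ξ A i ω * ((κ ^ 2 * ∑ j ∈ (B i)ᶜ, |ξ j ω| ^ 3) * (1 + |S ξ ω|)) := fun ω => by
      rw [cub, ← Finset.sum_add_sum_compl (B i), ← Finset.mul_sum, ← Finset.sum_mul]
      ring
    simp_rw [e]
    rw [BddMeas.integral_add (by fun_prop) (by fun_prop), BddMeas.integral_sum (by fun_prop)]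
    refine add_le_add ?_ (h.integral_mul_far_cub_le i (hw i) (h.measurable_wt i) (wt_nonneg ξ A i))
    rw [Finset.mul_sum]
    refine Finset.sum_le_sum fun j _ => ?_
    rw [← integral_const_mul]
    refine BddMeas.integral_mono (by fun_prop) (by fun_prop) fun ω => ?_
    refine mul_le_mul_of_nonneg_right ?_ (by positivity)
    -- For nearby indices one factor `κ` is spent on `κ * wt ≤ 1`. The factor `κ` that remains is
    -- matched below by another from the overlap of the sets `B i`, which restores `κ²` in front of
    -- the cubes.
    have := h.wt_le i ω
    nlinarith
  refine (Finset.sum_le_sum fun i _ => hsplit i).trans ?_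
  rw [Finset.sum_add_distrib, ← Finset.mul_sum, ← Finset.mul_sum]
  have h1 := h.nbhds.sum_sum_mem_B_le (c := fun j => ∫ ω, |ξ j ω| ^ 3 * (1 + |S ξ ω|) ∂μ)
    fun j => integral_nonneg fun ω => by positivity
  have h2 := h.sum_cube_mul_le
  have h3 := mul_le_mul_of_nonneg_left h.theta_le (by positivity : 0 ≤ 15 * r)
  have h4 := mul_le_mul_of_nonneg_left h1 (by linarith : 0 ≤ κ)
  nlinarith

end NormDep
end
end LocalDep
-- The random kernel: its mean, its variance and its decoupling from local weights.
namespace LocalDep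

set_option linter.unusedSectionVars false

noncomputable section

variable {J Ω : Type*} [Fintype J]

/-- The kernel of the leave-one-out increment of `j`. -/
def kerTerm (ξ : J → Ω → ℝ) (A : J → Finset J) (j : J) (p : Ω × ℝ) : ℝ :=
  ξ j p.1 * kern (Y ξ A j p.1) p.2

/-- The sum of the kernels over `N`. -/
def kerSum (ξ : J → Ω → ℝ) (A : J → Finset J) (N : Finset J) (p : Ω × ℝ) : ℝ :=
  ∑ j ∈ N, kerTerm ξ A j p

variable [DecidableEq J] [mΩ : MeasurableSpace Ω]

/-- The expectation of `kerSum`. -/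
def kerMean (μ : Measure Ω) (ξ : J → Ω → ℝ) (A : J → Finset J) (N : Finset J) (t : ℝ) : ℝ :=
  ∫ ω, kerSum ξ A N (ω, t) ∂μ

variable {μ : Measure Ω} [IsProbabilityMeasure μ] {ξ : J → Ω → ℝ} {A B : J → Finset J}
  {κ b r θ : ℝ}

/-- Cauchy–Schwarz; 2 is the length of `[-1, 1]`. -/
lemma sq_integral_lebUnit_le {g : ℝ → ℝ} (hg : BddMeas g) :
    (∫ t, g t ∂lebUnit) ^ 2 ≤ 2 * ∫ t, g t ^ 2 ∂lebUnit := by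
  set c := ∫ t, g t ∂lebUnit with hc
  have h0 : 0 ≤ ∫ t, (g t - c / 2) ^ 2 ∂lebUnit := integral_nonneg fun t => sq_nonneg _
  have e : ∀ t, (g t - c / 2) ^ 2 = (g t ^ 2 - c * g t) + c ^ 2 / 4 := fun t => by ring
  simp_rw [e] at h0
  rw [BddMeas.integral_add (by fun_prop) (by fun_prop),
    BddMeas.integral_sub (by fun_prop) (by fun_prop), integral_const_mul, ← hc] at h0
  have hm : lebUnit.real Set.univ = 2 := by
    simp [lebUnit, measureReal_def]; norm_num
  rw [integral_const, hm, smul_eq_mul] at h0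
  linarith

namespace LocDep

lemma bdd_kerTerm (h : LocDep μ ξ A B κ) (j : J) : BddMeas (kerTerm ξ A j) := by
  refine BddMeas.mul (h.bdd j).comp_fst (BddMeas.of_bound ?_ fun p => abs_kern_le_one _ _)
  exact measurable_kern.comp (((h.bdd_Y j).measurable.comp measurable_fst).prodMk measurable_snd)

lemma bdd_kerSum (h : LocDep μ ξ A B κ) (N : Finset J) : BddMeas (kerSum ξ A N) :=
  BddMeas.sum _ h.bdd_kerTerm

lemma bdd_kerMean (h : LocDep μ ξ A B κ) (N : Finset J) : BddMeas (kerMean μ ξ A N) :=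
  (h.bdd_kerSum N).integral_left

lemma measurable_kerTerm (h : LocDep μ ξ A B κ) {p : J → Prop} {j : J} (hp : ∀ k ∈ A j, p k)
    (t : ℝ) : Measurable[sig ξ p] fun ω => kerTerm ξ A j (ω, t) := by
  have h1 := h.measurable_xi hp
  have h2 := measurable_Y (ξ := ξ) hp
  have h3 : Measurable fun x => kern x t :=
    measurable_kern.comp (measurable_id.prodMk measurable_const)
  exact Measurable.mul h1 (h3.comp h2)

lemma integral_kerTerm_sq (h : LocDep μ ξ A B κ) (j : J) (ω : Ω) :
    ∫ t, kerTerm ξ A j (ω, t) ^ 2 ∂lebUnit = ξ j ω ^ 2 * |Y ξ A j ω| := by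
  simp_rw [kerTerm, mul_pow, kern_sq]
  rw [integral_const_mul, integral_abs_kern (h.abs_Y_le j ω)]

lemma kappa_mul_sum_sq_le_cub (h : LocDep μ ξ A B κ) (ω : Ω) :
    κ * ∑ j, ξ j ω ^ 2 * |Y ξ A j ω| ≤ cub ξ κ ω := (h.small ω).kappa_mul_sum_sq_mul_abs_le

lemma integral_kerSum_univ (h : LocDep μ ξ A B κ) (ω : Ω) :
    ∫ t, kerSum ξ A Finset.univ (ω, t) ∂lebUnit = quad ξ A ω := by
  unfold kerSum quad
  rw [BddMeas.integral_sum fun j => (h.bdd_kerTerm j).slice_left ω]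
  refine Finset.sum_congr rfl fun j _ => ?_
  simp_rw [kerTerm]
  rw [integral_const_mul, integral_kern (h.abs_Y_le j ω)]

/-- Cauchy–Schwarz over at most `κ` summands, then `kern² = |kern|` turns the integrals into `ξ j²
|Y j|`. This pointwise bound serves the kernels near a given index, for which independence is not
available. -/
lemma integral_kerSum_sq_le (h : LocDep μ ξ A B κ) {N : Finset J} (hN : (N.card : ℝ) ≤ κ)
    (ω : Ω) : ∫ t, kerSum ξ A N (ω, t) ^ 2 ∂lebUnit ≤ cub ξ κ ω := by
  have hk : ∀ j, BddMeas fun t => kerTerm ξ A j (ω, t) := fun j => (h.bdd_kerTerm j).slice_left ω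
  have hM : BddMeas fun t => kerSum ξ A N (ω, t) := (h.bdd_kerSum N).slice_left ω
  refine le_trans ?_ (h.kappa_mul_sum_sq_le_cub ω)
  have e : κ * ∑ j, ξ j ω ^ 2 * |Y ξ A j ω|
      = ∫ t, κ * ∑ j, kerTerm ξ A j (ω, t) ^ 2 ∂lebUnit := by
    rw [integral_const_mul, BddMeas.integral_sum (by fun_prop)]
    simp_rw [h.integral_kerTerm_sq]
  rw [e]
  refine BddMeas.integral_mono (by fun_prop) (by fun_prop) fun t => ?_
  have h0 : 0 ≤ ∑ j, kerTerm ξ A j (ω, t) ^ 2 := Finset.sum_nonneg fun _ _ => sq_nonneg _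
  refine (sq_sum_le_card_mul_sum_sq (s := N) (f := fun j => kerTerm ξ A j (ω, t))).trans ?_
  exact mul_le_mul hN (Finset.sum_le_sum_of_subset_of_nonneg (Finset.subset_univ _)
    fun _ _ _ => sq_nonneg _) (Finset.sum_nonneg fun _ _ => sq_nonneg _)
    (by linarith [h.one_le])

lemma sq_integral_le {g : Ω → ℝ} (hg : BddMeas g) : (∫ ω, g ω ∂μ) ^ 2 ≤ ∫ ω, g ω ^ 2 ∂μ := by
  set c := ∫ ω, g ω ∂μ with hc
  have h0 : 0 ≤ ∫ ω, (g ω - c) ^ 2 ∂μ := integral_nonneg fun t => sq_nonneg _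
  have e : ∀ ω, (g ω - c) ^ 2 = (g ω ^ 2 - 2 * c * g ω) + c ^ 2 := fun t => by ring
  simp_rw [e] at h0
  rw [BddMeas.integral_add (by fun_prop) (by fun_prop),
    BddMeas.integral_sub (by fun_prop) (by fun_prop), integral_const_mul, ← hc] at h0
  simp only [integral_const, probReal_univ, smul_eq_mul, one_mul] at h0
  linarith

lemma integral_sub_mean_sq_le {g : Ω → ℝ} (hg : BddMeas g) :
    ∫ ω, (g ω - ∫ ω', g ω' ∂μ) ^ 2 ∂μ ≤ ∫ ω, g ω ^ 2 ∂μ := by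
  set c := ∫ ω, g ω ∂μ with hc
  have e : ∀ ω, (g ω - c) ^ 2 = (g ω ^ 2 - 2 * c * g ω) + c ^ 2 := fun t => by ring
  simp_rw [e]
  rw [BddMeas.integral_add (by fun_prop) (by fun_prop),
    BddMeas.integral_sub (by fun_prop) (by fun_prop), integral_const_mul, ← hc]
  simp only [integral_const, probReal_univ, smul_eq_mul, one_mul]
  nlinarith [sq_nonneg c]

/-- Variance bound for sums of kernels: only pairs which are dependent in both directions
contribute. -/
lemma integral_kerSum_sub_mean_sq_le (h : LocDep μ ξ A B κ) (N : Finset J) (t : ℝ) :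
    ∫ ω, (kerSum ξ A N (ω, t) - kerMean μ ξ A N t) ^ 2 ∂μ
      ≤ κ * ∑ j, ∫ ω, kerTerm ξ A j (ω, t) ^ 2 ∂μ := by
  have hk : ∀ j, BddMeas fun ω => kerTerm ξ A j (ω, t) := fun j => (h.bdd_kerTerm j).slice_right t
  set D : J → Ω → ℝ := fun j ω => kerTerm ξ A j (ω, t) - ∫ ω', kerTerm ξ A j (ω', t) ∂μ with hD
  have hDb : ∀ j, BddMeas (D j) := fun j => by simp only [hD]; fun_prop
  have hD0 : ∀ j, ∫ ω, D j ω ∂μ = 0 := fun j => by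
    simp only [hD]
    rw [BddMeas.integral_sub (hk j) (by fun_prop)]
    simp
  have hDm : ∀ (j : J) (p : J → Prop), (∀ k ∈ A j, p k) → Measurable[sig ξ p] (D j) :=
    fun j p hp => by
      have := h.measurable_kerTerm hp t
      simp only [hD]
      fun_prop
  have hD2 : ∀ j, ∫ ω, D j ω ^ 2 ∂μ ≤ ∫ ω, kerTerm ξ A j (ω, t) ^ 2 ∂μ := fun j =>
    integral_sub_mean_sq_le (hk j)
  have hsum : ∀ ω, kerSum ξ A N (ω, t) - kerMean μ ξ A N t = ∑ j ∈ N, D j ω := fun ω => by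
    simp only [hD, kerMean, kerSum]
    rw [Finset.sum_sub_distrib, BddMeas.integral_sum hk]
  -- If `B j ∩ A k` is empty, the `k`-th kernel depends only on variables outside `B j` and the
  -- covariance vanishes by (LD2); likewise with the roles exchanged. Asking for both overlaps makes
  -- the weight symmetric, and its rows sum to at most `κ`.
  set w : J → J → ℝ := fun j k =>
    if (B j ∩ A k).Nonempty ∧ (B k ∩ A j).Nonempty then 1 else 0 with hw
  have hw0 : ∀ j k, 0 ≤ w j k := fun j k => by simp only [hw]; split_ifs <;> norm_num
  have hwc : ∀ j k, w j k = w k j := fun j k => by simp only [hw, and_comm]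
  have hrow : ∀ j, ∑ k, w j k ≤ κ := fun j => by
    refine le_trans ?_ (h.nbhds.kappa j).1
    rw [← Finset.sum_boole]
    refine Finset.sum_le_sum fun k _ => ?_
    simp only [hw]
    split_ifs <;> simp_all
  have hcov : ∀ j k, ∫ ω, D j ω * D k ω ∂μ
      ≤ w j k * ((∫ ω, D j ω ^ 2 ∂μ + ∫ ω, D k ω ^ 2 ∂μ) / 2) := by
    intro j k
    have hdis : ∀ {s u : Finset J}, ¬ (s ∩ u).Nonempty → ∀ l ∈ u, l ∉ s := fun hn l hl hl' =>
      hn ⟨l, Finset.mem_inter.2 ⟨hl', hl⟩⟩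
    by_cases h1 : (B j ∩ A k).Nonempty
    · by_cases h2 : (B k ∩ A j).Nonempty
      · simp only [hw, if_pos (And.intro h1 h2), one_mul]
        have := hDb j
        have := hDb k
        rw [← BddMeas.integral_add (by fun_prop) (by fun_prop), ← integral_div]
        exact BddMeas.integral_mono (by fun_prop) (by fun_prop) fun ω => by
          nlinarith [sq_nonneg (D j ω - D k ω)]
      · simp only [hw, h2, and_false, if_false, zero_mul]
        refine le_of_eq ?_
        simp_rw [mul_comm (D j _)]
        rw [h.integral_mul_B k (hDm k _ fun _ hl => hl) (hDm j _ (hdis h2)), hD0, zero_mul]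
    · simp only [hw, h1, false_and, if_false, zero_mul]
      refine le_of_eq ?_
      rw [h.integral_mul_B j (hDm j _ fun _ hl => hl) (hDm k _ (hdis h1)), hD0, zero_mul]
  simp_rw [hsum, sq, Finset.sum_mul_sum]
  simp_rw [← sq]
  set d : J → ℝ := fun j => ∫ ω, D j ω ^ 2 ∂μ with hd
  have hd0 : ∀ j, 0 ≤ d j := fun j => integral_nonneg fun ω => sq_nonneg _
  calc ∫ ω, ∑ j ∈ N, ∑ k ∈ N, D j ω * D k ω ∂μ
      = ∑ j ∈ N, ∑ k ∈ N, ∫ ω, D j ω * D k ω ∂μ := by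
        rw [BddMeas.integral_sum (by fun_prop)]
        exact Finset.sum_congr rfl fun j _ => BddMeas.integral_sum (by fun_prop)
    _ ≤ ∑ j ∈ N, ∑ k ∈ N, w j k * ((d j + d k) / 2) :=
        Finset.sum_le_sum fun j _ => Finset.sum_le_sum fun k _ => hcov j k
    _ ≤ ∑ j, ∑ k, w j k * ((d j + d k) / 2) := by
        have h0 : ∀ j k, 0 ≤ w j k * ((d j + d k) / 2) := fun j k =>
          mul_nonneg (hw0 j k) (by linarith [hd0 j, hd0 k])
        refine (Finset.sum_le_sum fun j _ => Finset.sum_le_sum_of_subset_of_nonneg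
          (Finset.subset_univ _) fun k _ _ => h0 j k).trans ?_
        exact Finset.sum_le_sum_of_subset_of_nonneg (Finset.subset_univ _)
          fun j _ _ => Finset.sum_nonneg fun k _ => h0 j k
    _ = ∑ j, ∑ k, w j k * d j := by
        have e1 : ∀ j k, w j k * ((d j + d k) / 2) = w j k * d j / 2 + w j k * d k / 2 :=
          fun j k => by ring
        simp_rw [e1, Finset.sum_add_distrib]
        have e2 : ∑ j, ∑ k, w j k * d k / 2 = ∑ j, ∑ k, w j k * d j / 2 := by
          rw [Finset.sum_comm]
          exact Finset.sum_congr rfl fun j _ => Finset.sum_congr rfl fun k _ => by rw [hwc]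
        rw [e2, ← Finset.sum_add_distrib]
        exact Finset.sum_congr rfl fun j _ => by
          rw [← Finset.sum_add_distrib]
          exact Finset.sum_congr rfl fun k _ => by ring
    _ ≤ κ * ∑ j, d j := by
        rw [Finset.mul_sum]
        refine Finset.sum_le_sum fun j _ => ?_
        rw [← Finset.sum_mul]
        exact mul_le_mul_of_nonneg_right (hrow j) (hd0 j)
    _ ≤ _ := mul_le_mul_of_nonneg_left (Finset.sum_le_sum fun j _ => hD2 j)
        (by linarith [h.one_le])

lemma bdd_kerDev (h : LocDep μ ξ A B κ) (N : Finset J) :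
    BddMeas fun p : Ω × ℝ => (kerSum ξ A N p - kerMean μ ξ A N p.2) ^ 2 :=
  ((h.bdd_kerSum N).sub (h.bdd_kerMean N).comp_snd).pow 2

end LocDep

namespace NormDep

/-- The variance bound is integrated over `t`: the factor `κ` and the integrals `ξ j² |Y j|` combine
into the cubic sum. -/
lemma integral_integral_kerDev_le (h : NormDep μ ξ A B κ b r θ) (N : Finset J) :
    ∫ t, ∫ ω, (kerSum ξ A N (ω, t) - kerMean μ ξ A N t) ^ 2 ∂μ ∂lebUnit ≤ r := by
  have hb := h.bdd
  have hY := h.bdd_Y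
  have hk : ∀ j, BddMeas fun p => kerTerm ξ A j p ^ 2 := fun j => (h.bdd_kerTerm j).pow 2
  have hki : ∀ j, BddMeas fun t => ∫ ω, kerTerm ξ A j (ω, t) ^ 2 ∂μ := fun j =>
    (hk j).integral_left
  calc _ ≤ ∫ t, κ * ∑ j, ∫ ω, kerTerm ξ A j (ω, t) ^ 2 ∂μ ∂lebUnit :=
        BddMeas.integral_mono (h.bdd_kerDev N).integral_left (by fun_prop)
          fun t => h.integral_kerSum_sub_mean_sq_le N t
    _ = κ * ∑ j, ∫ ω, ξ j ω ^ 2 * |Y ξ A j ω| ∂μ := by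
        rw [integral_const_mul, BddMeas.integral_sum hki]
        congr 1
        refine Finset.sum_congr rfl fun j _ => ?_
        rw [← (hk j).integral_swap (μ := μ) (ν := lebUnit)]
        simp_rw [h.integral_kerTerm_sq]
    _ = ∫ ω, κ * ∑ j, ξ j ω ^ 2 * |Y ξ A j ω| ∂μ := by
        rw [integral_const_mul, BddMeas.integral_sum (by fun_prop)]
    _ ≤ ∫ ω, cub ξ κ ω ∂μ :=
        BddMeas.integral_mono (by fun_prop) h.bdd_cub h.kappa_mul_sum_sq_le_cub
    _ ≤ r := h.cub_le

lemma integral_kerMean_sq_le (h : NormDep μ ξ A B κ b r θ) {N : Finset J}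
    (hN : (N.card : ℝ) ≤ κ) : ∫ t, kerMean μ ξ A N t ^ 2 ∂lebUnit ≤ r := by
  have hM : BddMeas fun p => kerSum ξ A N p ^ 2 := (h.bdd_kerSum N).pow 2
  calc _ ≤ ∫ t, ∫ ω, kerSum ξ A N (ω, t) ^ 2 ∂μ ∂lebUnit :=
        BddMeas.integral_mono ((h.bdd_kerMean N).pow 2) hM.integral_left fun t =>
          LocDep.sq_integral_le ((h.bdd_kerSum N).slice_right t)
    _ = ∫ ω, ∫ t, kerSum ξ A N (ω, t) ^ 2 ∂lebUnit ∂μ := (hM.integral_swap).symm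
    _ ≤ ∫ ω, cub ξ κ ω ∂μ :=
        BddMeas.integral_mono hM.integral_right h.bdd_cub fun ω => h.integral_kerSum_sq_le hN ω
    _ ≤ r := h.cub_le

/-- Decoupling of a weight depending on the variables in `A i` from the kernel fluctuations. -/
lemma integral_mul_kerDev_le (h : NormDep μ ξ A B κ b r θ) (i : J) {Z : Ω → ℝ} (hZ : BddMeas Z)
    (hZm : Measurable[sig ξ (· ∈ A i)] Z) (hZ0 : ∀ ω, 0 ≤ Z ω) :
    ∫ ω, Z ω * ∫ t, (kerSum ξ A Finset.univ (ω, t) - kerMean μ ξ A Finset.univ t) ^ 2 ∂lebUnit ∂μ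
      ≤ 6 * r * ∫ ω, Z ω ∂μ + 4 * ∫ ω, Z ω * cub ξ κ ω ∂μ := by
  -- Kernels outside `N` depend only on variables outside `B i`, hence are independent of `Z`; `N`
  -- has at most `κ` elements and is handled by the pointwise Cauchy–Schwarz bound.
  set N : Finset J := Finset.univ.filter fun j => (B i ∩ A j).Nonempty with hN
  have hNκ : (N.card : ℝ) ≤ κ := (h.nbhds.kappa i).1
  have h0 : 0 ≤ ∫ ω, Z ω ∂μ := integral_nonneg hZ0
  have hc := h.bdd_cub
  have hfar : ∫ ω, Z ω * ∫ t, (kerSum ξ A Nᶜ (ω, t) - kerMean μ ξ A Nᶜ t) ^ 2 ∂lebUnit ∂μ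
      ≤ r * ∫ ω, Z ω ∂μ := by
    have hF : BddMeas fun p : Ω × ℝ =>
        Z p.1 * (kerSum ξ A Nᶜ p - kerMean μ ξ A Nᶜ p.2) ^ 2 :=
      hZ.comp_fst.mul (h.bdd_kerDev Nᶜ)
    conv_lhs => simp only [← integral_const_mul]
    rw [hF.integral_swap (μ := μ) (ν := lebUnit)]
    have e : ∀ t, ∫ ω, Z ω * (kerSum ξ A Nᶜ (ω, t) - kerMean μ ξ A Nᶜ t) ^ 2 ∂μ
        = (∫ ω, Z ω ∂μ) * ∫ ω, (kerSum ξ A Nᶜ (ω, t) - kerMean μ ξ A Nᶜ t) ^ 2 ∂μ := fun t => by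
      refine h.integral_mul_B i hZm ?_
      have : Measurable[sig ξ (· ∉ B i)] fun ω => kerSum ξ A Nᶜ (ω, t) := by
        refine Finset.measurable_fun_sum _ fun j hj => h.measurable_kerTerm (fun k hk hk' => ?_) t
        rw [Finset.mem_compl, hN, Finset.mem_filter] at hj
        exact hj ⟨Finset.mem_univ _, k, Finset.mem_inter.2 ⟨hk', hk⟩⟩
      fun_prop
    simp only [e]
    rw [integral_const_mul, mul_comm]
    exact mul_le_mul_of_nonneg_right (h.integral_integral_kerDev_le Nᶜ) h0
  have hpt : ∀ ω, ∫ t, (kerSum ξ A Finset.univ (ω, t) - kerMean μ ξ A Finset.univ t) ^ 2 ∂lebUnit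
      ≤ 2 * ∫ t, (kerSum ξ A Nᶜ (ω, t) - kerMean μ ξ A Nᶜ t) ^ 2 ∂lebUnit
        + (4 * cub ξ κ ω + 4 * r) := by
    intro ω
    have hM : ∀ N, BddMeas fun t => kerSum ξ A N (ω, t) := fun N =>
      (h.bdd_kerSum N).slice_left ω
    have hK := h.bdd_kerMean
    calc _ ≤ ∫ t, (2 * (kerSum ξ A Nᶜ (ω, t) - kerMean μ ξ A Nᶜ t) ^ 2
          + (4 * kerSum ξ A N (ω, t) ^ 2 + 4 * kerMean μ ξ A N t ^ 2)) ∂lebUnit := by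
          refine BddMeas.integral_mono (by fun_prop) (by fun_prop) fun t => ?_
          have e1 : kerSum ξ A Finset.univ (ω, t) = kerSum ξ A N (ω, t) + kerSum ξ A Nᶜ (ω, t) :=
            (Finset.sum_add_sum_compl N _).symm
          have e2 : kerMean μ ξ A Finset.univ t = kerMean μ ξ A N t + kerMean μ ξ A Nᶜ t := by
            unfold kerMean
            rw [← BddMeas.integral_add ((h.bdd_kerSum N).slice_right t)
              ((h.bdd_kerSum Nᶜ).slice_right t)]
            congr 1; ext ω
            exact (Finset.sum_add_sum_compl N _).symm
          rw [e1, e2]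
          nlinarith [sq_nonneg (kerSum ξ A N (ω, t) + kerMean μ ξ A N t),
            sq_nonneg (kerSum ξ A N (ω, t) - kerMean μ ξ A N t
              - (kerSum ξ A Nᶜ (ω, t) - kerMean μ ξ A Nᶜ t))]
      _ ≤ _ := by
          rw [BddMeas.integral_add (by fun_prop) (by fun_prop),
            BddMeas.integral_add (by fun_prop) (by fun_prop), integral_const_mul,
            integral_const_mul, integral_const_mul]
          linarith [h.integral_kerSum_sq_le hNκ ω, h.integral_kerMean_sq_le hNκ]
  have hI : ∀ N, BddMeas fun ω => ∫ t, (kerSum ξ A N (ω, t) - kerMean μ ξ A N t) ^ 2 ∂lebUnit :=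
    fun N => (h.bdd_kerDev N).integral_right
  have hI1 := hI Nᶜ
  have hI2 := hI Finset.univ
  calc _ ≤ ∫ ω, (2 * (Z ω * ∫ t, (kerSum ξ A Nᶜ (ω, t) - kerMean μ ξ A Nᶜ t) ^ 2 ∂lebUnit)
          + (4 * (Z ω * cub ξ κ ω) + 4 * r * Z ω)) ∂μ :=
        BddMeas.integral_mono (by fun_prop) (by fun_prop) fun ω => by
          have := mul_le_mul_of_nonneg_left (hpt ω) (hZ0 ω)
          linarith
    _ ≤ _ := by
        rw [BddMeas.integral_add (by fun_prop) (by fun_prop),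
          BddMeas.integral_add (by fun_prop) (by fun_prop), integral_const_mul,
          integral_const_mul, integral_const_mul]
        linarith

/-- The first absolute moment of the mean kernel. -/
lemma integral_abs_mul_abs_kerMean_le (h : NormDep μ ξ A B κ b r θ) :
    ∫ t, |t| * |kerMean μ ξ A Finset.univ t| ∂lebUnit ≤ r := by
  set F : Ω × ℝ → ℝ := fun p => ∑ j, |Y ξ A j p.1| * |kerTerm ξ A j p| with hF
  have hFb : BddMeas F := BddMeas.sum _ fun j => (h.bdd_Y j).abs.comp_fst.mul (h.bdd_kerTerm j).abs
  have hK := h.bdd_kerMean Finset.univ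
  have ht : Integrable (fun t => |t| * |kerMean μ ξ A Finset.univ t|) lebUnit := by
    have hm : Measurable fun t => |t| * |kerMean μ ξ A Finset.univ t| := by
      have := hK.measurable
      fun_prop
    obtain ⟨C, hC⟩ := hK.bdd
    refine Integrable.of_bound hm.aestronglyMeasurable C ?_
    refine (ae_restrict_iff' measurableSet_Icc).2 (Filter.Eventually.of_forall fun t ht => ?_)
    rw [Real.norm_eq_abs, abs_mul, abs_abs, abs_abs]
    have h1 : |t| ≤ 1 := abs_le.2 ht
    nlinarith [hC t, abs_nonneg t, abs_nonneg (kerMean μ ξ A Finset.univ t)]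
  calc _ ≤ ∫ t, ∫ ω, F (ω, t) ∂μ ∂lebUnit := by
        refine integral_mono ht hFb.integral_left.integrable fun t => ?_
        have hM : BddMeas fun ω => kerSum ξ A Finset.univ (ω, t) := (h.bdd_kerSum _).slice_right t
        have hFt : BddMeas fun ω => F (ω, t) := hFb.slice_right t
        have h1 : |kerMean μ ξ A Finset.univ t| ≤ ∫ ω, |kerSum ξ A Finset.univ (ω, t)| ∂μ :=
          abs_integral_le_integral_abs
        refine (mul_le_mul_of_nonneg_left h1 (abs_nonneg t)).trans ?_
        rw [← integral_const_mul]
        refine BddMeas.integral_mono (by fun_prop) hFt fun ω => ?_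
        refine (mul_le_mul_of_nonneg_left (Finset.abs_sum_le_sum_abs _ _) (abs_nonneg t)).trans ?_
        rw [Finset.mul_sum]
        refine Finset.sum_le_sum fun j _ => ?_
        simp only [kerTerm, abs_mul]
        -- The kernel of `j` is carried by `|t| ≤ |Y j|`, so the first moment in `t` yields one more
        -- factor `|Y j|` and hence a cubic term.
        have := mul_le_mul_of_nonneg_left (abs_mul_abs_kern_le (Y ξ A j ω) t) (abs_nonneg (ξ j ω))
        linarith
    _ = ∫ ω, ∫ t, F (ω, t) ∂lebUnit ∂μ := hFb.integral_swap.symm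
    _ ≤ ∫ ω, cub ξ κ ω ∂μ := by
        refine BddMeas.integral_mono hFb.integral_right h.bdd_cub fun ω => ?_
        refine le_trans (le_of_eq ?_) (h.small ω).sum_abs_mul_sq_le
        simp only [hF]
        have hj : ∀ j, BddMeas fun t => kerTerm ξ A j (ω, t) := fun j =>
          (h.bdd_kerTerm j).slice_left ω
        rw [BddMeas.integral_sum (by fun_prop)]
        refine Finset.sum_congr rfl fun j _ => ?_
        simp only [kerTerm, abs_mul]
        rw [integral_const_mul, integral_const_mul, integral_abs_kern (h.abs_Y_le j ω)]
        change |Y ξ A j ω| * (|ξ j ω| * |Y ξ A j ω|) = |ξ j ω| * Y ξ A j ω ^ 2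
        rw [← sq_abs (Y ξ A j ω)]; ring
    _ ≤ r := h.cub_le

/-- The quadratic form is the total mass of the kernel, so its fluctuation is an integral of kernel
fluctuations. -/
lemma sq_quad_sub_mean_le (h : NormDep μ ξ A B κ b r θ) (ω : Ω) :
    (quad ξ A ω - ∫ ω', quad ξ A ω' ∂μ) ^ 2
      ≤ 2 * ∫ t, (kerSum ξ A Finset.univ (ω, t) - kerMean μ ξ A Finset.univ t) ^ 2 ∂lebUnit := by
  have hM : BddMeas fun t => kerSum ξ A Finset.univ (ω, t) := (h.bdd_kerSum _).slice_left ω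
  have hK := h.bdd_kerMean Finset.univ
  have e : quad ξ A ω - ∫ ω', quad ξ A ω' ∂μ
      = ∫ t, (kerSum ξ A Finset.univ (ω, t) - kerMean μ ξ A Finset.univ t) ∂lebUnit := by
    rw [BddMeas.integral_sub hM hK, h.integral_kerSum_univ]
    congr 1
    unfold kerMean
    rw [← (h.bdd_kerSum _).integral_swap (μ := μ) (ν := lebUnit)]
    simp_rw [h.integral_kerSum_univ]
  rw [e]
  exact sq_integral_lebUnit_le (by fun_prop)

lemma integral_sq_quad_sub_mean_le (h : NormDep μ ξ A B κ b r θ) :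
    ∫ ω, (quad ξ A ω - ∫ ω', quad ξ A ω' ∂μ) ^ 2 ∂μ ≤ 2 * r := by
  have hq := h.bdd_quad
  have hI : BddMeas fun ω =>
      ∫ t, (kerSum ξ A Finset.univ (ω, t) - kerMean μ ξ A Finset.univ t) ^ 2 ∂lebUnit :=
    (h.bdd_kerDev Finset.univ).integral_right
  refine (BddMeas.integral_mono (by fun_prop) (by fun_prop) h.sq_quad_sub_mean_le).trans ?_
  rw [integral_const_mul, (h.bdd_kerDev Finset.univ).integral_swap]
  linarith [h.integral_integral_kerDev_le Finset.univ]

end NormDep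
end
end LocalDep
-- Leave-one-out decomposition for the trapezoid test function.
namespace LocalDep

set_option linter.unusedSectionVars false

noncomputable section

lemma sig_mono {J Ω : Type*} {ξ : J → Ω → ℝ} {p q : J → Prop} (h : ∀ j, p j → q j) :
    sig ξ p ≤ sig ξ q := by
  have : Measurable[sig ξ q] fun ω (j : {j // p j}) => ξ j ω := by
    let _ : MeasurableSpace Ω := sig ξ q
    exact measurable_pi_lambda _ fun j => measurable_sig (h j.1 j.2)
  exact this.comap_le

/-- The σ-algebra on `Ω` is arbitrary because the lemma is also needed for the sub-σ-algebras `sig`.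
-/
lemma measurable_trapInt_comp {Ω : Type*} {m : MeasurableSpace Ω} {w y : Ω → ℝ} (α : ℝ)
    (hw : Measurable w) (hy : Measurable y) : Measurable fun ω => trapInt α (w ω) (y ω) :=
  (continuous_trapInt α).measurable.comp (hw.prodMk hy)

lemma measurable_trap_comp {Ω : Type*} {m : MeasurableSpace Ω} {w y : Ω → ℝ} (α : ℝ)
    (hw : Measurable w) (hy : Measurable y) : Measurable fun ω => trap α (w ω) (y ω) :=
  (continuous_trap α).measurable.comp (hw.prodMk hy)

lemma bdd_trapInt {Ω : Type*} [MeasurableSpace Ω] {w y : Ω → ℝ} {α : ℝ} (hα : 0 < α)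
    (hw : BddMeas w) (hw0 : ∀ ω, 0 ≤ w ω) (hy : Measurable y) :
    BddMeas fun ω => trapInt α (w ω) (y ω) := by
  obtain ⟨C, hC⟩ := hw.bdd
  exact BddMeas.of_bound (measurable_trapInt_comp α hw.measurable hy) fun ω =>
    (abs_trapInt_le hα (hw0 ω) _).trans (add_le_add ((le_abs_self _).trans (hC ω)) le_rfl)

lemma bdd_trap {Ω : Type*} [MeasurableSpace Ω] {w y : Ω → ℝ} (α : ℝ)
    (hw : Measurable w) (hy : Measurable y) : BddMeas fun ω => trap α (w ω) (y ω) :=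
  BddMeas.of_bound (measurable_trap_comp α hw hy) fun ω => by
    rw [abs_of_nonneg (trap_nonneg _ _ _)]; exact trap_le_one _ _ _

lemma bdd_window {Ω : Type*} [MeasurableSpace Ω] {y : Ω → ℝ} (α : ℝ) (hy : Measurable y) :
    BddMeas fun ω => window α (y ω) :=
  BddMeas.of_bound ((measurable_window α).comp hy) fun ω => by
    rw [abs_of_nonneg (window_nonneg _ _)]; exact window_le_one _ _

variable {J Ω : Type*} [Fintype J] [DecidableEq J]

/-- The quadratic form without the terms which involve the variables in `A j`. -/
def quadOut (ξ : J → Ω → ℝ) (A : J → Finset J) (j : J) (ω : Ω) : ℝ :=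
  ∑ l ∈ (nbr A j)ᶜ, ξ l ω * Y ξ A l ω

/-- The excess of the sum over the level `z` times the truncated normalization. -/
def excess (ξ : J → Ω → ℝ) (A : J → Finset J) (z : ℝ) (ω : Ω) : ℝ :=
  S ξ ω - z * clampSqrt (quad ξ A ω)

variable [mΩ : MeasurableSpace Ω]
  {μ : Measure Ω} [IsProbabilityMeasure μ] {ξ : J → Ω → ℝ} {A B : J → Finset J}
  {κ b r θ : ℝ}

namespace LocDep

lemma bdd_quadOut (h : LocDep μ ξ A B κ) (j : J) : BddMeas (quadOut ξ A j) :=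
  BddMeas.sum _ fun i => (h.bdd i).mul (h.bdd_Y i)

/-- If `l` is not a neighbour of `j`, then `A l` is disjoint from `A j`, and both `ξ l` and `Y l`
depend only on `A l`. -/
lemma measurable_quadOut (h : LocDep μ ξ A B κ) (j : J) :
    Measurable[sig ξ (· ∉ A j)] (quadOut ξ A j) := by
  refine Finset.measurable_fun_sum _ fun l hl => ?_
  have hp : ∀ k ∈ A l, k ∉ A j := fun k hk hk' => by
    rw [Finset.mem_compl, nbr, Finset.mem_filter] at hl
    exact hl ⟨Finset.mem_univ _, k, Finset.mem_inter.2 ⟨hk', hk⟩⟩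
  exact (h.measurable_xi hp).mul (measurable_Y hp)

lemma bdd_excess (h : LocDep μ ξ A B κ) (z : ℝ) : BddMeas (excess ξ A z) := by
  have h1 := h.bdd_quad.comp_continuous continuous_clampSqrt
  have h2 := h.bdd_S
  unfold excess
  fun_prop

lemma sum_abs_mul_abs_quad_sub_le (h : LocDep μ ξ A B κ) (ω : Ω) :
    ∑ j, |ξ j ω| * |quad ξ A ω - quadOut ξ A j ω| ≤ cub ξ κ ω := by
  refine le_trans (Finset.sum_le_sum fun j _ => mul_le_mul_of_nonneg_left ?_ (abs_nonneg _))
    (h.small ω).sum_abs_mul_nbr_le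
  rw [quad, quadOut, ← Finset.sum_add_sum_compl (nbr A j), add_sub_cancel_right]
  refine (Finset.abs_sum_le_sum_abs _ _).trans (le_of_eq ?_)
  exact Finset.sum_congr rfl fun l _ => by rw [abs_mul]; rfl

end LocDep

/-- Bounded families of functions such that the `i`-th depends only on the variables in `A i`. -/
structure Admissible (ξ : J → Ω → ℝ) (A : J → Finset J) (H : ℝ) (i : J) (x : Ω → ℝ) : Prop where
  bdd : BddMeas x
  meas : Measurable[sig ξ (· ∈ A i)] x
  le : ∀ ω, |x ω| ≤ H

namespace NormDep

/-- Pointwise leave-one-out decomposition of the smoothed occupation integral. -/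
lemma integral_trap_mul_kerSum_le (h : NormDep μ ξ A B κ b r θ) (i : J) {α w x H : ℝ} (hα : 0 < α)
    (hα1 : α ≤ 1) (hw0 : 0 ≤ w) (hw : w ≤ 4) (hx : |x| ≤ H) (z : ℝ) (ω : Ω) :
    ∫ t, trap α w (excess ξ A z ω - x + t) * kerSum ξ A Finset.univ (ω, t) ∂lebUnit
      ≤ (w + α) * |S ξ ω| + (w + α) + 24 * (1 + H) * (cub ξ κ ω * (1 + |S ξ ω|))
        - ∑ j ∈ (nbr A i)ᶜ, ξ j ω *
          trapInt α w (Sout ξ (A j) ω - z * clampSqrt (quadOut ξ A j ω) - x) := by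
  set F : ℝ → ℝ → ℝ := fun s v => trapInt α w (s - z * clampSqrt v - x) with hF
  have hFle : ∀ s v, |F s v| ≤ w + α := fun s v => abs_trapInt_le hα hw0 _
  have hSo : ∀ j, Sout ξ (A j) ω = S ξ ω - Y ξ A j ω := fun j => by
    rw [LocDep.S_eq_Y ξ A j ω]; ring
  have e1 : ∫ t, trap α w (excess ξ A z ω - x + t) * kerSum ξ A Finset.univ (ω, t) ∂lebUnit
      = ∑ j, ξ j ω * (F (S ξ ω) (quad ξ A ω) - F (Sout ξ (A j) ω) (quad ξ A ω)) := by
    simp only [kerSum, Finset.mul_sum]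
    rw [BddMeas.integral_sum fun j => (bdd_trap α measurable_const (by fun_prop)).mul
      ((h.bdd_kerTerm j).slice_left ω)]
    refine Finset.sum_congr rfl fun j _ => ?_
    have : F (S ξ ω) (quad ξ A ω) - F (Sout ξ (A j) ω) (quad ξ A ω)
        = trapInt α w (excess ξ A z ω - x) - trapInt α w (excess ξ A z ω - x - Y ξ A j ω) := by
      simp only [hF, hSo, excess]; congr 2; ring
    rw [this, trapInt_sub_eq_integral_kern (h.abs_Y_le j ω), ← integral_const_mul]
    congr 1; ext t; simp only [kerTerm]; ring
  -- The sum over `j` is split into the full term, the neighbours of `i` (bounded trivially), the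
  -- change from `quad` to `quadOut` (cubic), and a remainder in which the second factor is
  -- independent of `ξ j`, even after multiplication by a weight depending on `A i`.
  have e2 : ∑ j, ξ j ω * (F (S ξ ω) (quad ξ A ω) - F (Sout ξ (A j) ω) (quad ξ A ω))
      = S ξ ω * F (S ξ ω) (quad ξ A ω)
        - ∑ j ∈ nbr A i, ξ j ω * F (Sout ξ (A j) ω) (quad ξ A ω)
        - ∑ j ∈ (nbr A i)ᶜ, ξ j ω *
          (F (Sout ξ (A j) ω) (quad ξ A ω) - F (Sout ξ (A j) ω) (quadOut ξ A j ω))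
        - ∑ j ∈ (nbr A i)ᶜ, ξ j ω * F (Sout ξ (A j) ω) (quadOut ξ A j ω) := by
    simp only [mul_sub, Finset.sum_sub_distrib]
    rw [← Finset.sum_mul, ← Finset.sum_add_sum_compl (nbr A i)
      (fun j => ξ j ω * F (Sout ξ (A j) ω) (quad ξ A ω)), S]
    ring
  have b1 : S ξ ω * F (S ξ ω) (quad ξ A ω) ≤ (w + α) * |S ξ ω| := by
    refine (le_abs_self _).trans ?_
    rw [abs_mul, mul_comm]
    exact mul_le_mul_of_nonneg_right (hFle _ _) (abs_nonneg _)
  have b2 : -∑ j ∈ nbr A i, ξ j ω * F (Sout ξ (A j) ω) (quad ξ A ω) ≤ w + α := by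
    refine (neg_le_abs _).trans ((Finset.abs_sum_le_sum_abs _ _).trans ?_)
    calc _ ≤ ∑ j ∈ nbr A i, |ξ j ω| * (w + α) := Finset.sum_le_sum fun j _ => by
          rw [abs_mul]; exact mul_le_mul_of_nonneg_left (hFle _ _) (abs_nonneg _)
      _ ≤ w + α := by
          rw [← Finset.sum_mul]
          exact mul_le_of_le_one_left (by linarith) ((h.small ω).sum_abs_nbr_le i)
  have b3 : -∑ j ∈ (nbr A i)ᶜ, ξ j ω *
      (F (Sout ξ (A j) ω) (quad ξ A ω) - F (Sout ξ (A j) ω) (quadOut ξ A j ω))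
      ≤ 24 * (1 + H) * (cub ξ κ ω * (1 + |S ξ ω|)) := by
    have hH : 0 ≤ H := (abs_nonneg x).trans hx
    refine (neg_le_abs _).trans ((Finset.abs_sum_le_sum_abs _ _).trans ?_)
    calc _ ≤ ∑ j, 24 * (1 + H) * (1 + |S ξ ω|) *
          (|ξ j ω| * |quad ξ A ω - quadOut ξ A j ω|) := by
          refine (Finset.sum_le_sum fun j _ => ?_).trans
            (Finset.sum_le_sum_of_subset_of_nonneg (Finset.subset_univ _)
              fun j _ _ => by positivity)
          rw [abs_mul]
          have h1 := abs_trapInt_clampSqrt_sub_le hα hw0 (Sout ξ (A j) ω) x z (quad ξ A ω)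
            (quadOut ξ A j ω)
          have h2 : 4 * (|Sout ξ (A j) ω| + |x| + w + α) ≤ 24 * (1 + H) * (1 + |S ξ ω|) := by
            nlinarith [h.abs_Sout_A_le j ω, abs_nonneg (S ξ ω),
              mul_nonneg hH (abs_nonneg (S ξ ω))]
          have h3 := h1.trans (mul_le_mul_of_nonneg_right h2 (abs_nonneg _))
          refine (mul_le_mul_of_nonneg_left h3 (abs_nonneg _)).trans (le_of_eq (by ring))
      _ ≤ _ := by
          rw [← Finset.mul_sum]
          refine (mul_le_mul_of_nonneg_left (h.sum_abs_mul_abs_quad_sub_le ω)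
            (by positivity)).trans (le_of_eq (by ring))
  rw [e1, e2]
  linarith

/-- The constant 6 is 4 from `|S|` decoupled from the local weight, 1 from the neighbours of `i` and
1 from the means of the truncated variables. -/
lemma integral_mul_trap_kerSum_le (h : NormDep μ ξ A B κ b r θ) (i : J) {α H : ℝ} (hα : 0 < α)
    (hα1 : α ≤ 1) {Z w x : Ω → ℝ} (hZ : BddMeas Z) (hZm : Measurable[sig ξ (· ∈ A i)] Z)
    (hZ0 : ∀ ω, 0 ≤ Z ω) (hw : Admissible ξ A 4 i w) (hw0 : ∀ ω, 0 ≤ w ω)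
    (hx : Admissible ξ A H i x) (z : ℝ) :
    ∫ ω, Z ω * ∫ t, trap α (w ω) (excess ξ A z ω - x ω + t)
        * kerSum ξ A Finset.univ (ω, t) ∂lebUnit ∂μ
      ≤ 6 * ∫ ω, Z ω * (w ω + α) ∂μ
        + 24 * (1 + H) * ∫ ω, Z ω * (cub ξ κ ω * (1 + |S ξ ω|)) ∂μ := by
  have hS := h.bdd_S
  have hc := h.bdd_cub
  have hb := h.bdd
  have hwb := hw.bdd
  have hwm := hw.meas
  have hxm := hx.meas
  have hE := h.bdd_excess z
  set G : J → Ω → ℝ := fun j ω =>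
    Z ω * trapInt α (w ω) (Sout ξ (A j) ω - z * clampSqrt (quadOut ξ A j ω) - x ω) with hG
  have hGb : ∀ j, BddMeas (G j) := fun j => by
    have h1 := (h.bdd_Sout (A j)).measurable
    have h2 := ((h.bdd_quadOut j).comp_continuous continuous_clampSqrt).measurable
    have h3 := hx.bdd.measurable
    exact hZ.mul (bdd_trapInt hα hwb hw0 (by fun_prop))
  have hlast : ∀ j ∈ (nbr A i)ᶜ,
      -∫ ω, ξ j ω * G j ω ∂μ ≤ |∫ ω, ξ j ω ∂μ| * ∫ ω, Z ω * (w ω + α) ∂μ := by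
    intro j hj
    -- As `A i` and `A j` are disjoint, `Z`, `w` and `x` are functions of the variables outside `A
    -- j`, so the whole factor is independent of `ξ j`.
    have hle : sig ξ (· ∈ A i) ≤ sig ξ (· ∉ A j) := by
      have hp : ∀ k ∈ A i, k ∉ A j := fun k hk hk' => by
        rw [Finset.mem_compl, nbr, Finset.mem_filter] at hj
        exact hj ⟨Finset.mem_univ _, k, Finset.mem_inter.2 ⟨hk, hk'⟩⟩
      exact sig_mono hp
    have hGm : Measurable[sig ξ (· ∉ A j)] (G j) := by
      have h1 : Measurable[sig ξ (· ∉ A j)] (Sout ξ (A j)) :=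
        LocDep.measurable_Sout fun _ hk => hk
      have h2 := continuous_clampSqrt.measurable.comp (h.measurable_quadOut j)
      have h3 : Measurable[sig ξ (· ∉ A j)] w := hwm.mono hle le_rfl
      have h4 : Measurable[sig ξ (· ∉ A j)] x := hxm.mono hle le_rfl
      have h5 : Measurable[sig ξ (· ∉ A j)] Z := hZm.mono hle le_rfl
      exact h5.mul (measurable_trapInt_comp α h3 ((h1.sub (h2.const_mul z)).sub h4))
    rw [h.integral_mul_A j (measurable_sig rfl) hGm]
    refine (neg_le_abs _).trans ?_
    rw [abs_mul]
    refine mul_le_mul_of_nonneg_left ?_ (abs_nonneg _)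
    refine abs_integral_le_integral_abs.trans ?_
    refine BddMeas.integral_mono (hGb j).abs (by fun_prop) fun ω => ?_
    simp only [hG]
    rw [abs_mul, abs_of_nonneg (hZ0 ω)]
    exact mul_le_mul_of_nonneg_left (abs_trapInt_le hα (hw0 ω) _) (hZ0 ω)
  have hI0 : 0 ≤ ∫ ω, Z ω * (w ω + α) ∂μ :=
    integral_nonneg fun ω => mul_nonneg (hZ0 ω) (by linarith [hw0 ω])
  have hlasts : -∑ j ∈ (nbr A i)ᶜ, ∫ ω, ξ j ω * G j ω ∂μ ≤ ∫ ω, Z ω * (w ω + α) ∂μ := by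
    rw [← Finset.sum_neg_distrib]
    calc _ ≤ ∑ j, |∫ ω, ξ j ω ∂μ| * ∫ ω, Z ω * (w ω + α) ∂μ :=
          (Finset.sum_le_sum hlast).trans (Finset.sum_le_sum_of_subset_of_nonneg
            (Finset.subset_univ _) fun j _ _ => mul_nonneg (abs_nonneg _) hI0)
      _ ≤ _ := by
          rw [← Finset.sum_mul]
          exact mul_le_of_le_one_left hI0 (by linarith [h.sum_mean, h.b_le])
  have hSbound : ∫ ω, Z ω * (w ω + α) * |S ξ ω| ∂μ ≤ 4 * ∫ ω, Z ω * (w ω + α) ∂μ :=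
    h.integral_mul_abs_S_le i (by fun_prop) (by fun_prop) fun ω =>
      mul_nonneg (hZ0 ω) (by linarith [hw0 ω])
  have hT : BddMeas fun p : Ω × ℝ => trap α (w p.1) (excess ξ A z p.1 - x p.1 + p.2)
      * kerSum ξ A Finset.univ p := by
    refine BddMeas.mul (bdd_trap α ?_ ?_) (h.bdd_kerSum _)
    · exact hwb.measurable.comp measurable_fst
    · exact ((hE.measurable.sub hx.bdd.measurable).comp measurable_fst).add measurable_snd
  have hTi := hT.integral_right (ν := lebUnit)
  calc _ ≤ ∫ ω, (Z ω * (w ω + α) * |S ξ ω| + Z ω * (w ω + α)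
        + 24 * (1 + H) * (Z ω * (cub ξ κ ω * (1 + |S ξ ω|)))
        - ∑ j ∈ (nbr A i)ᶜ, ξ j ω * G j ω) ∂μ := by
        refine BddMeas.integral_mono (hZ.mul hTi) (by fun_prop) fun ω => ?_
        refine (mul_le_mul_of_nonneg_left (h.integral_trap_mul_kerSum_le i hα hα1 (hw0 ω)
          ((le_abs_self _).trans (hw.le ω)) (hx.le ω) z ω) (hZ0 ω)).trans (le_of_eq ?_)
        simp only [hG]
        rw [mul_sub, Finset.mul_sum]
        congr 1
        · ring
        · exact Finset.sum_congr rfl fun j _ => by ring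
    _ ≤ _ := by
        rw [BddMeas.integral_sub (by fun_prop) (by fun_prop),
          BddMeas.integral_add (by fun_prop) (by fun_prop),
          BddMeas.integral_add (by fun_prop) (by fun_prop), integral_const_mul,
          BddMeas.integral_sum (by fun_prop)]
        linarith

end NormDep
end
end LocalDep
-- From the trapezoid to window sums.
namespace LocalDep

set_option linter.unusedSectionVars false

noncomputable section

variable {J Ω : Type*} [Fintype J] [DecidableEq J] [mΩ : MeasurableSpace Ω]
  {μ : Measure Ω} [IsProbabilityMeasure μ] {ξ : J → Ω → ℝ} {A B : J → Finset J}
  {κ b r θ : ℝ}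

/-- The squared fluctuation of the kernel. -/
def kerFluct (μ : Measure Ω) (ξ : J → Ω → ℝ) (A : J → Finset J) (ω : Ω) : ℝ :=
  ∫ t, (kerSum ξ A Finset.univ (ω, t) - kerMean μ ξ A Finset.univ t) ^ 2 ∂lebUnit

lemma LocDep.bdd_kerFluct (h : LocDep μ ξ A B κ) : BddMeas (kerFluct μ ξ A) :=
  (h.bdd_kerDev Finset.univ).integral_right

lemma ae_lebUnit : ∀ᵐ t ∂lebUnit, |t| ≤ 1 :=
  (ae_restrict_iff' measurableSet_Icc).2 (Filter.Eventually.of_forall fun _ ht => abs_le.2 ht)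

/-- For `p, q ∈ [0, 1]` one has `(p - q)² ≤ p + q`, so the linear term can be traded for a small
multiple of the trapezoids themselves. The fraction `1/16` becomes `1/8` after integration over
length 2, small against the main term `1/2`. -/
lemma abs_mul_le_of_unit {p q d : ℝ} (hp0 : 0 ≤ p) (hp : p ≤ 1) (hq0 : 0 ≤ q) (hq : q ≤ 1) :
    |p - q| * |d| ≤ (p + q) / 16 + 4 * d ^ 2 := by
  have h1 : |p - q| ^ 2 ≤ p + q := by rw [sq_abs]; nlinarith
  rw [← sq_abs d]
  nlinarith [sq_nonneg (|p - q| / 4 - 2 * |d|)]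

namespace NormDep

/-- `trap * quad` is the integral of the unshifted trapezoid against the kernel. Shifting it costs
its increment times the kernel, which is split into fluctuation and mean. As `quad` is at least
`1/2` up to fluctuation, `1/2 - 1/8 = 3/8` of the trapezoid survives. -/
lemma mul_trap_le (h : NormDep μ ξ A B κ b r θ) {α w : ℝ} (hα : 0 < α) (hw0 : 0 ≤ w)
    (y : ℝ) (ω : Ω) :
    3 / 8 * trap α w y ≤ ∫ t, trap α w (y + t) * kerSum ξ A Finset.univ (ω, t) ∂lebUnit
      + (w + α) / 8 + 12 * kerFluct μ ξ A ω
      + ∫ t, |trap α w (y + t) - trap α w y| * |kerMean μ ξ A Finset.univ t| ∂lebUnit := by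
  set M : ℝ → ℝ := fun t => kerSum ξ A Finset.univ (ω, t) with hM
  set K : ℝ → ℝ := kerMean μ ξ A Finset.univ with hK
  have hMb : BddMeas M := (h.bdd_kerSum _).slice_left ω
  have hKb : BddMeas K := h.bdd_kerMean _
  have hψ : BddMeas fun t => trap α w (y + t) := bdd_trap α measurable_const (by fun_prop)
  have hquad : trap α w y * quad ξ A ω = ∫ t, trap α w y * M t ∂lebUnit := by
    rw [integral_const_mul, h.integral_kerSum_univ]
  have hm : lebUnit.real Set.univ = 2 := by
    simp [lebUnit, measureReal_def]; norm_num
  have hle : trap α w y * quad ξ A ω ≤ ∫ t, trap α w (y + t) * M t ∂lebUnit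
      + ((w + α) / 8 + trap α w y / 8) + 4 * kerFluct μ ξ A ω
      + ∫ t, |trap α w (y + t) - trap α w y| * |K t| ∂lebUnit := by
    rw [hquad]
    calc _ ≤ ∫ t, (trap α w (y + t) * M t + (trap α w (y + t) / 16 + trap α w y / 16)
          + 4 * (M t - K t) ^ 2 + |trap α w (y + t) - trap α w y| * |K t|) ∂lebUnit := by
          refine BddMeas.integral_mono (by fun_prop) (by fun_prop) fun t => ?_
          have h1 := abs_mul_le_of_unit (d := M t - K t) (trap_nonneg α w (y + t))
            (trap_le_one α w (y + t)) (trap_nonneg α w y) (trap_le_one α w y)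
          have h2 : (trap α w y - trap α w (y + t)) * M t
              ≤ |trap α w (y + t) - trap α w y| * (|M t - K t| + |K t|) := by
            refine (le_abs_self _).trans ?_
            rw [abs_mul, abs_sub_comm]
            refine mul_le_mul_of_nonneg_left ?_ (abs_nonneg _)
            have := abs_add_le (M t - K t) (K t)
            rwa [sub_add_cancel] at this
          nlinarith
      _ ≤ _ := by
          rw [BddMeas.integral_add (by fun_prop) (by fun_prop),
            BddMeas.integral_add (by fun_prop) (by fun_prop),
            BddMeas.integral_add (by fun_prop) (by fun_prop),
            BddMeas.integral_add (by fun_prop) (by fun_prop), integral_const_mul, integral_div,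
            integral_const, hm, smul_eq_mul]
          have := integral_trap_shift_le hα hw0 y
          have e : kerFluct μ ξ A ω = ∫ t, (M t - K t) ^ 2 ∂lebUnit := rfl
          linarith
  have hq2 := h.sq_quad_sub_mean_le ω
  change _ ≤ 2 * kerFluct μ ξ A ω at hq2
  have hmean := (abs_le.1 h.mean_quad).1
  have hb := h.b_le
  -- The mean of `quad` is at least `7/8`, so `quad < 1/2` forces a fluctuation above `3/8`, whose
  -- square pays for the deficit.
  have hlow : trap α w y / 2 - 4 * (quad ξ A ω - ∫ ω', quad ξ A ω' ∂μ) ^ 2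
      ≤ trap α w y * quad ξ A ω := by
    set m := ∫ ω', quad ξ A ω' ∂μ
    have h1 := trap_nonneg α w y
    have h2 := trap_le_one α w y
    by_cases hc : 1 / 2 ≤ quad ξ A ω
    · nlinarith [sq_nonneg (quad ξ A ω - m)]
    · push Not at hc
      have h3 : 1 / 2 - quad ξ A ω ≤ 4 * (quad ξ A ω - m) ^ 2 := by nlinarith
      nlinarith
  linarith

lemma integral_mul_trap_le (h : NormDep μ ξ A B κ b r θ) (i : J) {α H : ℝ} (hα : 0 < α)
    (hα1 : α ≤ 1) {Z w x : Ω → ℝ} (hZ : BddMeas Z) (hZm : Measurable[sig ξ (· ∈ A i)] Z)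
    (hZ0 : ∀ ω, 0 ≤ Z ω) (hw : Admissible ξ A 4 i w) (hw0 : ∀ ω, 0 ≤ w ω)
    (hx : Admissible ξ A H i x) (hH : 0 ≤ H) (z : ℝ) :
    3 / 8 * ∫ ω, Z ω * trap α (w ω) (excess ξ A z ω - x ω) ∂μ
      ≤ 49 / 8 * ∫ ω, Z ω * (w ω + α) ∂μ
        + 72 * (1 + H) * ∫ ω, Z ω * (cub ξ κ ω * (1 + |S ξ ω|)) ∂μ
        + 72 * r * ∫ ω, Z ω ∂μ
        + ∫ t, |kerMean μ ξ A Finset.univ t| * ∫ ω, Z ω *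
          |trap α (w ω) (excess ξ A z ω - x ω + t) - trap α (w ω) (excess ξ A z ω - x ω)| ∂μ
            ∂lebUnit := by
  have hS := h.bdd_S
  have hc := h.bdd_cub
  have hwb := hw.bdd
  have hym : Measurable fun ω => excess ξ A z ω - x ω :=
    (h.bdd_excess z).measurable.sub hx.bdd.measurable
  have hF := h.bdd_kerFluct
  have hK := h.bdd_kerMean Finset.univ
  have hψt : BddMeas fun p : Ω × ℝ => trap α (w p.1) (excess ξ A z p.1 - x p.1 + p.2) :=
    bdd_trap α (hwb.measurable.comp measurable_fst)
      ((hym.comp measurable_fst).add measurable_snd)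
  have hψ : BddMeas fun ω => trap α (w ω) (excess ξ A z ω - x ω) :=
    bdd_trap α hwb.measurable hym
  have hT : BddMeas fun p : Ω × ℝ => trap α (w p.1) (excess ξ A z p.1 - x p.1 + p.2)
      * kerSum ξ A Finset.univ p := hψt.mul (h.bdd_kerSum _)
  have hTi := hT.integral_right (ν := lebUnit)
  have hD : BddMeas fun p : Ω × ℝ => |trap α (w p.1) (excess ξ A z p.1 - x p.1 + p.2)
      - trap α (w p.1) (excess ξ A z p.1 - x p.1)| := (hψt.sub hψ.comp_fst).abs
  have hDK : BddMeas fun p : Ω × ℝ => |trap α (w p.1) (excess ξ A z p.1 - x p.1 + p.2)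
      - trap α (w p.1) (excess ξ A z p.1 - x p.1)| * |kerMean μ ξ A Finset.univ p.2| :=
    hD.mul hK.abs.comp_snd
  have hDKi := hDK.integral_right (ν := lebUnit)
  have hswap : ∫ ω, Z ω * ∫ t, |trap α (w ω) (excess ξ A z ω - x ω + t)
      - trap α (w ω) (excess ξ A z ω - x ω)| * |kerMean μ ξ A Finset.univ t| ∂lebUnit ∂μ
      = ∫ t, |kerMean μ ξ A Finset.univ t| * ∫ ω, Z ω *
          |trap α (w ω) (excess ξ A z ω - x ω + t) - trap α (w ω) (excess ξ A z ω - x ω)| ∂μ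
            ∂lebUnit := by
    simp only [← integral_const_mul]
    rw [(hZ.comp_fst.mul hDK).integral_swap]
    congr 1; ext t; congr 1; ext ω; ring
  have h1 := h.integral_mul_trap_kerSum_le i hα hα1 hZ hZm hZ0 hw hw0 hx z
  have h2 := h.integral_mul_kerDev_le i hZ hZm hZ0
  have h3 : ∫ ω, Z ω * cub ξ κ ω ∂μ ≤ ∫ ω, Z ω * (cub ξ κ ω * (1 + |S ξ ω|)) ∂μ :=
    BddMeas.integral_mono (by fun_prop) (by fun_prop) fun ω =>
      mul_le_mul_of_nonneg_left (le_mul_of_one_le_right (cub_nonneg _ _ _)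
        (by linarith [abs_nonneg (S ξ ω)])) (hZ0 ω)
  have h4 : 0 ≤ ∫ ω, Z ω * (cub ξ κ ω * (1 + |S ξ ω|)) ∂μ := integral_nonneg fun ω =>
    mul_nonneg (hZ0 ω) (mul_nonneg (cub_nonneg _ _ _) (by positivity))
  change ∫ ω, Z ω * kerFluct μ ξ A ω ∂μ ≤ _ at h2
  have hmain : ∫ ω, 3 / 8 * (Z ω * trap α (w ω) (excess ξ A z ω - x ω)) ∂μ
      ≤ ∫ ω, (Z ω * (∫ t, trap α (w ω) (excess ξ A z ω - x ω + t)
          * kerSum ξ A Finset.univ (ω, t) ∂lebUnit) + Z ω * (w ω + α) / 8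
        + 12 * (Z ω * kerFluct μ ξ A ω)
        + Z ω * ∫ t, |trap α (w ω) (excess ξ A z ω - x ω + t)
          - trap α (w ω) (excess ξ A z ω - x ω)| * |kerMean μ ξ A Finset.univ t| ∂lebUnit) ∂μ := by
    refine BddMeas.integral_mono (by fun_prop) (by fun_prop) fun ω => ?_
    have := mul_le_mul_of_nonneg_left
      (h.mul_trap_le hα (hw0 ω) (excess ξ A z ω - x ω) ω) (hZ0 ω)
    linarith
  rw [integral_const_mul, BddMeas.integral_add (by fun_prop) (by fun_prop),
    BddMeas.integral_add (by fun_prop) (by fun_prop),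
    BddMeas.integral_add (by fun_prop) (by fun_prop), integral_const_mul, integral_div,
    hswap] at hmain
  nlinarith [mul_nonneg hH h4]

/-- A bound, uniform over admissible centres, for the weighted probability that the excess lies in
a window of radius `2 * α`. -/
def WindowBound (μ : Measure Ω) (ξ : J → Ω → ℝ) (A : J → Finset J) (z α H G : ℝ) : Prop :=
  ∀ x : J → Ω → ℝ, (∀ i, Admissible ξ A H i (x i)) →
    ∑ i, ∫ ω, wt ξ A i ω * window α (excess ξ A z ω - x i ω) ∂μ ≤ G

/-- The summands of the window decomposition have moving centres, but these remain functions of the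
variables in `A i`. `WindowBound` is uniform over such centres, so every window sum is at most `G`,
and the step lengths add up to `|t|`. -/
lemma sum_integral_wt_trap_shift_le (h : NormDep μ ξ A B κ b r θ) {α H G z : ℝ} (hα : 0 < α)
    (hα1 : α ≤ 1) {w x : J → Ω → ℝ} (hw : ∀ i, Admissible ξ A 4 i (w i))
    (hx : ∀ i, Admissible ξ A H i (x i))
    (hG : WindowBound μ ξ A z α (H + 6) G) {t : ℝ} (ht : |t| ≤ 1) :
    ∑ i, ∫ ω, wt ξ A i ω * |trap α (w i ω) (excess ξ A z ω - x i ω + t)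
      - trap α (w i ω) (excess ξ A z ω - x i ω)| ∂μ ≤ |t| * (2 * G / α) := by
  obtain ⟨n, hn⟩ := exists_nat_gt (1 / α)
  have hn0 : (0 : ℝ) < n := (by positivity : (0 : ℝ) < 1 / α).trans hn
  have hn1 : 0 < n := by exact_mod_cast hn0
  have htn : |t| ≤ n * α := by
    rw [div_lt_iff₀ hα] at hn
    linarith
  have hEm := (h.bdd_excess z).measurable
  have hwt := h.bdd_wt
  have hwin : ∀ (k : ℕ) (i : J) (s : ℝ), BddMeas fun ω =>
      window α (excess ξ A z ω - x i ω + k * (t / n) + s * (w i ω + α / 2)) := fun k i s => by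
    have h1 := (hx i).bdd.measurable
    have h2 := (hw i).bdd.measurable
    exact bdd_window α (by fun_prop)
  have hone : ∀ k ∈ Finset.range n, ∀ s : ℝ, |s| = 1 → ∑ i, ∫ ω, wt ξ A i ω *
      window α (excess ξ A z ω - x i ω + k * (t / n) + s * (w i ω + α / 2)) ∂μ ≤ G := by
    intro k hk s hs
    refine le_trans (le_of_eq ?_) (hG (fun i ω => x i ω - k * (t / n) - s * (w i ω + α / 2)) ?_)
    · refine Finset.sum_congr rfl fun i _ => ?_
      congr 1; ext ω; congr 2; ring
    · intro i
      have h1 := (hx i).bdd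
      have h2 := (hw i).bdd
      have h3 := (hx i).meas
      have h4 := (hw i).meas
      refine ⟨by fun_prop, by fun_prop, fun ω => ?_⟩
      -- The centre moves by at most 1 through `k * (t / n)` and by at most 5 through `w + α/2`;
      -- this is the 6 in `H + 6`.
      have h5 : |(k : ℝ) * (t / n)| ≤ 1 := by
        rw [abs_mul, abs_div, abs_of_nonneg (Nat.cast_nonneg k), abs_of_pos hn0, ← mul_div_assoc,
          div_le_one hn0]
        have : (k : ℝ) ≤ n := by exact_mod_cast (Finset.mem_range.1 hk).le
        nlinarith [abs_nonneg t]
      have h6 : |s * (w i ω + α / 2)| ≤ 5 := by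
        rw [abs_mul, hs, one_mul]
        refine (abs_add_le _ _).trans ?_
        rw [abs_of_pos (by positivity : 0 < α / 2)]
        linarith [(hw i).le ω]
      have h7 := abs_sub (x i ω - k * (t / n)) (s * (w i ω + α / 2))
      have h8 := abs_sub (x i ω) (k * (t / n))
      linarith [(hx i).le ω]
  have hbd : ∀ i, BddMeas fun ω => |trap α (w i ω) (excess ξ A z ω - x i ω + t)
      - trap α (w i ω) (excess ξ A z ω - x i ω)| := fun i => by
    have h1 := (hx i).bdd.measurable
    have h2 := (hw i).bdd.measurable
    exact ((bdd_trap α h2 (by fun_prop)).sub (bdd_trap α h2 (by fun_prop))).abs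
  calc _ ≤ ∑ i, ∫ ω, ∑ k ∈ Finset.range n, |t| / n / α * (wt ξ A i ω *
          window α (excess ξ A z ω - x i ω + k * (t / n) + (-1) * (w i ω + α / 2))
          + wt ξ A i ω *
          window α (excess ξ A z ω - x i ω + k * (t / n) + 1 * (w i ω + α / 2))) ∂μ := by
        refine Finset.sum_le_sum fun i _ => ?_
        refine BddMeas.integral_mono (by fun_prop) (by fun_prop) fun ω => ?_
        have := mul_le_mul_of_nonneg_left (abs_trap_shift_le_sum_window (w := w i ω) hα
          (excess ξ A z ω - x i ω) t hn1 htn) (wt_nonneg ξ A i ω)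
        refine this.trans (le_of_eq ?_)
        rw [Finset.mul_sum]
        refine Finset.sum_congr rfl fun k _ => ?_
        rw [neg_one_mul, one_mul, ← sub_eq_add_neg]
        ring
    _ = ∑ k ∈ Finset.range n, |t| / n / α * (∑ i, ∫ ω, wt ξ A i ω *
          window α (excess ξ A z ω - x i ω + k * (t / n) + (-1) * (w i ω + α / 2)) ∂μ
          + ∑ i, ∫ ω, wt ξ A i ω *
          window α (excess ξ A z ω - x i ω + k * (t / n) + 1 * (w i ω + α / 2)) ∂μ) := by
        simp_rw [← Finset.sum_add_distrib, Finset.mul_sum]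
        rw [Finset.sum_comm]
        refine Finset.sum_congr rfl fun i _ => ?_
        rw [BddMeas.integral_sum fun k => by fun_prop]
        refine Finset.sum_congr rfl fun k _ => ?_
        rw [integral_const_mul, BddMeas.integral_add (by fun_prop) (by fun_prop)]
    _ ≤ ∑ k ∈ Finset.range n, |t| / n / α * (G + G) := by
        refine Finset.sum_le_sum fun k hk => mul_le_mul_of_nonneg_left ?_ (by positivity)
        exact add_le_add (hone k hk (-1) (by simp)) (hone k hk 1 (by simp))
    _ = |t| * (2 * G / α) := by
        rw [Finset.sum_const, Finset.card_range, nsmul_eq_mul]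
        field_simp
        ring

end NormDep
end
end LocalDep
-- The randomized concentration inequality.
namespace LocalDep

set_option linter.unusedSectionVars false

noncomputable section

variable {J Ω : Type*} [Fintype J] [DecidableEq J] [mΩ : MeasurableSpace Ω]
  {μ : Measure Ω} [IsProbabilityMeasure μ] {ξ : J → Ω → ℝ} {A B : J → Finset J}
  {κ b r θ : ℝ}

namespace NormDep

/-- The self-bounding inequality: the sum of trapezoids is controlled by its width, the cubic error
and `r / α` times a window bound. The last term arises by integrating the shift estimate against the
mean kernel, whose first absolute moment is at most `r`. -/
lemma sum_integral_wt_trap_le (h : NormDep μ ξ A B κ b r θ) {α H G z : ℝ} (hα : 0 < α)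
    (hα1 : α ≤ 1) {w x : J → Ω → ℝ} (hw : ∀ i, Admissible ξ A 4 i (w i))
    (hw0 : ∀ i ω, 0 ≤ w i ω) (hx : ∀ i, Admissible ξ A H i (x i)) (hH : 0 ≤ H) (hG0 : 0 ≤ G)
    (hG : WindowBound μ ξ A z α (H + 6) G) :
    ∑ i, ∫ ω, wt ξ A i ω * trap α (w i ω) (excess ξ A z ω - x i ω) ∂μ
      ≤ 17 * ∑ i, ∫ ω, wt ξ A i ω * (w i ω + α) ∂μ + 3072 * ((1 + H) * ((1 + θ) * r))
        + 16 / 3 * (r / α) * G := by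
  have hwt := h.bdd_wt
  have hEm := (h.bdd_excess z).measurable
  have hK := h.bdd_kerMean Finset.univ
  have hr := h.r_nonneg
  have hθ := h.theta_nonneg
  set D : J → ℝ → ℝ := fun i t => ∫ ω, wt ξ A i ω *
    |trap α (w i ω) (excess ξ A z ω - x i ω + t) - trap α (w i ω) (excess ξ A z ω - x i ω)| ∂μ
    with hD
  have hDb : ∀ i, BddMeas (D i) := fun i => by
    have h1 := (hx i).bdd.measurable
    have h2 := (hw i).bdd.measurable
    have h3 : BddMeas fun p : Ω × ℝ => trap α (w i p.1) (excess ξ A z p.1 - x i p.1 + p.2) :=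
      bdd_trap α (h2.comp measurable_fst) (((hEm.sub h1).comp measurable_fst).add measurable_snd)
    have h4 : BddMeas fun ω : Ω => trap α (w i ω) (excess ξ A z ω - x i ω) :=
      bdd_trap α h2 (hEm.sub h1)
    exact ((hwt i).comp_fst.mul (h3.sub h4.comp_fst).abs).integral_left
  have hKD : ∑ i, ∫ t, |kerMean μ ξ A Finset.univ t| * D i t ∂lebUnit ≤ 2 * G / α * r := by
    rw [← BddMeas.integral_sum (by fun_prop)]
    have hm : ∀ᵐ t ∂lebUnit, ∑ i, |kerMean μ ξ A Finset.univ t| * D i t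
        ≤ 2 * G / α * (|t| * |kerMean μ ξ A Finset.univ t|) := by
      filter_upwards [ae_lebUnit] with t ht
      rw [← Finset.mul_sum]
      have := mul_le_mul_of_nonneg_left (h.sum_integral_wt_trap_shift_le hα hα1 hw hx hG ht)
        (abs_nonneg (kerMean μ ξ A Finset.univ t))
      linarith
    have hint : Integrable (fun t => |t| * |kerMean μ ξ A Finset.univ t|) lebUnit := by
      have hmeas : Measurable fun t => |t| * |kerMean μ ξ A Finset.univ t| := by
        have := hK.measurable
        fun_prop
      obtain ⟨C, hC⟩ := hK.bdd
      refine Integrable.of_bound hmeas.aestronglyMeasurable C ?_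
      filter_upwards [ae_lebUnit] with t ht
      rw [Real.norm_eq_abs, abs_mul, abs_abs, abs_abs]
      nlinarith [hC t, abs_nonneg t, abs_nonneg (kerMean μ ξ A Finset.univ t)]
    refine (integral_mono_ae (BddMeas.integrable (by fun_prop)) (hint.const_mul _) hm).trans ?_
    rw [integral_const_mul]
    exact mul_le_mul_of_nonneg_left h.integral_abs_mul_abs_kerMean_le (by positivity)
  have hsum := Finset.sum_le_sum fun i (_ : i ∈ Finset.univ) =>
    h.integral_mul_trap_le i hα hα1 (hwt i) (h.measurable_wt i) (wt_nonneg ξ A i) (hw i)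
      (hw0 i) (hx i) hH z
  simp only [Finset.sum_add_distrib, ← Finset.mul_sum] at hsum
  have h1 := h.sum_integral_wt_mul_cub_le
  have h2 := h.theta_le
  have h3 : 0 ≤ ∑ i, ∫ ω, wt ξ A i ω * (w i ω + α) ∂μ := Finset.sum_nonneg fun i _ =>
    integral_nonneg fun ω => mul_nonneg (wt_nonneg ξ A i ω) (by linarith [hw0 i ω])
  have h4 := mul_le_mul_of_nonneg_left h1 (by positivity : 0 ≤ 72 * (1 + H))
  have h5 := mul_le_mul_of_nonneg_left h2 (by positivity : 0 ≤ 72 * r)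
  have h6 : 2 * G / α * r = 2 * (r / α * G) := by ring
  have h7 : r * θ ≤ (1 + H) * ((1 + θ) * r) := by
    nlinarith [mul_nonneg hH (mul_nonneg (by linarith : 0 ≤ 1 + θ) hr)]
  nlinarith

lemma window_le_trap {α : ℝ} (hα : 0 < α) (y : ℝ) : window α y ≤ trap α (2 * α) y := by
  unfold window
  split_ifs with hy
  · rw [trap_eq_one hα hy]
  · exact trap_nonneg _ _ _

/-- Iteration of the self-bounding inequality from the trivial bound `θ`. With `α = 96 r` the
feedback factor is `(16/3) / 96 = 1/18`. Each step enlarges `H` by 6, which multiplies `1 + H` by at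
most 7, and `7/18 < 1` keeps the main constant fixed. -/
lemma windowBound (h : NormDep μ ξ A B κ b r θ) (hr : 0 < r) (hr1 : r ≤ 1 / 96) (z : ℝ) (n : ℕ) :
    ∀ H, 0 ≤ H →
      WindowBound μ ξ A z (96 * r) H (16000 * ((1 + H) * ((1 + θ) * r)) + θ / 2 ^ n) := by
  have hθ := h.theta_nonneg
  have hα : 0 < 96 * r := by positivity
  have hEm := (h.bdd_excess z).measurable
  have hwt := h.bdd_wt
  induction n with
  | zero =>
    intro H hH x hx
    have h1 : ∑ i, ∫ ω, wt ξ A i ω * window (96 * r) (excess ξ A z ω - x i ω) ∂μ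
        ≤ ∑ i, ∫ ω, wt ξ A i ω ∂μ := by
      refine Finset.sum_le_sum fun i _ => ?_
      have hw : BddMeas fun ω => window (96 * r) (excess ξ A z ω - x i ω) :=
        bdd_window _ (hEm.sub (hx i).bdd.measurable)
      exact BddMeas.integral_mono (by fun_prop) (by fun_prop) fun ω =>
        mul_le_of_le_one_right (wt_nonneg ξ A i ω) (window_le_one _ _)
    have h2 : 0 ≤ 16000 * ((1 + H) * ((1 + θ) * r)) := by positivity
    rw [pow_zero, div_one]
    linarith [h.theta_le]
  | succ n ih =>
    intro H hH x hx
    set w : J → Ω → ℝ := fun _ _ => 2 * (96 * r) with hw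
    have hwa : ∀ i, Admissible ξ A 4 i (w i) := fun i =>
      ⟨BddMeas.const _, measurable_const, fun ω => by
        simp only [hw]; rw [abs_of_pos (by positivity)]; linarith⟩
    have h1 := h.sum_integral_wt_trap_le hα (by linarith) hwa (fun i ω => by positivity) hx hH
      (by positivity) (ih (H + 6) (by linarith))
    have h2 : ∑ i, ∫ ω, wt ξ A i ω * window (96 * r) (excess ξ A z ω - x i ω) ∂μ
        ≤ ∑ i, ∫ ω, wt ξ A i ω * trap (96 * r) (w i ω) (excess ξ A z ω - x i ω) ∂μ := by
      refine Finset.sum_le_sum fun i _ => ?_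
      have hxm := (hx i).bdd.measurable
      have hwd : BddMeas fun ω => window (96 * r) (excess ξ A z ω - x i ω) :=
        bdd_window _ (hEm.sub hxm)
      have htr : BddMeas fun ω => trap (96 * r) (w i ω) (excess ξ A z ω - x i ω) :=
        bdd_trap _ measurable_const (hEm.sub hxm)
      exact BddMeas.integral_mono (by fun_prop) (by fun_prop) fun ω =>
        mul_le_mul_of_nonneg_left (window_le_trap hα _) (wt_nonneg ξ A i ω)
    have h3 : ∑ i, ∫ ω, wt ξ A i ω * (w i ω + 96 * r) ∂μ ≤ 288 * r * θ := by
      simp only [hw, integral_mul_const]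
      rw [← Finset.sum_mul]
      have := mul_le_mul_of_nonneg_right h.theta_le (by positivity : 0 ≤ 288 * r)
      linarith
    have h4 : r / (96 * r) = 1 / 96 := by field_simp
    rw [h4] at h1
    have h5 : θ / 2 ^ (n + 1) = θ / 2 ^ n / 2 := by rw [pow_succ]; ring
    have h6 : 0 ≤ θ / 2 ^ n := by positivity
    have h7 : r * θ ≤ (1 + H) * ((1 + θ) * r) := by
      nlinarith [mul_nonneg hH (mul_nonneg (by linarith : 0 ≤ 1 + θ) hr.le)]
    have h8 : (1 + (H + 6)) * ((1 + θ) * r) ≤ 7 * ((1 + H) * ((1 + θ) * r)) := by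
      nlinarith [mul_nonneg hH (mul_nonneg (by linarith : 0 ≤ 1 + θ) hr.le)]
    rw [h5]
    have h9 : 0 ≤ (1 + H) * ((1 + θ) * r) := by positivity
    linarith

/-- Randomized concentration inequality. -/
theorem sum_integral_wt_near_le (h : NormDep μ ξ A B κ b r θ) (hr : 0 < r) (hr1 : r ≤ 1 / 96)
    (z : ℝ) :
    ∑ i, ∫ ω, wt ξ A i ω * (if |excess ξ A z ω| ≤ 4 * |Y ξ A i ω| then 1 else 0) ∂μ
      ≤ 11000 * ((1 + θ) * r) := by
  have hθ := h.theta_nonneg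
  have hα : 0 < 96 * r := by positivity
  have hEm := (h.bdd_excess z).measurable
  have hwt := h.bdd_wt
  have hY := h.bdd_Y
  -- The half-width is random but depends only on the variables in `A i`. Multiplied by the weight
  -- `|ξ i Y i|` it yields `|ξ i| Y i²`, a cubic term.
  set w : J → Ω → ℝ := fun i ω => 4 * |Y ξ A i ω| with hw
  have hw0 : ∀ i ω, 0 ≤ w i ω := fun i ω => by positivity
  have hwa : ∀ i, Admissible ξ A 4 i (w i) := fun i => by
    have hYm : Measurable[sig ξ (· ∈ A i)] (Y ξ A i) := LocDep.measurable_Y fun _ hk => hk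
    refine ⟨by fun_prop, by fun_prop, fun ω => ?_⟩
    rw [abs_of_nonneg (hw0 i ω)]
    simp only [hw]
    linarith [h.abs_Y_le i ω]
  have hxa : ∀ i, Admissible ξ A 0 i (fun _ => (0 : ℝ)) := fun i =>
    ⟨BddMeas.const _, measurable_const, fun ω => by simp⟩
  have h2 : ∑ i, ∫ ω, wt ξ A i ω * (if |excess ξ A z ω| ≤ 4 * |Y ξ A i ω| then 1 else 0) ∂μ
      ≤ ∑ i, ∫ ω, wt ξ A i ω * trap (96 * r) (w i ω) (excess ξ A z ω - 0) ∂μ := by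
    refine Finset.sum_le_sum fun i _ => ?_
    have hYm := (hY i).measurable
    have hwd : BddMeas fun ω => if |excess ξ A z ω| ≤ 4 * |Y ξ A i ω| then (1 : ℝ) else 0 :=
      BddMeas.of_bound (C := 1) (Measurable.ite (measurableSet_le (by fun_prop) (by fun_prop))
        measurable_const measurable_const) fun ω => by split_ifs <;> norm_num
    have htr : BddMeas fun ω => trap (96 * r) (w i ω) (excess ξ A z ω - 0) :=
      bdd_trap _ (hwa i).bdd.measurable (by fun_prop)
    refine BddMeas.integral_mono (by fun_prop) (by fun_prop) fun ω =>
      mul_le_mul_of_nonneg_left ?_ (wt_nonneg ξ A i ω)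
    split_ifs with hc
    · rw [sub_zero, trap_eq_one hα hc]
    · exact trap_nonneg _ _ _
  have h3 : ∑ i, ∫ ω, wt ξ A i ω * (w i ω + 96 * r) ∂μ ≤ 4 * r + 96 * r * θ := by
    have e : ∀ i, ∫ ω, wt ξ A i ω * (w i ω + 96 * r) ∂μ
        = 4 * ∫ ω, |ξ i ω| * Y ξ A i ω ^ 2 ∂μ + 96 * r * ∫ ω, wt ξ A i ω ∂μ := fun i => by
      have hb := h.bdd i
      have := hY i
      rw [← integral_const_mul, ← integral_const_mul,
        ← BddMeas.integral_add (by fun_prop) (by fun_prop)]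
      congr 1; ext ω
      simp only [hw, wt, abs_mul]
      rw [← sq_abs (Y ξ A i ω)]; ring
    simp_rw [e]
    rw [Finset.sum_add_distrib, ← Finset.mul_sum, ← Finset.mul_sum]
    have h4 : ∑ i, ∫ ω, |ξ i ω| * Y ξ A i ω ^ 2 ∂μ ≤ r := by
      have hb := h.bdd
      rw [← BddMeas.integral_sum (by fun_prop)]
      exact (BddMeas.integral_mono (by fun_prop) h.bdd_cub fun ω =>
        (h.small ω).sum_abs_mul_sq_le).trans h.cub_le
    have h5 := mul_le_mul_of_nonneg_left h.theta_le (by positivity : 0 ≤ 96 * r)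
    linarith
  have hn : ∀ n : ℕ, ∑ i, ∫ ω, wt ξ A i ω *
      (if |excess ξ A z ω| ≤ 4 * |Y ξ A i ω| then 1 else 0) ∂μ
      ≤ 10930 * ((1 + θ) * r) + 1 / 18 * (θ / 2 ^ n) := by
    intro n
    have h1 := h.sum_integral_wt_trap_le hα (by linarith) hwa hw0 hxa le_rfl
      (by positivity) (h.windowBound hr hr1 z n (0 + 6) (by norm_num))
    have h4 : r / (96 * r) = 1 / 96 := by field_simp
    rw [h4] at h1
    have h6 : 0 ≤ θ / 2 ^ n := by positivity
    have h9 : 0 ≤ θ * r := by positivity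
    nlinarith
  -- Letting the number of iterations tend to infinity removes the remnant of the trivial bound.
  have hlim : Filter.Tendsto (fun n : ℕ => 10930 * ((1 + θ) * r) + 1 / 18 * (θ / 2 ^ n))
      Filter.atTop (nhds (10930 * ((1 + θ) * r) + 1 / 18 * (θ * 0))) := by
    have := (tendsto_pow_atTop_nhds_zero_of_lt_one (r := (1 / 2 : ℝ)) (by norm_num) (by norm_num))
    refine ((this.const_mul θ).const_mul (1 / 18)).const_add _ |>.congr fun n => ?_
    rw [one_div_pow]; ring
  have := ge_of_tendsto' hlim hn
  nlinarith [mul_nonneg (by linarith : 0 ≤ 1 + θ) hr.le]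

end NormDep
end
end LocalDep
-- Stein's method for the sum divided by the truncated root.
namespace LocalDep

set_option linter.unusedSectionVars false

noncomputable section

/-- The test function `v ↦ f (s / q v) / q v` of Stein's method for a self-normalized sum. -/
def selfSol (z s v : ℝ) : ℝ := (clampSqrt v)⁻¹ * steinSol z (s * (clampSqrt v)⁻¹)

lemma abs_selfSol_le (z s v : ℝ) : |selfSol z s v| ≤ 12 := by
  have h1 := inv_clampSqrt_pos v
  rw [selfSol, abs_mul, abs_of_pos h1]
  nlinarith [abs_steinSol_le z (s * (clampSqrt v)⁻¹), inv_clampSqrt_le v,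
    abs_nonneg (steinSol z (s * (clampSqrt v)⁻¹))]

lemma abs_selfSol_sub_le (z s v v' : ℝ) :
    |selfSol z s v - selfSol z s v'| ≤ (24 + 16 * |s|) * |v - v'| := by
  set g := (clampSqrt v)⁻¹
  set g' := (clampSqrt v')⁻¹
  have e : selfSol z s v - selfSol z s v'
      = (g - g') * steinSol z (s * g) + g' * (steinSol z (s * g) - steinSol z (s * g')) := by
    simp only [selfSol, g, g']; ring
  have h0 : |g - g'| ≤ 4 * |v - v'| := abs_inv_clampSqrt_sub_le v v'
  have h1 : |steinSol z (s * g)| ≤ 6 := abs_steinSol_le _ _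
  have h2 : |steinSol z (s * g) - steinSol z (s * g')| ≤ 2 * (|s| * |g - g'|) := by
    refine (abs_steinSol_sub_le _ _ _).trans (le_of_eq ?_)
    rw [← mul_sub, abs_mul]
  have h3 : 0 < g' := inv_clampSqrt_pos v'
  have h4 : g' ≤ 2 := inv_clampSqrt_le v'
  rw [e]
  refine (abs_add_le _ _).trans ?_
  rw [abs_mul, abs_mul, abs_of_pos h3]
  have h5 : |g - g'| * |steinSol z (s * g)| ≤ 4 * |v - v'| * 6 :=
    mul_le_mul h0 h1 (abs_nonneg _) (by positivity)
  have h6 : g' * |steinSol z (s * g) - steinSol z (s * g')| ≤ 2 * (2 * (|s| * (4 * |v - v'|))) :=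
    mul_le_mul h4 (h2.trans (by gcongr)) (abs_nonneg _) (by norm_num)
  linarith

/-- Leave-one-out expansion of the test function. -/
lemma abs_selfSol_expansion_le (z s v y : ℝ) :
    |selfSol z s v - selfSol z (s - y) v
        - y * ((clampSqrt v)⁻¹ ^ 2 * steinDeriv z (s * (clampSqrt v)⁻¹))|
      ≤ 48 * (1 + |s|) * y ^ 2
        + 16 * |y| * (if |s - z * clampSqrt v| ≤ 4 * |y| then 1 else 0) := by
  set g := (clampSqrt v)⁻¹ with hg
  have hg0 : 0 < g := inv_clampSqrt_pos v
  have hg2 : g ≤ 2 := inv_clampSqrt_le v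
  have e : selfSol z s v - selfSol z (s - y) v - y * (g ^ 2 * steinDeriv z (s * g))
      = g * (steinSol z (s * g) - steinSol z (s * g - y * g)
        - y * g * steinDeriv z (s * g)) := by
    simp only [selfSol, sub_mul]; ring
  rw [e, abs_mul, abs_of_pos hg0]
  have h1 := abs_steinSol_expansion_le z (s * g) (y * g)
  -- Multiplication by `clampSqrt v = g⁻¹` removes the normalization from the event; the threshold
  -- `|y|` results, and `4 * |y|` leaves room.
  have hind : (if |s * g - z| ≤ |y * g| then (1 : ℝ) else 0)
      ≤ if |s - z * clampSqrt v| ≤ 4 * |y| then 1 else 0 := by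
    split_ifs with hc hd
    · exact le_rfl
    · exfalso; apply hd
      have e2 : s - z * clampSqrt v = (s * g - z) * clampSqrt v := by
        rw [sub_mul, mul_assoc, hg, inv_mul_cancel₀ (clampSqrt_pos v).ne', mul_one]
      rw [e2, abs_mul, abs_of_pos (clampSqrt_pos v)]
      have : |y * g| * clampSqrt v = |y| := by
        rw [abs_mul, abs_of_pos hg0, mul_assoc, hg, inv_mul_cancel₀ (clampSqrt_pos v).ne',
          mul_one]
      have h2 := mul_le_mul_of_nonneg_right hc (clampSqrt_pos v).le
      linarith [abs_nonneg y]
    · exact zero_le_one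
    · exact le_rfl
  rw [abs_mul s g, abs_mul y g, abs_of_pos hg0] at h1
  set I1 : ℝ := if |s * g - z| ≤ |y * g| then (1 : ℝ) else 0
  set I2 : ℝ := if |s - z * clampSqrt v| ≤ 4 * |y| then (1 : ℝ) else 0
  have hI1 : (if |s * g - z| ≤ |y| * g then (1 : ℝ) else 0) = I1 := by
    simp only [I1, abs_mul y g, abs_of_pos hg0]
  rw [hI1] at h1
  have hI0 : 0 ≤ I2 := by simp only [I2]; split_ifs <;> norm_num
  have g2 : g ^ 2 ≤ 4 := by nlinarith
  have g3 : g ^ 3 ≤ 8 := by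
    calc g ^ 3 = g ^ 2 * g := by ring
      _ ≤ 4 * 2 := mul_le_mul g2 hg2 hg0.le (by norm_num)
      _ = 8 := by norm_num
  calc _ ≤ g * ((6 + 2 * (|s| * g)) * (y * g) ^ 2 + 4 * (|y| * g) * I1) :=
        mul_le_mul_of_nonneg_left h1 hg0.le
    _ ≤ g * ((6 + 2 * (|s| * 2)) * (y * g) ^ 2 + 4 * (|y| * g) * I2) := by gcongr
    _ = g ^ 3 * ((6 + 4 * |s|) * y ^ 2) + g ^ 2 * (4 * |y| * I2) := by ring
    _ ≤ 8 * ((6 + 4 * |s|) * y ^ 2) + 4 * (4 * |y| * I2) := by gcongr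
    _ ≤ _ := by nlinarith [mul_nonneg (abs_nonneg s) (sq_nonneg y)]

variable {J Ω : Type*} [Fintype J] [DecidableEq J]

/-- The sum, normalized by the truncated root of the quadratic form. -/
def selfStat (ξ : J → Ω → ℝ) (A : J → Finset J) (ω : Ω) : ℝ :=
  S ξ ω * (clampSqrt (quad ξ A ω))⁻¹

variable [mΩ : MeasurableSpace Ω]
  {μ : Measure Ω} [IsProbabilityMeasure μ] {ξ : J → Ω → ℝ} {A B : J → Finset J}
  {κ b r θ : ℝ}

namespace LocDep

/-- Three errors: expanding in the first argument when `Y j` is removed from `S`, changing `quad` to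
`quadOut` in the second, and replacing `quad * g²` by 1. The last is quadratic in `quad - 1` because
`quad * g² = 1` holds exactly where the root is not truncated, so a variance bound suffices. -/
lemma abs_stein_selfStat_le (h : LocDep μ ξ A B κ) (z : ℝ) (ω : Ω) :
    |selfStat ξ A ω * steinSol z (selfStat ξ A ω) - steinDeriv z (selfStat ξ A ω)
        - ∑ j, ξ j ω * selfSol z (Sout ξ (A j) ω) (quadOut ξ A j ω)|
      ≤ 88 * (cub ξ κ ω * (1 + |S ξ ω|))
        + 16 * ∑ j, wt ξ A j ω * (if |excess ξ A z ω| ≤ 4 * |Y ξ A j ω| then 1 else 0)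
        + 2 * (quad ξ A ω - 1) ^ 2 := by
  set U := quad ξ A ω with hU
  set s := S ξ ω with hs
  set g := (clampSqrt U)⁻¹ with hg
  set d := steinDeriv z (s * g) with hd
  have hSo : ∀ j, Sout ξ (A j) ω = s - Y ξ A j ω := fun j => by
    rw [hs, S_eq_Y ξ A j ω]; ring
  have e0 : s * g * steinSol z (s * g) = ∑ j, ξ j ω * selfSol z s U := by
    rw [← Finset.sum_mul]
    change _ = s * selfSol z s U
    rw [selfSol]; ring
  have e : s * g * steinSol z (s * g) - d
        - ∑ j, ξ j ω * selfSol z (Sout ξ (A j) ω) (quadOut ξ A j ω)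
      = ∑ j, ξ j ω * (selfSol z s U - selfSol z (s - Y ξ A j ω) U - Y ξ A j ω * (g ^ 2 * d))
        + ∑ j, ξ j ω * (selfSol z (Sout ξ (A j) ω) U
          - selfSol z (Sout ξ (A j) ω) (quadOut ξ A j ω)) + (U * g ^ 2 - 1) * d := by
    have e1 : U * g ^ 2 * d = ∑ j, ξ j ω * (Y ξ A j ω * (g ^ 2 * d)) := by
      rw [hU, quad, mul_assoc, Finset.sum_mul]
      exact Finset.sum_congr rfl fun j _ => by ring
    rw [e0, sub_mul, e1]
    simp only [mul_sub, Finset.sum_sub_distrib, hSo]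
    ring
  have b1 : |∑ j, ξ j ω * (selfSol z s U - selfSol z (s - Y ξ A j ω) U
      - Y ξ A j ω * (g ^ 2 * d))|
      ≤ 48 * (1 + |s|) * cub ξ κ ω
        + 16 * ∑ j, wt ξ A j ω * (if |excess ξ A z ω| ≤ 4 * |Y ξ A j ω| then 1 else 0) := by
    refine (Finset.abs_sum_le_sum_abs _ _).trans ?_
    calc _ ≤ ∑ j, (48 * (1 + |s|) * (|ξ j ω| * Y ξ A j ω ^ 2)
          + 16 * (wt ξ A j ω * (if |excess ξ A z ω| ≤ 4 * |Y ξ A j ω| then 1 else 0))) := by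
          refine Finset.sum_le_sum fun j _ => ?_
          rw [abs_mul]
          refine (mul_le_mul_of_nonneg_left (abs_selfSol_expansion_le z s U (Y ξ A j ω))
            (abs_nonneg _)).trans (le_of_eq ?_)
          rw [wt, abs_mul, excess]; ring
      _ ≤ _ := by
          rw [Finset.sum_add_distrib, ← Finset.mul_sum, ← Finset.mul_sum]
          have := (h.small ω).sum_abs_mul_sq_le
          gcongr
          exact this
  have b2 : |∑ j, ξ j ω * (selfSol z (Sout ξ (A j) ω) U
      - selfSol z (Sout ξ (A j) ω) (quadOut ξ A j ω))| ≤ 40 * (1 + |s|) * cub ξ κ ω := by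
    refine (Finset.abs_sum_le_sum_abs _ _).trans ?_
    calc _ ≤ ∑ j, 40 * (1 + |s|) * (|ξ j ω| * |U - quadOut ξ A j ω|) := by
          refine Finset.sum_le_sum fun j _ => ?_
          rw [abs_mul]
          have h1 := abs_selfSol_sub_le z (Sout ξ (A j) ω) U (quadOut ξ A j ω)
          have h2 : 24 + 16 * |Sout ξ (A j) ω| ≤ 40 * (1 + |s|) := by
            linarith [h.abs_Sout_A_le j ω, abs_nonneg s]
          refine (mul_le_mul_of_nonneg_left (h1.trans (mul_le_mul_of_nonneg_right h2
            (abs_nonneg _))) (abs_nonneg _)).trans (le_of_eq (by ring))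
      _ ≤ _ := by
          rw [← Finset.mul_sum]
          exact mul_le_mul_of_nonneg_left (h.sum_abs_mul_abs_quad_sub_le ω) (by positivity)
  have b3 : |(U * g ^ 2 - 1) * d| ≤ 2 * (U - 1) ^ 2 := by
    rw [abs_mul, mul_comm 2]
    exact mul_le_mul (abs_mul_inv_clampSqrt_sq_sub_one_le U) (abs_steinDeriv_le _ _)
      (abs_nonneg _) (sq_nonneg _)
  change |s * g * steinSol z (s * g) - d
        - ∑ j, ξ j ω * selfSol z (Sout ξ (A j) ω) (quadOut ξ A j ω)| ≤ _
  rw [e]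
  refine (abs_add_le _ _).trans ((add_le_add_left (abs_add_le _ _) _).trans ?_)
  linarith

lemma bdd_selfStat (h : LocDep μ ξ A B κ) : BddMeas (selfStat ξ A) := by
  have h1 : Continuous fun v => (clampSqrt v)⁻¹ :=
    continuous_clampSqrt.inv₀ fun v => (clampSqrt_pos v).ne'
  exact h.bdd_S.mul (h.bdd_quad.comp_continuous h1)

end LocDep

lemma measurable_selfSol_comp {Ω : Type*} {m : MeasurableSpace Ω} {s v : Ω → ℝ} (z : ℝ)
    (hs : Measurable s) (hv : Measurable v) : Measurable fun ω => selfSol z (s ω) (v ω) := by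
  have h1 := (continuous_steinSol z).measurable
  have h2 := continuous_clampSqrt.measurable
  unfold selfSol
  fun_prop

namespace NormDep

lemma integral_sq_quad_sub_one_le (h : NormDep μ ξ A B κ b r θ) :
    ∫ ω, (quad ξ A ω - 1) ^ 2 ∂μ ≤ 4 * r + b := by
  have hq := h.bdd_quad
  set m := ∫ ω, quad ξ A ω ∂μ with hm
  have h1 : ∫ ω, (quad ξ A ω - 1) ^ 2 ∂μ
      ≤ ∫ ω, (2 * (quad ξ A ω - m) ^ 2 + 2 * (m - 1) ^ 2) ∂μ :=
    BddMeas.integral_mono (by fun_prop) (by fun_prop) fun ω => by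
      nlinarith [sq_nonneg (quad ξ A ω - m - (m - 1))]
  rw [BddMeas.integral_add (by fun_prop) (by fun_prop), integral_const_mul] at h1
  simp only [integral_const, probReal_univ, smul_eq_mul, one_mul] at h1
  have h2 := h.integral_sq_quad_sub_mean_le
  have h3 : (m - 1) ^ 2 ≤ (2 * b) ^ 2 := by
    rw [← sq_abs]; exact pow_le_pow_left₀ (abs_nonneg _) h.mean_quad 2
  nlinarith [h.b_nonneg, h.b_le]

/-- Berry–Esseen bound for the statistic with truncated normalization. -/
theorem abs_selfStat_sub_Phi_le (h : NormDep μ ξ A B κ b r θ) (hr : 0 < r) (hr1 : r ≤ 1 / 96)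
    (z : ℝ) :
    |μ.real {ω | selfStat ξ A ω ≤ z} - Phi z| ≤ 200000 * ((1 + θ) * r + b) := by
  have hT := h.bdd_selfStat
  have hS := h.bdd_S
  have hc := h.bdd_cub
  have hq := h.bdd_quad
  have hwt := h.bdd_wt
  have hb := h.bdd
  have hθ := h.theta_nonneg
  set f : Ω → ℝ := fun ω => selfStat ξ A ω * steinSol z (selfStat ξ A ω) with hf
  have hfb : BddMeas f := hT.mul (hT.comp_continuous (continuous_steinSol z))
  set d : Ω → ℝ := fun ω => steinDeriv z (selfStat ξ A ω) with hd
  have hdb : BddMeas d := BddMeas.of_bound ((measurable_steinDeriv z).comp hT.measurable)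
    fun ω => abs_steinDeriv_le _ _
  have hset : MeasurableSet {ω | selfStat ξ A ω ≤ z} := measurableSet_le hT.measurable (by fun_prop)
  have hP : μ.real {ω | selfStat ξ A ω ≤ z} - Phi z = ∫ ω, (d ω - f ω) ∂μ := by
    have e : ∀ ω, d ω - f ω = {ω | selfStat ξ A ω ≤ z}.indicator 1 ω - Phi z := fun ω => by
      simp only [hd, hf, steinDeriv, Set.indicator, Set.mem_ofPred_eq, Pi.one_apply]
      ring
    simp_rw [e]
    rw [MeasureTheory.integral_sub ((integrable_const 1).indicator hset) (integrable_const _),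
      integral_indicator_one hset]
    simp
  set Fj : J → Ω → ℝ := fun j ω => selfSol z (Sout ξ (A j) ω) (quadOut ξ A j ω) with hFj
  have hFb : ∀ j, BddMeas (Fj j) := fun j => BddMeas.of_bound
    (measurable_selfSol_comp z (h.bdd_Sout _).measurable (h.bdd_quadOut j).measurable)
    fun ω => abs_selfSol_le _ _ _
  have hFint : ∀ j, |∫ ω, Fj j ω ∂μ| ≤ 12 := fun j => by
    have := norm_integral_le_of_norm_le_const (μ := μ) (f := Fj j) (C := 12)
      (Filter.Eventually.of_forall fun ω => abs_selfSol_le _ _ _)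
    simpa using this
  have hsum : |∑ j, ∫ ω, ξ j ω * Fj j ω ∂μ| ≤ 12 * b := by
    refine (Finset.abs_sum_le_sum_abs _ _).trans ?_
    calc _ ≤ ∑ j, |∫ ω, ξ j ω ∂μ| * 12 := Finset.sum_le_sum fun j _ => by
          -- Both arguments of `Fj j` avoid the variables in `A j`, so the expectation factors and
          -- the sum of `|E ξ j|` enters.
          have hm : Measurable[sig ξ (· ∉ A j)] (Fj j) :=
            measurable_selfSol_comp z (LocDep.measurable_Sout fun _ hk => hk)
              (h.measurable_quadOut j)
          rw [h.integral_mul_A j (measurable_sig rfl) hm, abs_mul]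
          exact mul_le_mul_of_nonneg_left (hFint j) (abs_nonneg _)
      _ ≤ 12 * b := by rw [← Finset.sum_mul]; linarith [h.sum_mean]
  have hind : ∀ j, BddMeas fun ω =>
      if |excess ξ A z ω| ≤ 4 * |Y ξ A j ω| then (1 : ℝ) else 0 := fun j => by
    have h1 := (h.bdd_Y j).measurable
    have h2 := (h.bdd_excess z).measurable
    exact BddMeas.of_bound (C := 1) (Measurable.ite (measurableSet_le (by fun_prop) (by fun_prop))
      measurable_const measurable_const) fun ω => by split_ifs <;> norm_num
  have hmain : |∫ ω, (f ω - d ω - ∑ j, ξ j ω * Fj j ω) ∂μ|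
      ≤ 88 * (5 * r) + 16 * (11000 * ((1 + θ) * r)) + 2 * (4 * r + b) := by
    have hdiff : BddMeas fun ω => |f ω - d ω - ∑ j, ξ j ω * Fj j ω| := by fun_prop
    refine abs_integral_le_integral_abs.trans ?_
    refine (BddMeas.integral_mono hdiff (by fun_prop) (h.abs_stein_selfStat_le z)).trans ?_
    rw [BddMeas.integral_add (by fun_prop) (by fun_prop),
      BddMeas.integral_add (by fun_prop) (by fun_prop), integral_const_mul, integral_const_mul,
      integral_const_mul, BddMeas.integral_sum (by fun_prop)]
    linarith [h.integral_cub_mul_le, h.sum_integral_wt_near_le hr hr1 z,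
      h.integral_sq_quad_sub_one_le]
  rw [BddMeas.integral_sub (by fun_prop) (by fun_prop),
    BddMeas.integral_sum (by fun_prop), BddMeas.integral_sub hfb hdb] at hmain
  rw [hP, BddMeas.integral_sub hdb hfb]
  have h1 := abs_le.1 hmain
  have h2 := abs_le.1 hsum
  have h3 := h.b_nonneg
  have h4 : 0 ≤ θ * r := by positivity
  rw [abs_le]
  constructor <;> nlinarith

end NormDep
end
end LocalDep
-- Removing the centring term from the normalization.
namespace LocalDep

set_option linter.unusedSectionVars false

noncomputable section

section Normal

lemma pdf_le_exp (x : ℝ) : gaussianPDFReal 0 1 x ≤ Real.exp (-x ^ 2 / 2) := by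
  rw [pdf_eq]
  refine mul_le_of_le_one_left (Real.exp_nonneg _) (inv_le_one_of_one_le₀ ?_)
  rw [Real.one_le_sqrt]
  nlinarith [Real.pi_gt_three]

lemma one_sub_Phi_le {z c : ℝ} (hc : 0 < c) (hz : c⁻¹ ≤ z) : 1 - Phi z ≤ c := by
  have h0 : 0 < c⁻¹ := inv_pos.2 hc
  have h1 := mul_one_sub_Phi_le z
  have h2 := pdf_le_exp z
  have h3 : Real.exp (-z ^ 2 / 2) ≤ 1 := Real.exp_le_one_iff.2 (by nlinarith [sq_nonneg z])
  have h4 : c⁻¹ * (1 - Phi z) ≤ 1 :=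
    (mul_le_mul_of_nonneg_right hz (by linarith [Phi_le_one z])).trans (by linarith)
  calc 1 - Phi z = c * (c⁻¹ * (1 - Phi z)) := by rw [mul_inv_cancel_left₀ hc.ne']
    _ ≤ c * 1 := mul_le_mul_of_nonneg_left h4 hc.le
    _ = c := mul_one c

lemma Phi_le_of_le_neg {z c : ℝ} (hc : 0 < c) (hz : z ≤ -c⁻¹) : Phi z ≤ c := by
  have h1 := one_sub_Phi_le hc (z := -z) (by linarith)
  rw [Phi_neg] at h1
  linarith

lemma sq_mul_exp_le (z : ℝ) : z ^ 2 * Real.exp (-z ^ 2 / 8) ≤ 8 := by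
  have h1 := Real.add_one_le_exp (z ^ 2 / 8)
  have h2 : Real.exp (z ^ 2 / 8) * Real.exp (-z ^ 2 / 8) = 1 := by
    rw [← Real.exp_add]; simp [neg_div]
  nlinarith [Real.exp_pos (-z ^ 2 / 8)]

/-- `Phi` varies little under a shift which is quadratic in the argument. -/
lemma abs_Phi_sub_le_of_abs_sub_le {z y ρ : ℝ} (hρ : 0 ≤ ρ) (hz : 6 * ρ * |z| ≤ 1)
    (hy : |y - z| ≤ 3 * ρ * z ^ 2) : |Phi y - Phi z| ≤ 24 * ρ := by
  -- The shift stays within distance `|z|/2` of `z`, where `|x| ≥ |z|/2` and the density is at most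
  -- `exp (-z²/8)`. Then `z² exp (-z²/8) ≤ 8` gives `24 = 3 * 8`.
  have h0 : 3 * ρ * z ^ 2 ≤ |z| / 2 := by
    rw [← sq_abs]; nlinarith [abs_nonneg z]
  have h1 : ‖Phi y - Phi z‖ ≤ Real.exp (-z ^ 2 / 8) * ‖y - z‖ := by
    refine Convex.norm_image_sub_le_of_norm_hasDerivWithin_le (f := Phi)
      (f' := gaussianPDFReal 0 1) (s := Metric.closedBall z (|z| / 2))
      (fun x _ => (hasDerivAt_Phi x).hasDerivWithinAt) (fun x hx => ?_)
      (convex_closedBall _ _) (Metric.mem_closedBall_self (by positivity)) ?_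
    · rw [Metric.mem_closedBall, Real.dist_eq] at hx
      have h2 : |z| ≤ 2 * |x| := by
        have := abs_sub_abs_le_abs_sub z x
        rw [abs_sub_comm] at this
        linarith
      have h3 : z ^ 2 ≤ 4 * x ^ 2 := by
        rw [← sq_abs z, ← sq_abs x]; nlinarith [abs_nonneg z]
      rw [Real.norm_eq_abs, abs_of_nonneg (gaussianPDFReal_nonneg _ _ _)]
      exact (pdf_le_exp x).trans (Real.exp_le_exp.2 (by linarith))
    · rw [Metric.mem_closedBall, Real.dist_eq]
      linarith
  rw [Real.norm_eq_abs, Real.norm_eq_abs] at h1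
  have h2 := sq_mul_exp_le z
  have h3 := mul_le_mul_of_nonneg_left hy (Real.exp_nonneg (-z ^ 2 / 8))
  nlinarith

end Normal

section Perturbation

/-- Perturbing the normalization of a quotient changes it by a quadratic amount. -/
lemma abs_div_sqrt_sub_le {s u e ρ : ℝ} (hρ : 0 < ρ) (hu : |u - 1| ≤ 1 / 2)
    (hs : |s| * ρ ≤ 1 / 100) (he : |e| ≤ ρ) :
    0 < u - s * e ∧ ρ * |s / √(u - s * e)| ≤ 1 / 40 ∧
      |s / √(u - s * e) - s / √u| ≤ 3 * ρ * (s / √(u - s * e)) ^ 2 := by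
  have h1 := abs_le.1 hu
  have hse : |s * e| ≤ 1 / 100 := by
    rw [abs_mul]
    exact (mul_le_mul_of_nonneg_left he (abs_nonneg _)).trans hs
  have h2 := abs_le.1 hse
  have hv : 0 < u - s * e := by linarith
  set p := √(u - s * e) with hp
  set q := √u with hq
  have hp2 : p ^ 2 = u - s * e := Real.sq_sqrt hv.le
  have hq2 : q ^ 2 = u := Real.sq_sqrt (by linarith)
  have hp0 : 7 / 10 ≤ p := Real.le_sqrt_of_sq_le (by linarith)
  have hq0 : 7 / 10 ≤ q := Real.le_sqrt_of_sq_le (by linarith)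
  have hpq : p ≤ 2 * q := by nlinarith
  refine ⟨hv, ?_, ?_⟩
  · rw [abs_div, abs_of_pos (show 0 < p by linarith), ← mul_div_assoc, div_le_iff₀ (by linarith)]
    linarith
  · have e1 : s / p - s / q = s / p * ((s / p) * e) * (p / (q * (p + q))) := by
      have : p ≠ 0 := by positivity
      have : q ≠ 0 := by positivity
      have h3 : (q - p) * (p + q) = s * e := by linear_combination hq2 - hp2
      field_simp
      linear_combination s * h3
    have h4 : |p / (q * (p + q))| ≤ 3 := by
      rw [abs_of_nonneg (by positivity), div_le_iff₀ (by positivity)]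
      nlinarith
    rw [e1, abs_mul, ← mul_assoc, ← sq, abs_mul, abs_of_nonneg (sq_nonneg (s / p))]
    have h5 := sq_nonneg (s / p)
    have h6 : (s / p) ^ 2 * |e| * |p / (q * (p + q))| ≤ (s / p) ^ 2 * ρ * 3 := by gcongr
    linarith

/-- The map `x ↦ x + 3 ρ x²` preserves the order `w ≤ z`, since `ρ |w|` is small and only the lower
point needs control. -/
lemma le_add_of_close {w t z ρ : ℝ} (hw : ρ * |w| ≤ 1 / 40) (hρ : 0 < ρ)
    (hwt : |w - t| ≤ 3 * ρ * w ^ 2) (h : w ≤ z) : t ≤ z + 3 * ρ * z ^ 2 := by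
  have h1 := (abs_le.1 hwt).1
  have h2 := neg_abs_le w
  have h3 : 0 ≤ (z - w) * (1 + 3 * ρ * (z + w)) :=
    mul_nonneg (by linarith) (by nlinarith)
  nlinarith

lemma le_of_close {w t z ρ : ℝ} (hw : ρ * |w| ≤ 1 / 40) (hρ : 0 < ρ)
    (hwt : |w - t| ≤ 3 * ρ * w ^ 2) (h : t ≤ z - 3 * ρ * z ^ 2) : w ≤ z := by
  by_contra! hz
  have h1 := (abs_le.1 hwt).2
  have h2 := le_abs_self w
  have h3 : 0 < (w - z) * (1 - 3 * ρ * (z + w)) :=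
    mul_pos (by linarith) (by nlinarith)
  nlinarith

end Perturbation

variable {J Ω : Type*} [Fintype J] [DecidableEq J] [mΩ : MeasurableSpace Ω]
  {μ : Measure Ω} [IsProbabilityMeasure μ] {ξ : J → Ω → ℝ} {A B : J → Finset J}
  {κ b r θ : ℝ}

lemma BddMeas.measureReal_lt_le {f : Ω → ℝ} (hf : BddMeas f) {c : ℝ} (hc : 0 < c) :
    μ.real {ω | c < |f ω|} ≤ (∫ ω, f ω ^ 2 ∂μ) / c ^ 2 := by
  rw [le_div_iff₀ (by positivity), mul_comm]
  refine le_trans ?_ (mul_meas_ge_le_integral_of_nonneg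
    (Filter.Eventually.of_forall fun ω => sq_nonneg (f ω)) (hf.pow 2).integrable (c ^ 2))
  refine mul_le_mul_of_nonneg_left (measureReal_mono fun ω hω => ?_) (by positivity)
  change c ^ 2 ≤ f ω ^ 2
  rw [← sq_abs (f ω)]
  exact pow_le_pow_left₀ hc.le (le_of_lt hω) 2

namespace LocDep

lemma bdd_avg (h : LocDep μ ξ A B κ) : BddMeas (avg (Y ξ A)) :=
  (BddMeas.sum _ h.bdd_Y).div_const _

lemma sum_Y_eq (ξ : J → Ω → ℝ) (A : J → Finset J) (ω : Ω) :
    ∑ i, Y ξ A i ω = ∑ k, ((Finset.univ.filter fun i => k ∈ A i).card : ℝ) * ξ k ω := by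
  unfold Y
  rw [Finset.sum_comm' (t' := Finset.univ) (s' := fun k => Finset.univ.filter fun i => k ∈ A i)
    (by simp)]
  simp

/-- Second moment of a weighted sum. -/
lemma integral_sq_weighted_le (h : LocDep μ ξ A B κ) {n : J → ℝ} (hn0 : ∀ k, 0 ≤ n k)
    (hn : ∀ k, n k ≤ κ) (hb : ∑ i, |∫ ω, ξ i ω ∂μ| ≤ b)
    (hθ : ∑ i, ∑ j ∈ A i, ∫ ω, |ξ i ω * ξ j ω| ∂μ ≤ θ) :
    ∫ ω, (∑ k, n k * ξ k ω) ^ 2 ∂μ ≤ κ ^ 2 * (θ + b ^ 2) := by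
  have hξ := h.bdd
  have e : ∀ ω, (∑ k, n k * ξ k ω) ^ 2 = ∑ k, ∑ l, n k * n l * (ξ k ω * ξ l ω) := fun ω => by
    rw [sq, Finset.sum_mul_sum]
    exact Finset.sum_congr rfl fun _ _ => Finset.sum_congr rfl fun _ _ => by ring
  simp_rw [e]
  rw [BddMeas.integral_sum (by fun_prop)]
  have h0 : 0 ≤ κ ^ 2 := sq_nonneg κ
  have h1 : ∀ k l, 0 ≤ n k * n l ∧ n k * n l ≤ κ ^ 2 := fun k l =>
    ⟨mul_nonneg (hn0 k) (hn0 l), by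
      rw [sq]; exact mul_le_mul (hn k) (hn l) (hn0 l) ((hn0 k).trans (hn k))⟩
  have h2 : ∀ k, ∫ ω, ∑ l, n k * n l * (ξ k ω * ξ l ω) ∂μ
      ≤ κ ^ 2 * (∑ l ∈ A k, ∫ ω, |ξ k ω * ξ l ω| ∂μ + |∫ ω, ξ k ω ∂μ| * b) := fun k => by
    rw [BddMeas.integral_sum (by fun_prop), ← Finset.sum_add_sum_compl (A k), mul_add,
      Finset.mul_sum]
    refine add_le_add (Finset.sum_le_sum fun l _ => ?_) ?_
    · rw [integral_const_mul]
      refine (mul_le_mul_of_nonneg_left ((le_abs_self _).trans abs_integral_le_integral_abs)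
        (h1 k l).1).trans ?_
      exact mul_le_mul_of_nonneg_right (h1 k l).2 (integral_nonneg fun _ => abs_nonneg _)
    · have h3 : ∑ l ∈ (A k)ᶜ, |∫ ω, ξ l ω ∂μ| ≤ b :=
        (Finset.sum_le_sum_of_subset_of_nonneg (Finset.subset_univ _)
          fun _ _ _ => abs_nonneg _).trans hb
      calc _ ≤ ∑ l ∈ (A k)ᶜ, κ ^ 2 * (|∫ ω, ξ k ω ∂μ| * |∫ ω, ξ l ω ∂μ|) := by
            refine Finset.sum_le_sum fun l hl => ?_
            rw [integral_const_mul, h.integral_mul_A k (measurable_sig rfl)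
              (measurable_sig (Finset.mem_compl.1 hl)), ← abs_mul]
            refine (mul_le_mul_of_nonneg_left (le_abs_self _) (h1 k l).1).trans ?_
            exact mul_le_mul_of_nonneg_right (h1 k l).2 (abs_nonneg _)
        _ ≤ _ := by
            rw [← Finset.mul_sum, ← Finset.mul_sum]
            exact mul_le_mul_of_nonneg_left (mul_le_mul_of_nonneg_left h3 (abs_nonneg _)) h0
  refine (Finset.sum_le_sum fun k _ => h2 k).trans ?_
  rw [← Finset.mul_sum, Finset.sum_add_distrib, ← Finset.sum_mul]
  have h4 : (∑ k, |∫ ω, ξ k ω ∂μ|) * b ≤ b ^ 2 := by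
    have h5 : 0 ≤ ∑ k, |∫ ω, ξ k ω ∂μ| := Finset.sum_nonneg fun _ _ => abs_nonneg _
    rw [sq]
    exact mul_le_mul_of_nonneg_right hb (h5.trans hb)
  exact mul_le_mul_of_nonneg_left (add_le_add hθ h4) h0

lemma integral_sq_avg_le (h : LocDep μ ξ A B κ) (hb : ∑ i, |∫ ω, ξ i ω ∂μ| ≤ b)
    (hθ : ∑ i, ∑ j ∈ A i, ∫ ω, |ξ i ω * ξ j ω| ∂μ ≤ θ) :
    ∫ ω, avg (Y ξ A) ω ^ 2 ∂μ ≤ (κ / Fintype.card J) ^ 2 * (θ + b ^ 2) := by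
  simp_rw [avg, sum_Y_eq, div_pow, integral_div]
  rw [div_mul_eq_mul_div]
  exact div_le_div_of_nonneg_right (h.integral_sq_weighted_le (fun _ => by positivity)
    h.nbhds.card_mem_A_le hb hθ) (by positivity)

end LocDep

namespace NormDep

/-- Chebyshev for each event. With `κ / |J| = ρ²` the average of the `Y i` has second moment at most
`ρ⁴ (θ + b²)`, which leaves room at level `ρ`. -/
lemma measureReal_bad_le (h : NormDep μ ξ A B κ b r θ)
    (hθ : ∑ i, ∑ j ∈ A i, ∫ ω, |ξ i ω * ξ j ω| ∂μ ≤ θ) {ρ : ℝ} (hρ : 0 < ρ) (hρr : ρ ≤ r)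
    (hr1 : r ≤ 1 / 96) (hκ : κ / Fintype.card J = ρ ^ 2) :
    μ.real ({ω | ρ < |avg (Y ξ A) ω|} ∪ {ω | 1 / 2 < |quad ξ A ω - 1|}
      ∪ {ω | 1 / (100 * ρ) < |S ξ ω|}) ≤ 21000 * ((1 + θ) * r + b) := by
  have hq := h.bdd_quad
  have hθ0 := h.theta_nonneg
  have hb0 := h.b_nonneg
  have hb1 := h.b_le
  have h1 : μ.real {ω | ρ < |avg (Y ξ A) ω|} ≤ ρ * (θ + 1) := by
    refine (h.bdd_avg.measureReal_lt_le hρ).trans ?_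
    rw [div_le_iff₀ (by positivity)]
    refine (h.integral_sq_avg_le h.sum_mean hθ).trans ?_
    rw [hκ, ← pow_mul]
    calc ρ ^ (2 * 2) * (θ + b ^ 2) = ρ ^ 3 * (ρ * (θ + b ^ 2)) := by ring
      _ ≤ ρ ^ 3 * (1 * (θ + 1)) := by
          refine mul_le_mul_of_nonneg_left ?_ (by positivity)
          exact mul_le_mul (by linarith) (by nlinarith) (by positivity) (by norm_num)
      _ = _ := by ring
  have h2 : μ.real {ω | 1 / 2 < |quad ξ A ω - 1|} ≤ 4 * (4 * r + b) := by
    refine (BddMeas.measureReal_lt_le (f := fun ω => quad ξ A ω - 1) (by fun_prop)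
      (by norm_num)).trans ?_
    rw [div_le_iff₀ (by norm_num)]
    linarith [h.integral_sq_quad_sub_one_le]
  have h3 : μ.real {ω | 1 / (100 * ρ) < |S ξ ω|} ≤ 20000 * ρ := by
    refine (h.bdd_S.measureReal_lt_le (by positivity)).trans ?_
    rw [div_le_iff₀ (by positivity)]
    refine h.integral_S_sq_le.trans ?_
    rw [div_pow, one_pow, mul_pow, sq ρ, mul_one_div, le_div_iff₀ (by positivity)]
    nlinarith
  have h4 := measureReal_union_le (μ := μ)
    ({ω | ρ < |avg (Y ξ A) ω|} ∪ {ω | 1 / 2 < |quad ξ A ω - 1|}) {ω | 1 / (100 * ρ) < |S ξ ω|}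
  have h5 := measureReal_union_le (μ := μ)
    {ω | ρ < |avg (Y ξ A) ω|} {ω | 1 / 2 < |quad ξ A ω - 1|}
  have h6 : ρ * (θ + 1) ≤ r * (θ + 1) := mul_le_mul_of_nonneg_right hρr (by linarith)
  have h7 : 0 ≤ θ * r := mul_nonneg hθ0 h.r_nonneg
  nlinarith

/-- Berry–Esseen bound for a statistic which agrees with the self-normalized sum off `N`. -/
theorem abs_measureReal_sub_Phi_le (h : NormDep μ ξ A B κ b r θ)
    (hθ : ∑ i, ∑ j ∈ A i, ∫ ω, |ξ i ω * ξ j ω| ∂μ ≤ θ) {ρ : ℝ} (hρ : 0 < ρ) (hρr : ρ ≤ r)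
    (hr1 : r ≤ 1 / 96) (hκ : κ / Fintype.card J = ρ ^ 2) {w : Ω → ℝ} {N : Set Ω}
    (hw : ∀ ω ∉ N, 0 < quad ξ A ω - S ξ ω * avg (Y ξ A) ω →
      w ω = S ξ ω / √(quad ξ A ω - S ξ ω * avg (Y ξ A) ω)) (z : ℝ) :
    |μ.real {ω | w ω ≤ z} - Phi z| ≤ 300000 * ((1 + θ) * r + b) + μ.real N := by
  set D : Set Ω := N ∪ ({ω | ρ < |avg (Y ξ A) ω|} ∪ {ω | 1 / 2 < |quad ξ A ω - 1|}
      ∪ {ω | 1 / (100 * ρ) < |S ξ ω|}) with hD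
  have hDle : μ.real D ≤ μ.real N + 21000 * ((1 + θ) * r + b) :=
    (measureReal_union_le _ _).trans (by linarith [h.measureReal_bad_le hθ hρ hρr hr1 hκ])
  have hgood : ∀ ω ∉ D, ρ * |w ω| ≤ 1 / 40 ∧ |w ω - selfStat ξ A ω| ≤ 3 * ρ * w ω ^ 2 := by
    intro ω hω
    simp only [hD, Set.mem_union, Set.mem_ofPred_eq, not_or, not_lt] at hω
    obtain ⟨hN, ⟨h1, h2⟩, h3⟩ := hω
    have h3' : |S ξ ω| * ρ ≤ 1 / 100 := by
      refine (mul_le_mul_of_nonneg_right h3 hρ.le).trans (le_of_eq ?_)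
      field_simp
    obtain ⟨k1, k2, k3⟩ := abs_div_sqrt_sub_le hρ h2 h3' h1
    have h4 := abs_le.1 h2
    have e : selfStat ξ A ω = S ξ ω / √(quad ξ A ω) := by
      rw [selfStat, clampSqrt_eq (by linarith) (by linarith), div_eq_mul_inv]
    rw [hw ω hN k1, e]
    exact ⟨k2, k3⟩
  have hθr : 0 ≤ θ * r := mul_nonneg h.theta_nonneg h.r_nonneg
  have hr0 : 0 < r := hρ.trans_le hρr
  have hb0 := h.b_nonneg
  have h6 : (6 * ρ)⁻¹ * (6 * ρ) = 1 := inv_mul_cancel₀ (by positivity)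
  have hP1 : μ.real {ω | w ω ≤ z} ≤ 1 := measureReal_le_one
  -- Outside `D` one has `|w| ≤ 1 / (40 ρ)`, so for `|z| > 1 / (6 ρ)` the event is decided there,
  -- and the normal tail is at most `6 ρ`. For the remaining `z` the quadratic shift is absorbed by
  -- `Phi`.
  rcases lt_or_ge (6 * ρ)⁻¹ z with hz | hz
  · have h1 := one_sub_Phi_le (by positivity) hz.le
    have h2 : (Set.univ : Set Ω) ⊆ {ω | w ω ≤ z} ∪ D := fun ω _ => by
      by_cases hω : ω ∈ D
      · exact Or.inr hω
      · refine Or.inl ?_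
        have := (hgood ω hω).1
        change w ω ≤ z
        by_contra! h7
        nlinarith [le_abs_self (w ω)]
    have h3 := (measureReal_mono (μ := μ) h2).trans (measureReal_union_le _ _)
    rw [probReal_univ] at h3
    have := Phi_le_one z
    rw [abs_le]
    constructor <;> nlinarith
  rcases lt_or_ge z (-(6 * ρ)⁻¹) with hz' | hz'
  · have h1 := Phi_le_of_le_neg (by positivity) hz'.le
    have h2 : {ω | w ω ≤ z} ⊆ D := fun ω h7 => by
      by_contra hω
      have := (hgood ω hω).1
      change w ω ≤ z at h7
      nlinarith [neg_abs_le (w ω)]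
    have h3 := measureReal_mono (μ := μ) h2
    have := Phi_nonneg z
    have : 0 ≤ μ.real {ω | w ω ≤ z} := measureReal_nonneg
    rw [abs_le]
    constructor <;> nlinarith
  have hz6 : 6 * ρ * |z| ≤ 1 := by
    have : |z| ≤ (6 * ρ)⁻¹ := abs_le.2 ⟨hz', hz⟩
    calc _ ≤ 6 * ρ * (6 * ρ)⁻¹ := mul_le_mul_of_nonneg_left this (by positivity)
      _ = 1 := by linarith
  have hnn : 0 ≤ 3 * ρ * z ^ 2 := by positivity
  have k1 := abs_le.1 (abs_Phi_sub_le_of_abs_sub_le hρ.le hz6 (y := z + 3 * ρ * z ^ 2)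
    (by rw [add_sub_cancel_left, abs_of_nonneg hnn]))
  have k2 := abs_le.1 (abs_Phi_sub_le_of_abs_sub_le hρ.le hz6 (y := z - 3 * ρ * z ^ 2)
    (by rw [sub_sub_cancel_left, abs_neg, abs_of_nonneg hnn]))
  have k3 := abs_le.1 (h.abs_selfStat_sub_Phi_le hr0 hr1 (z + 3 * ρ * z ^ 2))
  have k4 := abs_le.1 (h.abs_selfStat_sub_Phi_le hr0 hr1 (z - 3 * ρ * z ^ 2))
  have s1 : {ω | w ω ≤ z} ⊆ {ω | selfStat ξ A ω ≤ z + 3 * ρ * z ^ 2} ∪ D := fun ω h7 => by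
    by_cases hω : ω ∈ D
    · exact Or.inr hω
    · exact Or.inl (le_add_of_close (hgood ω hω).1 hρ (hgood ω hω).2 h7)
  have s2 : {ω | selfStat ξ A ω ≤ z - 3 * ρ * z ^ 2} ⊆ {ω | w ω ≤ z} ∪ D := fun ω h7 => by
    by_cases hω : ω ∈ D
    · exact Or.inr hω
    · exact Or.inl (le_of_close (hgood ω hω).1 hρ (hgood ω hω).2 h7)
  have t1 := (measureReal_mono (μ := μ) s1).trans (measureReal_union_le _ _)
  have t2 := (measureReal_mono (μ := μ) s2).trans (measureReal_union_le _ _)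
  rw [abs_le]
  constructor <;> nlinarith

end NormDep
end
end LocalDep
-- Truncation of a standardized family.
namespace LocalDep

set_option linter.unusedSectionVars false

noncomputable section

variable {J Ω : Type*} [mΩ : MeasurableSpace Ω] {μ : Measure Ω} {X : J → Ω → ℝ}
  {A B : J → Finset J} {κ : ℝ}

section Independence

lemma measurable_pi_comp {p : J → Prop} {φ : J → ℝ → ℝ} (hφ : ∀ i, Measurable (φ i)) :
    Measurable fun (v : {j : J // p j} → ℝ) (j : {j : J // p j}) => φ j (v j) := by
  refine measurable_pi_lambda _ fun j => ?_
  have := hφ j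
  fun_prop

lemma LD1.comp (h : LD1 μ X A) {φ : J → ℝ → ℝ} (hφ : ∀ i, Measurable (φ i)) :
    LD1 μ (fun i ω => φ i (X i ω)) A := fun i =>
  (h i).comp (hφ i) (measurable_pi_comp hφ)

lemma LD2.comp (h : LD2 μ X A B) {φ : J → ℝ → ℝ} (hφ : ∀ i, Measurable (φ i)) :
    LD2 μ (fun i ω => φ i (X i ω)) A B := fun i =>
  ⟨(h i).1, (h i).2.comp (measurable_pi_comp hφ) (measurable_pi_comp hφ)⟩

lemma LD1.indep_sig (h : LD1 μ X A) (i : J) : Indep (sig X (· = i)) (sig X (· ∉ A i)) μ := by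
  have h1 := (h i).comp (φ := fun t (_ : {j : J // j = i}) => t) (ψ := id)
    (measurable_pi_lambda _ fun _ => measurable_id) measurable_id
  rw [IndepFun_iff_Indep] at h1
  have e : (fun t (_ : {j : J // j = i}) => t) ∘ X i = fun ω (j : {j : J // j = i}) => X j ω := by
    funext ω j
    obtain ⟨j, rfl⟩ := j
    rfl
  rw [e] at h1
  exact h1

lemma LD2.indep_sig (h : LD2 μ X A B) (i : J) : Indep (sig X (· ∈ A i)) (sig X (· ∉ B i)) μ := by
  have h1 := (h i).2
  rw [IndepFun_iff_Indep] at h1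
  exact h1

lemma LD1.integral_mul (h : LD1 μ X A) (hX : ∀ i, Measurable (X i)) {i j : J} (hj : j ∉ A i) :
    ∫ ω, X i ω * X j ω ∂μ = (∫ ω, X i ω ∂μ) * ∫ ω, X j ω ∂μ :=
  integral_mul_of_indep (h.indep_sig i) (sig_le hX) (sig_le hX) (measurable_sig rfl)
    (measurable_sig hj)

end Independence

section Truncation

variable [DecidableEq J]

/-- The family truncated at level `1 / κ`, and set to zero at inactive indices. -/
def trunc (X : J → Ω → ℝ) (A : J → Finset J) (κ : ℝ) (i : J) (ω : Ω) : ℝ :=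
  if i ∈ A i ∧ |X i ω| ≤ 1 / κ then X i ω else 0

/-- The part of `X i ^ 2` above the truncation level. -/
def tail (X : J → Ω → ℝ) (κ : ℝ) (i : J) (ω : Ω) : ℝ :=
  {ω | 1 / κ < |X i ω|}.indicator (fun ω => |X i ω| ^ 2) ω

lemma tail_nonneg (X : J → Ω → ℝ) (κ : ℝ) (i : J) (ω : Ω) : 0 ≤ tail X κ i ω :=
  Set.indicator_nonneg (fun _ _ => by positivity) _

lemma tail_le (X : J → Ω → ℝ) (κ : ℝ) (i : J) (ω : Ω) : tail X κ i ω ≤ X i ω ^ 2 := by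
  simp only [tail, Set.indicator, sq_abs]
  split_ifs
  · exact le_rfl
  · positivity

lemma mul_abs_trunc_le (hκ : 0 < κ) (i : J) (ω : Ω) : κ * |trunc X A κ i ω| ≤ 1 := by
  unfold trunc
  split_ifs with h
  · calc _ ≤ κ * (1 / κ) := mul_le_mul_of_nonneg_left h.2 hκ.le
      _ = 1 := mul_one_div_cancel hκ.ne'
  · simp

lemma abs_trunc_cube_le (i : J) (ω : Ω) : |trunc X A κ i ω| ^ 3
    ≤ {ω | |X i ω| ≤ 1 / κ}.indicator (fun ω => |X i ω| ^ 3) ω := by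
  simp only [trunc, Set.indicator, Set.mem_ofPred_eq]
  split_ifs with h1 h2 h2
  · exact le_rfl
  · exact absurd h1.2 h2
  · simp
  · simp

lemma abs_trunc_mul_le (i j : J) (ω : Ω) : |trunc X A κ i ω * trunc X A κ j ω|
    ≤ |{ω | |X i ω| ≤ 1 / κ ∧ |X j ω| ≤ 1 / κ}.indicator (fun ω => X i ω * X j ω) ω| := by
  simp only [trunc, Set.indicator, Set.mem_ofPred_eq]
  split_ifs with h1 h2 h3 h3 h3 <;> simp_all [mul_nonneg]

/-- Above the level `1 / κ` one has `|X| ≤ κ X²`. -/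
lemma abs_sub_trunc_le (hκ : 0 < κ) {i : J} {ω : Ω} (hi : i ∉ A i → X i ω = 0) :
    |X i ω - trunc X A κ i ω| ≤ κ * tail X κ i ω := by
  by_cases h : 1 / κ < |X i ω|
  · have h1 : trunc X A κ i ω = 0 := if_neg fun h' => h'.2.not_gt h
    have h2 : tail X κ i ω = |X i ω| ^ 2 := Set.indicator_of_mem (s := {ω | 1 / κ < |X i ω|}) h _
    rw [h1, h2, sub_zero]
    rw [div_lt_iff₀ hκ] at h
    nlinarith [abs_nonneg (X i ω)]
  · have h1 : trunc X A κ i ω = X i ω := by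
      by_cases hA : i ∈ A i
      · exact if_pos ⟨hA, not_lt.1 h⟩
      · rw [hi hA]; simp [trunc, hi hA]
    rw [h1, sub_self, abs_zero]
    exact mul_nonneg hκ.le (tail_nonneg _ _ _ _)

/-- If one factor exceeds the level, the product is at most the sum of the squares that exceed it.
The condition on `j` ensures that, summed over `j ∈ A i`, the first term is counted at most `κ`
times. -/
lemma abs_mul_sub_trunc_le {i j : J} {ω : Ω} (hi : i ∉ A i → X i ω = 0)
    (hj : j ∉ A j → X j ω = 0) :
    |X i ω * X j ω - trunc X A κ i ω * trunc X A κ j ω|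
      ≤ (if j ∈ A j then tail X κ i ω else 0) + tail X κ j ω := by
  have t1 := tail_nonneg X κ i ω
  have t2 := tail_nonneg X κ j ω
  have key : ∀ k, 1 / κ < |X k ω| → trunc X A κ k ω = 0 ∧ tail X κ k ω = |X k ω| ^ 2 :=
    fun k h => ⟨if_neg fun h' => h'.2.not_gt h,
      Set.indicator_of_mem (s := {ω | 1 / κ < |X k ω|}) h _⟩
  by_cases hjA : j ∈ A j
  · rw [if_pos hjA]
    rcases lt_or_ge (1 / κ) |X i ω| with h1 | h1 <;> rcases lt_or_ge (1 / κ) |X j ω| with h2 | h2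
    · rw [(key i h1).1, (key i h1).2, (key j h2).2, zero_mul, sub_zero, abs_mul]
      nlinarith [sq_nonneg (|X i ω| - |X j ω|), sq_nonneg (|X i ω|), sq_nonneg (|X j ω|)]
    · rw [(key i h1).1, (key i h1).2, zero_mul, sub_zero, abs_mul]
      nlinarith [abs_nonneg (X i ω)]
    · rw [(key j h2).1, (key j h2).2, mul_zero, sub_zero, abs_mul]
      nlinarith [abs_nonneg (X j ω)]
    · have e1 : trunc X A κ j ω = X j ω := if_pos ⟨hjA, h2⟩
      have e2 : trunc X A κ i ω = X i ω := by
        by_cases hA : i ∈ A i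
        · exact if_pos ⟨hA, h1⟩
        · rw [hi hA]; simp [trunc, hi hA]
      rw [e1, e2, sub_self, abs_zero]
      positivity
  · have e1 : trunc X A κ j ω = 0 := if_neg fun h => hjA h.1
    rw [e1, hj hjA, if_neg hjA]
    simpa using t2

lemma measurable_truncFun (A : J → Finset J) (κ : ℝ) (i : J) :
    Measurable fun t : ℝ => if i ∈ A i ∧ |t| ≤ 1 / κ then t else 0 := by
  refine Measurable.ite ?_ measurable_id measurable_const
  by_cases h : i ∈ A i
  · simp only [h, true_and]
    exact measurableSet_le (by fun_prop) (by fun_prop)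
  · simp [h]

lemma LD1.trunc (h : LD1 μ X A) : LD1 μ (trunc X A κ) A := h.comp (measurable_truncFun A κ)

lemma LD2.trunc (h : LD2 μ X A B) : LD2 μ (LocalDep.trunc X A κ) A B :=
  h.comp (measurable_truncFun A κ)

end Truncation

/-- Centred square-integrable locally dependent variables with `Var S = 1`. -/
structure Std [Fintype J] [DecidableEq J] (μ : Measure Ω) (X : J → Ω → ℝ) (A B : J → Finset J)
    (κ : ℝ) : Prop where
  meas : ∀ i, Measurable (X i)
  memLp : ∀ i, MemLp (X i) 2 μ
  mean : ∀ i, ∫ ω, X i ω ∂μ = 0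
  ld1 : LD1 μ X A
  ld2 : LD2 μ X A B
  kappa : KappaBound A B κ
  sigma_eq : sigma μ X = 1

namespace Std

variable [Fintype J] [DecidableEq J] [IsProbabilityMeasure μ]

lemma nbhds (h : Std μ X A B κ) : Nbhds A B κ := ⟨h.kappa, fun i => (h.ld2 i).1⟩

/-- If `i ∉ A i`, then (LD1) makes `X i` independent of itself; being centred, it has second moment
zero. -/
lemma ae_eq_zero (h : Std μ X A B κ) : ∀ᵐ ω ∂μ, ∀ i, i ∉ A i → X i ω = 0 := by
  rw [ae_all_iff]
  intro i
  by_cases hi : i ∈ A i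
  · exact Filter.Eventually.of_forall fun ω h' => absurd hi h'
  · have h1 : ∫ ω, X i ω * X i ω ∂μ = 0 := by
      rw [h.ld1.integral_mul h.meas hi, h.mean, zero_mul]
    have h2 := (integral_eq_zero_iff_of_nonneg (fun ω => mul_self_nonneg (X i ω))
      ((h.memLp i).integrable_mul (h.memLp i))).1 h1
    filter_upwards [h2] with ω hω _
    exact mul_self_eq_zero.1 hω

lemma integrable (h : Std μ X A B κ) (i : J) : Integrable (X i) μ :=
  (h.memLp i).integrable one_le_two

lemma integrable_mul (h : Std μ X A B κ) (i j : J) : Integrable (fun ω => X i ω * X j ω) μ :=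
  (h.memLp i).integrable_mul (h.memLp j)

lemma integral_sq_S (h : Std μ X A B κ) : ∫ ω, S X ω ^ 2 ∂μ = 1 := by
  have h1 : ∫ ω, S X ω ∂μ = 0 := by
    unfold S
    rw [integral_finsetSum _ fun i _ => h.integrable i]
    exact Finset.sum_eq_zero fun i _ => h.mean i
  have hm : Measurable (S X) := Finset.measurable_fun_sum _ fun i _ => h.meas i
  have h2 := variance_of_integral_eq_zero hm.aemeasurable h1
  have h3 := h.sigma_eq
  rw [sigma, Real.sqrt_eq_one] at h3
  rw [← h3, h2]

lemma sum_integral_mul (h : Std μ X A B κ) :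
    ∑ i, ∑ j ∈ A i, ∫ ω, X i ω * X j ω ∂μ = 1 := by
  have e : ∀ ω, S X ω ^ 2 = ∑ i, ∑ j, X i ω * X j ω := fun ω => by
    rw [sq, S, Finset.sum_mul_sum]
  have h1 := h.integral_sq_S
  simp_rw [e] at h1
  rw [integral_finsetSum _ fun i _ => integrable_finsetSum _ fun j _ => h.integrable_mul i j] at h1
  rw [← h1]
  refine Finset.sum_congr rfl fun i _ => ?_
  rw [integral_finsetSum _ fun j _ => h.integrable_mul i j]
  refine Finset.sum_subset (Finset.subset_univ _) fun j _ hj => ?_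
  rw [h.ld1.integral_mul h.meas hj, h.mean, zero_mul]

/-- An index with `i ∈ A i` is counted in its own overlap set. If there is none, then `S = 0` almost
surely, against unit variance. -/
lemma one_le (h : Std μ X A B κ) : 1 ≤ κ := by
  by_cases hA : ∃ i, i ∈ A i
  · obtain ⟨i, hi⟩ := hA
    refine le_trans ?_ (h.kappa i).1
    have h1 : 0 < (Finset.univ.filter fun j => (B i ∩ A j).Nonempty).card :=
      Finset.card_pos.2 ⟨i, Finset.mem_filter.2 ⟨Finset.mem_univ _, i,
        Finset.mem_inter.2 ⟨h.nbhds.sub i hi, hi⟩⟩⟩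
    exact_mod_cast h1
  · push Not at hA
    have h1 : ∀ᵐ ω ∂μ, S X ω ^ 2 = 0 := by
      filter_upwards [h.ae_eq_zero] with ω hω
      rw [S, Finset.sum_eq_zero fun i _ => hω i (hA i)]
      simp
    have h2 := h.integral_sq_S
    rw [integral_congr_ae h1] at h2
    simp at h2

lemma kappa_pos (h : Std μ X A B κ) : 0 < κ := one_pos.trans_le h.one_le

lemma measurable_trunc (h : Std μ X A B κ) (i : J) : Measurable (trunc X A κ i) :=
  (measurable_truncFun A κ i).comp (h.meas i)

lemma locDep (h : Std μ X A B κ) : LocDep μ (trunc X A κ) A B κ where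
  meas := h.measurable_trunc
  small ω :=
    { toNbhds := h.nbhds
      one_le := h.one_le
      zero := fun _ hi => if_neg fun h' => hi h'.1
      bdd := fun i => mul_abs_trunc_le h.kappa_pos i ω }
  indep_A := h.ld1.trunc.indep_sig
  indep_B := h.ld2.trunc.indep_sig

lemma integrable_tail (h : Std μ X A B κ) (i : J) : Integrable (tail X κ i) μ := by
  have hm := h.meas i
  refine ((h.memLp i).integrable_sq).mono ?_ (Filter.Eventually.of_forall fun ω => ?_)
  · exact (Measurable.indicator (by fun_prop)
      (measurableSet_lt measurable_const hm.abs)).aestronglyMeasurable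
  · rw [Real.norm_of_nonneg (tail_nonneg _ _ _ _), Real.norm_of_nonneg (sq_nonneg _)]
    exact tail_le X κ i ω

lemma integral_tail_nonneg (i : J) : 0 ≤ ∫ ω, tail X κ i ω ∂μ :=
  integral_nonneg fun _ => tail_nonneg _ _ _ _

lemma beta0_eq (h : Std μ X A B κ) : beta0 μ X κ = ∑ i, μ.real {ω | 1 / κ < |X i ω|} := by
  rw [beta0, h.sigma_eq]

lemma beta2_eq (h : Std μ X A B κ) : beta2 μ X κ = ∑ i, ∫ ω, tail X κ i ω ∂μ := by
  rw [beta2, h.sigma_eq, one_pow, div_one, one_mul]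
  rfl

lemma sum_abs_integral_trunc_le (h : Std μ X A B κ) :
    ∑ i, |∫ ω, trunc X A κ i ω ∂μ| ≤ κ * beta2 μ X κ := by
  rw [h.beta2_eq, Finset.mul_sum]
  refine Finset.sum_le_sum fun i _ => ?_
  have hb := (h.locDep.bdd i).integrable (μ := μ)
  have e : ∫ ω, trunc X A κ i ω ∂μ = -∫ ω, (X i ω - trunc X A κ i ω) ∂μ := by
    rw [integral_sub (h.integrable i) hb, h.mean, zero_sub, neg_neg]
  rw [e, abs_neg, ← integral_const_mul]
  refine abs_integral_le_integral_abs.trans (integral_mono_ae ((h.integrable i).sub hb).abs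
    ((h.integrable_tail i).const_mul κ) ?_)
  filter_upwards [h.ae_eq_zero] with ω hω
  exact abs_sub_trunc_le h.kappa_pos (hω i)

lemma abs_integral_mul_sub_le (h : Std μ X A B κ) (i j : J) :
    |∫ ω, trunc X A κ i ω * trunc X A κ j ω ∂μ - ∫ ω, X i ω * X j ω ∂μ|
      ≤ (if j ∈ A j then ∫ ω, tail X κ i ω ∂μ else 0) + ∫ ω, tail X κ j ω ∂μ := by
  have hb := ((h.locDep.bdd i).mul (h.locDep.bdd j)).integrable (μ := μ)
  have hi : Integrable (fun ω => if j ∈ A j then tail X κ i ω else 0) μ := by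
    split_ifs
    · exact h.integrable_tail i
    · exact integrable_const 0
  have e : (if j ∈ A j then ∫ ω, tail X κ i ω ∂μ else 0)
      = ∫ ω, (if j ∈ A j then tail X κ i ω else 0) ∂μ := by
    split_ifs
    · rfl
    · simp
  rw [abs_sub_comm, ← integral_sub (h.integrable_mul i j) hb, e,
    ← integral_add hi (h.integrable_tail j)]
  refine abs_integral_le_integral_abs.trans (integral_mono_ae
    ((h.integrable_mul i j).sub hb).abs (hi.add (h.integrable_tail j)) ?_)
  filter_upwards [h.ae_eq_zero] with ω hω
  exact abs_mul_sub_trunc_le (hω i) (hω j)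

/-- The untruncated quadratic form has mean `E S² = 1`. The two tail terms contribute `κ β₂` each:
one by the number of active members of `A i`, the other because each `j` lies in at most `κ` of the
sets `A i`. -/
lemma abs_integral_quad_sub_one_le (h : Std μ X A B κ) :
    |∫ ω, quad (trunc X A κ) A ω ∂μ - 1| ≤ 2 * (κ * beta2 μ X κ) := by
  have hb := h.locDep.bdd
  have e : ∫ ω, quad (trunc X A κ) A ω ∂μ
      = ∑ i, ∑ j ∈ A i, ∫ ω, trunc X A κ i ω * trunc X A κ j ω ∂μ := by
    unfold quad Y
    simp_rw [Finset.mul_sum]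
    rw [BddMeas.integral_sum (by fun_prop)]
    exact Finset.sum_congr rfl fun i _ => BddMeas.integral_sum (by fun_prop)
  rw [e, ← h.sum_integral_mul, ← Finset.sum_sub_distrib]
  simp_rw [← Finset.sum_sub_distrib]
  refine (Finset.abs_sum_le_sum_abs _ _).trans ?_
  calc _ ≤ ∑ i, ∑ j ∈ A i, ((if j ∈ A j then ∫ ω, tail X κ i ω ∂μ else 0)
        + ∫ ω, tail X κ j ω ∂μ) := Finset.sum_le_sum fun i _ =>
        (Finset.abs_sum_le_sum_abs _ _).trans
          (Finset.sum_le_sum fun j _ => h.abs_integral_mul_sub_le i j)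
    _ = ∑ i, ((act A (A i)).card : ℝ) * ∫ ω, tail X κ i ω ∂μ
        + ∑ i, ∑ j ∈ A i, ∫ ω, tail X κ j ω ∂μ := by
        simp_rw [Finset.sum_add_distrib]
        congr 1
        refine Finset.sum_congr rfl fun i _ => ?_
        rw [← Finset.sum_filter, Finset.sum_const, nsmul_eq_mul, act]
    _ ≤ κ * beta2 μ X κ + κ * beta2 μ X κ := by
        rw [h.beta2_eq]
        refine add_le_add ?_ (h.nbhds.sum_sum_mem_A_le integral_tail_nonneg)
        rw [Finset.mul_sum]
        exact Finset.sum_le_sum fun i _ =>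
          mul_le_mul_of_nonneg_right (h.nbhds.card_act_A_le i) (integral_tail_nonneg i)
    _ = _ := by ring

lemma integral_cub_trunc_le (h : Std μ X A B κ) :
    ∫ ω, cub (trunc X A κ) κ ω ∂μ ≤ κ ^ 2 * beta3 μ X κ := by
  have hb := h.locDep.bdd
  unfold cub
  rw [integral_const_mul, BddMeas.integral_sum (by fun_prop), beta3, h.sigma_eq, one_pow, div_one,
    one_mul]
  refine mul_le_mul_of_nonneg_left (Finset.sum_le_sum fun i _ => ?_) (sq_nonneg κ)
  have hm := h.meas i
  refine BddMeas.integral_mono (by fun_prop) (BddMeas.of_bound (C := (1 / κ) ^ 3)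
    (Measurable.indicator (by fun_prop) (measurableSet_le (by fun_prop) (by fun_prop)))
    fun ω => ?_) (abs_trunc_cube_le i)
  have := h.kappa_pos
  simp only [Set.indicator, Set.mem_ofPred_eq]
  split_ifs with h1
  · rw [abs_pow, abs_abs]
    exact pow_le_pow_left₀ (abs_nonneg _) h1 3
  · rw [abs_zero]; positivity

lemma sum_integral_abs_mul_le (h : Std μ X A B κ) :
    ∑ i, ∑ j ∈ A i, ∫ ω, |trunc X A κ i ω * trunc X A κ j ω| ∂μ ≤ theta μ X A κ := by
  have hb := h.locDep.bdd
  have hκ := h.kappa_pos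
  rw [theta, h.sigma_eq, one_pow, div_one, one_mul]
  refine Finset.sum_le_sum fun i _ => Finset.sum_le_sum fun j _ => ?_
  have hi := h.meas i
  have hj := h.meas j
  refine BddMeas.integral_mono (by fun_prop) (BddMeas.abs (BddMeas.of_bound (C := (1 / κ) ^ 2)
    (Measurable.indicator (by fun_prop) ((measurableSet_le hi.abs measurable_const).inter
      (measurableSet_le hj.abs measurable_const))) fun ω => ?_)) (abs_trunc_mul_le i j)
  simp only [Set.indicator, Set.mem_ofPred_eq]
  split_ifs with h1
  · rw [abs_mul, sq]
    exact mul_le_mul h1.1 h1.2 (abs_nonneg _) (by positivity)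
  · rw [abs_zero]; positivity

lemma normDep (h : Std μ X A B κ) (hb : κ * beta2 μ X κ ≤ 1 / 16) {r : ℝ}
    (hr : κ ^ 2 * beta3 μ X κ ≤ r) :
    NormDep μ (trunc X A κ) A B κ (κ * beta2 μ X κ) r (theta μ X A κ) where
  toLocDep := h.locDep
  sum_mean := h.sum_abs_integral_trunc_le
  mean_quad := h.abs_integral_quad_sub_one_le
  b_le := hb
  cub_le := h.integral_cub_trunc_le.trans hr
  theta_le := by
    have hb := h.locDep.bdd
    refine le_trans (Finset.sum_le_sum fun i _ => ?_) h.sum_integral_abs_mul_le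
    rw [← BddMeas.integral_sum (by fun_prop)]
    refine BddMeas.integral_mono (h.locDep.bdd_wt i) (by fun_prop) fun ω => ?_
    rw [wt, Y, Finset.mul_sum]
    exact Finset.abs_sum_le_sum_abs _ _

/-- The event on which the truncation acts. -/
def truncSet (X : J → Ω → ℝ) (A : J → Finset J) (κ : ℝ) : Set Ω :=
  (⋃ i, {ω | 1 / κ < |X i ω|}) ∪ {ω | ¬ ∀ i, i ∉ A i → X i ω = 0}

lemma measureReal_truncSet_le (h : Std μ X A B κ) : μ.real (truncSet X A κ) ≤ beta0 μ X κ := by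
  have h0 : μ.real {ω | ¬ ∀ i, i ∉ A i → X i ω = 0} = 0 := by
    rw [measureReal_eq_zero_iff]
    exact ae_iff.1 h.ae_eq_zero
  rw [h.beta0_eq]
  refine (measureReal_union_le _ _).trans ?_
  rw [h0, add_zero]
  exact measureReal_iUnion_fintype_le _

lemma trunc_eq {ω : Ω} (hω : ω ∉ truncSet X A κ) (i : J) : trunc X A κ i ω = X i ω := by
  simp only [truncSet, Set.mem_union, Set.mem_iUnion, Set.mem_ofPred_eq, not_or, not_exists,
    not_lt, not_not] at hω
  by_cases hi : i ∈ A i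
  · exact if_pos ⟨hi, hω.1 i⟩
  · simp [trunc, hω.2 i hi]

/-- The centring terms add up to `|J| * X̄ * Ȳ = S * Ȳ`. Positivity of the radicand gives `V ≠ 0`,
so the convention for `V = 0` plays no role here. -/
lemma W_eq [Nonempty J] {w₀ : Ω → ℝ} {ω : Ω} (hω : ω ∉ truncSet X A κ)
    (hpos : 0 < quad (trunc X A κ) A ω - S (trunc X A κ) ω * avg (Y (trunc X A κ) A) ω) :
    W X A w₀ ω = S (trunc X A κ) ω
      / √(quad (trunc X A κ) A ω - S (trunc X A κ) ω * avg (Y (trunc X A κ) A) ω) := by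
  have hn : (Fintype.card J : ℝ) ≠ 0 := by positivity
  have e : ∑ i, (X i ω * Y X A i ω - avg X ω * avg (Y X A) ω)
      = quad (trunc X A κ) A ω - S (trunc X A κ) ω * avg (Y (trunc X A κ) A) ω := by
    simp only [quad, S, avg, Y, trunc_eq hω, Finset.sum_sub_distrib, Finset.sum_const,
      Finset.card_univ, nsmul_eq_mul]
    field_simp
  have eV : V X A ω
      = √(quad (trunc X A κ) A ω - S (trunc X A κ) ω * avg (Y (trunc X A κ) A) ω) := by
    rw [V, e, max_eq_left hpos.le]
  have eS : S (trunc X A κ) ω = S X ω := Finset.sum_congr rfl fun i _ => trunc_eq hω i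
  rw [W, if_neg (by rw [eV]; exact (Real.sqrt_pos.2 hpos).ne'), eV, eS]

lemma card_pos (h : Std μ X A B κ) : Nonempty J := by
  by_contra hJ
  rw [not_nonempty_iff] at hJ
  simpa using h.sum_integral_mul

lemma abs_measureReal_W_sub_Phi_le (h : Std μ X A B κ) (w₀ : Ω → ℝ) (z : ℝ) :
    |μ.real {ω | W X A w₀ ω ≤ z} - Phi z|
      ≤ 300000 * ((1 + theta μ X A κ) * κ ^ 2 * beta3 μ X κ + κ * beta2 μ X κ + beta0 μ X κ)
        + 300000 * κ ^ (1 / 2 : ℝ) * (theta μ X A κ + 1)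
          * (Fintype.card J : ℝ) ^ (-(1 / 2) : ℝ) := by
  have hJ := h.card_pos
  have hκ := h.kappa_pos
  have hn : 0 < (Fintype.card J : ℝ) := by positivity
  set ρ := √(κ / Fintype.card J) with hρ
  have hρ0 : 0 < ρ := Real.sqrt_pos.2 (by positivity)
  have e : κ ^ (1 / 2 : ℝ) * (Fintype.card J : ℝ) ^ (-(1 / 2) : ℝ) = ρ := by
    rw [hρ, Real.sqrt_eq_rpow, Real.div_rpow hκ.le hn.le, Real.rpow_neg hn.le, ← div_eq_mul_inv]
  have hθ0 : 0 ≤ theta μ X A κ := le_trans (Finset.sum_nonneg fun i _ =>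
    Finset.sum_nonneg fun j _ => integral_nonneg fun _ => abs_nonneg _) h.sum_integral_abs_mul_le
  have hβ0 : 0 ≤ beta0 μ X κ := measureReal_nonneg.trans h.measureReal_truncSet_le
  have hβ2 : 0 ≤ κ * beta2 μ X κ :=
    (Finset.sum_nonneg fun _ _ => abs_nonneg _).trans h.sum_abs_integral_trunc_le
  have hβ3 : 0 ≤ κ ^ 2 * beta3 μ X κ :=
    (integral_nonneg fun ω => cub_nonneg _ _ _).trans h.integral_cub_trunc_le
  set b := κ * beta2 μ X κ with hb
  set c := κ ^ 2 * beta3 μ X κ with hc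
  set θ := theta μ X A κ with hθ
  have e2 : 300000 * ((1 + θ) * κ ^ 2 * beta3 μ X κ + b + beta0 μ X κ)
      + 300000 * κ ^ (1 / 2 : ℝ) * (θ + 1) * (Fintype.card J : ℝ) ^ (-(1 / 2) : ℝ)
      = 300000 * ((1 + θ) * (c + ρ) + b) + 300000 * beta0 μ X κ := by
    rw [← e, hc]; ring
  rw [e2]
  have hcθ : 0 ≤ θ * (c + ρ) := by positivity
  -- Taking `r = c + ρ` makes `r` positive and at least `ρ`, as the window argument and the
  -- perturbation step require. If either smallness condition fails, the right-hand side already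
  -- exceeds 1.
  by_cases hsmall : b ≤ 1 / 16 ∧ c + ρ ≤ 1 / 96
  · have hN := h.normDep hsmall.1 (r := c + ρ) (by linarith)
    have h1 := hN.abs_measureReal_sub_Phi_le h.sum_integral_abs_mul_le hρ0 (by linarith) hsmall.2
      (Real.sq_sqrt (by positivity)).symm (w := W X A w₀) (N := truncSet X A κ)
      (fun ω hω hpos => W_eq hω hpos) z
    linarith [h.measureReal_truncSet_le]
  · have h1 : |μ.real {ω | W X A w₀ ω ≤ z} - Phi z| ≤ 1 := by
      have h2 : μ.real {ω | W X A w₀ ω ≤ z} ≤ 1 := measureReal_le_one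
      have h3 : 0 ≤ μ.real {ω | W X A w₀ ω ≤ z} := measureReal_nonneg
      have h4 := Phi_nonneg z
      have h5 := Phi_le_one z
      rw [abs_le]
      constructor <;> linarith
    refine h1.trans ?_
    rw [not_and_or, not_le, not_le] at hsmall
    rcases hsmall with h2 | h2 <;> linarith

end Std

/-! ### Reduction to unit variance. -/

section Scaling

variable [Fintype J] [IsProbabilityMeasure μ]

/-- The family divided by the standard deviation of its sum. -/
def normalize (μ : Measure Ω) (X : J → Ω → ℝ) (i : J) (ω : Ω) : ℝ := X i ω / sigma μ X

lemma S_normalize (X : J → Ω → ℝ) (ω : Ω) : S (normalize μ X) ω = S X ω / sigma μ X :=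
  (Finset.sum_div _ _ _).symm

lemma Y_normalize (X : J → Ω → ℝ) (A : J → Finset J) (i : J) (ω : Ω) :
    Y (normalize μ X) A i ω = Y X A i ω / sigma μ X := (Finset.sum_div _ _ _).symm

lemma sigma_normalize (hσ : 0 < sigma μ X) : sigma μ (normalize μ X) = 1 := by
  have h1 : S (normalize μ X) = fun ω => (sigma μ X)⁻¹ * S X ω :=
    funext fun ω => by rw [S_normalize, div_eq_inv_mul]
  rw [sigma, h1, variance_const_mul, Real.sqrt_mul (sq_nonneg _), Real.sqrt_sq (inv_nonneg.2 hσ.le)]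
  exact inv_mul_cancel₀ hσ.ne'

lemma V_normalize (hσ : 0 < sigma μ X) (ω : Ω) :
    V (normalize μ X) A ω = V X A ω / sigma μ X := by
  have e : ∑ i, (normalize μ X i ω * Y (normalize μ X) A i ω
        - avg (normalize μ X) ω * avg (Y (normalize μ X) A) ω)
      = (∑ i, (X i ω * Y X A i ω - avg X ω * avg (Y X A) ω)) / sigma μ X ^ 2 := by
    rw [Finset.sum_div]
    refine Finset.sum_congr rfl fun i _ => ?_
    simp only [avg, Y_normalize, normalize, ← Finset.sum_div]
    field_simp
  have e2 : max ((∑ i, (X i ω * Y X A i ω - avg X ω * avg (Y X A) ω)) / sigma μ X ^ 2) 0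
      = max (∑ i, (X i ω * Y X A i ω - avg X ω * avg (Y X A) ω)) 0 / sigma μ X ^ 2 := by
    rw [← max_div_div_right (by positivity), zero_div]
  rw [V, V, e, e2, Real.sqrt_div' _ (by positivity), Real.sqrt_sq hσ.le]

lemma W_normalize (hσ : 0 < sigma μ X) (w₀ : Ω → ℝ) :
    W (normalize μ X) A w₀ = W X A w₀ := by
  funext ω
  rw [W, W, V_normalize hσ, S_normalize, div_div_div_cancel_right₀ hσ.ne']
  simp [hσ.ne']

lemma abs_normalize (hσ : 0 < sigma μ X) (i : J) (ω : Ω) :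
    |normalize μ X i ω| = |X i ω| / sigma μ X := by
  rw [normalize, abs_div, abs_of_pos hσ]

lemma lt_abs_normalize_iff (hσ : 0 < sigma μ X) {i : J} {ω : Ω} :
    1 / κ < |normalize μ X i ω| ↔ sigma μ X / κ < |X i ω| := by
  rw [abs_normalize hσ, lt_div_iff₀ hσ, one_div_mul_eq_div]

lemma abs_normalize_le_iff (hσ : 0 < sigma μ X) {i : J} {ω : Ω} :
    |normalize μ X i ω| ≤ 1 / κ ↔ |X i ω| ≤ sigma μ X / κ := by
  rw [abs_normalize hσ, div_le_iff₀ hσ, one_div_mul_eq_div]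

lemma beta0_normalize (hσ : 0 < sigma μ X) : beta0 μ (normalize μ X) κ = beta0 μ X κ := by
  simp only [beta0, sigma_normalize hσ, lt_abs_normalize_iff hσ]

lemma beta2_normalize (hσ : 0 < sigma μ X) : beta2 μ (normalize μ X) κ = beta2 μ X κ := by
  simp only [beta2, sigma_normalize hσ, lt_abs_normalize_iff hσ, one_pow, div_one, one_mul,
    Finset.mul_sum]
  refine Finset.sum_congr rfl fun i _ => ?_
  rw [← integral_const_mul]
  refine integral_congr_ae (Filter.Eventually.of_forall fun ω => ?_)
  simp only [Set.indicator]
  split_ifs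
  · rw [abs_normalize hσ]
    field_simp
  · simp

lemma beta3_normalize (hσ : 0 < sigma μ X) : beta3 μ (normalize μ X) κ = beta3 μ X κ := by
  simp only [beta3, sigma_normalize hσ, abs_normalize_le_iff hσ, one_pow, div_one, one_mul,
    Finset.mul_sum]
  refine Finset.sum_congr rfl fun i _ => ?_
  rw [← integral_const_mul]
  refine integral_congr_ae (Filter.Eventually.of_forall fun ω => ?_)
  simp only [Set.indicator]
  split_ifs
  · rw [abs_normalize hσ]
    field_simp
  · simp

lemma theta_normalize (hσ : 0 < sigma μ X) : theta μ (normalize μ X) A κ = theta μ X A κ := by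
  simp only [theta, sigma_normalize hσ, abs_normalize_le_iff hσ, one_pow, div_one, one_mul,
    Finset.mul_sum]
  refine Finset.sum_congr rfl fun i _ => Finset.sum_congr rfl fun j _ => ?_
  rw [← integral_const_mul]
  refine integral_congr_ae (Filter.Eventually.of_forall fun ω => ?_)
  simp only [Set.indicator]
  split_ifs
  · simp only [abs_mul, abs_normalize hσ]
    field_simp
  · simp

lemma std_normalize [DecidableEq J] (hX : ∀ i, Measurable (X i)) (hL : ∀ i, MemLp (X i) 2 μ)
    (h0 : ∀ i, ∫ ω, X i ω ∂μ = 0) (h1 : LD1 μ X A) (h2 : LD2 μ X A B) (hκ : KappaBound A B κ)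
    (hσ : 0 < sigma μ X) : Std μ (normalize μ X) A B κ where
  meas i := (hX i).div_const _
  memLp i := by
    have e : normalize μ X i = fun ω => (sigma μ X)⁻¹ * X i ω :=
      funext fun ω => div_eq_inv_mul _ _
    rw [e]
    exact (hL i).const_mul _
  mean i := by simp only [normalize, integral_div, h0, zero_div]
  ld1 := h1.comp fun _ => measurable_id.div_const _
  ld2 := h2.comp fun _ => measurable_id.div_const _
  kappa := hκ
  sigma_eq := sigma_normalize hσ

end Scaling
end
end LocalDep

theorem theorem2p1 :
    ∃ C : ℝ, 0 < C ∧
      ∀ (J : Type*) [Fintype J] [DecidableEq J]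
        (Ω : Type*) [MeasurableSpace Ω] (μ : Measure Ω) [IsProbabilityMeasure μ]
        (X : J → Ω → ℝ) (A B : J → Finset J) (κ : ℝ) (w₀ : Ω → ℝ),
        (∀ i, Measurable (X i)) →
        (∀ i, MemLp (X i) 2 μ) →
        (∀ i, ∫ ω, X i ω ∂μ = 0) →
        LocalDep.LD1 μ X A →
        LocalDep.LD2 μ X A B →
        LocalDep.KappaBound A B κ →
        0 < LocalDep.sigma μ X →
        Measurable w₀ →
        ∀ z : ℝ,
          |μ.real {ω | LocalDep.W X A w₀ ω ≤ z} - cdf (gaussianReal 0 1) z| ≤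
            C * ((1 + LocalDep.theta μ X A κ) * κ ^ 2 * LocalDep.beta3 μ X κ
                + κ * LocalDep.beta2 μ X κ + LocalDep.beta0 μ X κ)
              + C * κ ^ (1 / 2 : ℝ) * (LocalDep.theta μ X A κ + 1)
                * (Fintype.card J : ℝ) ^ (-(1 / 2) : ℝ) := by
  refine ⟨300000, by norm_num, ?_⟩
  intro J _ _ Ω _ μ _ X A B κ w₀ hX hL h0 h1 h2 hκ hσ _ z
  have h := (LocalDep.std_normalize hX hL h0 h1 h2 hκ hσ).abs_measureReal_W_sub_Phi_le w₀ z
  rw [LocalDep.W_normalize hσ, LocalDep.beta0_normalize hσ, LocalDep.beta2_normalize hσ,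
    LocalDep.beta3_normalize hσ, LocalDep.theta_normalize hσ] at h
  exact h
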